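/- Let $X$ be a compact connected complex surface, $B$ a compact connected Riemann surface, and let $f:X\to B$ be a semi-stable fibration of genus $g$: a surjective holomorphic map all of whose (scheme-theoretic) fibres $X_s=f^{-1}(s)$ are semi-stable curves and whose general fibre is a smooth curve of genus $g$. Here a semi-stable curve is a connected reduced compact curve whose only singularities are ordinary double points and each of whose smooth rational components meets the union of the other components in at least two points. For a topological space $Y$ with finite-dimensional total rational homology let $e(Y)=\sum_n(-1)^n\dim_{\mathbb Q}H_n(Y;\mathbb Q)$ denote its Euler number. Then for every $s\in B$ and every smooth fibre $X_{\rm gen}$ of $f$ the fibres $X_s$ and $X_{\rm gen}$ have finite-dimensional total rational homology, $X_s$ has only finitely many double points, and \[ \delta_s:=e(X_s)-e(X_{\rm gen})=\#\{\text{double points of }X_s\}. \] -/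

import Mathlib

open scoped Manifold ContDiff

universe u

noncomputable section

namespace SurfaceFibration

/-! ### Euler numbers -/

/-- The rational singular chain complex of a topological space. -/
def singularChains (Y : Type u) [TopologicalSpace Y] : ChainComplex (ModuleCat.{u} ℚ) ℕ :=
  ((AlgebraicTopology.singularChainComplexFunctor (ModuleCat.{u} ℚ)).obj
    (ModuleCat.of ℚ (ULift.{u} ℚ))).obj (TopCat.of Y)

/-- Rational singular homology `H_n(Y; ℚ)`. -/
abbrev singularHomology (n : ℕ) (Y : Type u) [TopologicalSpace Y] : ModuleCat.{u} ℚ :=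
  (singularChains Y).homology n

/-- The total rational homology of `Y` is finite dimensional, so that its Euler number is
defined. -/
def HasFiniteHomology (Y : Type u) [TopologicalSpace Y] : Prop :=
  (∀ n, Module.Finite ℚ (singularHomology n Y)) ∧
    ∃ N : ℕ, ∀ n, N < n → Subsingleton (singularHomology n Y)

/-- The Euler number `e(Y) = ∑ (-1)^n dim H_n(Y; ℚ)`. -/
def eulerNumber (Y : Type u) [TopologicalSpace Y] : ℤ :=
  (singularChains Y).homologyEulerChar

/-- The genus condition for compact connected Riemann surfaces: the first Betti number is `2g`. -/
def HasGenus (g : ℕ) (Y : Type u) [TopologicalSpace Y] : Prop :=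
  Module.finrank ℚ (singularHomology 1 Y) = 2 * g

/-! ### Fibres of a map from a complex surface to a complex curve -/

section

variable {X B : Type u} [TopologicalSpace X] [ChartedSpace (ℂ × ℂ) X]
  [TopologicalSpace B] [ChartedSpace ℂ B]

/-- The fibre `X_s` as a subset of `X` (with the subspace topology). -/
def fibre (f : X → B) (s : B) : Set X := f ⁻¹' {s}

/-- `f` is submersive at `p`, i.e. the analytic fibre through `p` is reduced and smooth at `p`. -/
def IsSmoothPoint (f : X → B) (p : X) : Prop :=
  mfderiv 𝓘(ℂ, ℂ × ℂ) 𝓘(ℂ, ℂ) f p ≠ 0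

/-- The analytic fibre through `p` has an ordinary double point at `p`: in suitable holomorphic
coordinates `(x, y)` of the surface centred at `p`, the local equation of the fibre (the function
`t ∘ f - t (f p)` for a local coordinate `t` of the base curve at `f p`) is `x * y`. -/
def IsDoublePoint (f : X → B) (p : X) : Prop :=
  ∃ φ ∈ IsManifold.maximalAtlas 𝓘(ℂ, ℂ × ℂ) ω X, p ∈ φ.source ∧ φ p = 0 ∧
    ∀ q ∈ φ.source, f q ∈ (chartAt ℂ (f p)).source ∧
      chartAt ℂ (f p) (f q) - chartAt ℂ (f p) (f p) = (φ q).1 * (φ q).2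

/-- The double points of `X_s`. -/
def doublePoints (f : X → B) (s : B) : Set X := {p ∈ fibre f s | IsDoublePoint f p}

/-- The fibre `X_s` is reduced and smooth. -/
def IsSmoothFibre (f : X → B) (s : B) : Prop := ∀ p ∈ fibre f s, IsSmoothPoint f p

/-- The irreducible components of a fibre `X_s` which is reduced with at most ordinary double
points: the closures of the connected components of the complement of the double points. -/
def fibreComponents (f : X → B) (s : B) : Set (Set X) :=
  {C | ∃ p ∈ fibre f s \ doublePoints f s,
    C = closure (connectedComponentIn (fibre f s \ doublePoints f s) p)}

/-- `X_s` is a semi-stable curve: it is connected, reduced, its only singularities are ordinary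
double points, and every smooth rational component meets the union of the other components in at
least two points. (Among the irreducible components of such a curve the smooth rational ones are
exactly those homeomorphic to the Riemann sphere.) -/
structure IsSemistableFibre (f : X → B) (s : B) : Prop where
  connected : IsConnected (fibre f s)
  nodal : ∀ p ∈ fibre f s, IsSmoothPoint f p ∨ IsDoublePoint f p
  rational : ∀ C ∈ fibreComponents f s, Nonempty (C ≃ₜ OnePoint ℂ) →
    2 ≤ (C ∩ ⋃₀ (fibreComponents f s \ {C})).encard

/-- A semi-stable genus `g` fibration: a surjective holomorphic map from a complex surface to a
complex curve all of whose fibres are semi-stable, with a smooth fibre of genus `g`. -/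
structure IsSemistableFibration (g : ℕ) (f : X → B) : Prop where
  holomorphic : ContMDiff 𝓘(ℂ, ℂ × ℂ) 𝓘(ℂ, ℂ) ω f
  surjective : Function.Surjective f
  semistable : ∀ s, IsSemistableFibre f s
  genus : ∃ t, IsSmoothFibre f t ∧ HasGenus g (fibre f t)

end

end SurfaceFibration

end

/-!
Near a double point the nearby fibre is a conic `x * y = c` in a bidisc, and damping its equation
to `x * y = c * σ`, with a cutoff `σ` vanishing near the centre, replaces an annulus, of Euler
number `0`, by a contractible cone, of Euler number `1`. By Mayer–Vietoris, passing from the fibre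
over `c` to the damped fibre adds `1` to the Euler number for each double point. The damped fibre
is also a deformation of `X_s`: near the double points the two agree, and elsewhere `F = c * σ` is,
in a chart in which `F` is a coordinate, the graph of the fixed point of a contraction depending on
`c`, so that cutting off `σ` one chart at a time moves one to the other by homeomorphisms. Only
local Lipschitz charts are needed, neither Ehresmann's theorem nor a triangulation. Hence
`e(X_s)` minus the number of double points of `X_s` is locally constant in `s`, and `B` is
connected.

Excision enters through the subdivision of singular chains. The homology of a smooth fibre is
finite dimensional because each compact subset has neighbourhoods whose inclusions into a given
one have finite rank on homology, a property which holds in charts and passes to unions by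
Mayer–Vietoris.
-/

noncomputable section

section

/-! ### Subdivision of formal affine simplices -/

/-- Formal chains of ordered `p`-tuples of points of `K`, where a `(p + 1)`-tuple stands for the
affine `p`-simplex it spans; the degree `p = 0` is the augmentation. -/
abbrev TupleChain (R K : Type*) [Ring R] (p : ℕ) := (Fin p → K) →₀ R

namespace TupleChain

open Finsupp (single)

variable {R K K' : Type*} [Ring R] {p : ℕ}

/-- The boundary of a formal chain: the alternating sum of its faces. -/
def boundary : TupleChain R K (p + 1) →ₗ[R] TupleChain R K p :=
  Finsupp.linearCombination R fun v =>
    ∑ i : Fin (p + 1), (-1 : R) ^ (i : ℕ) • single (v ∘ i.succAbove) 1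

/-- The cone over a formal chain with apex `a`. -/
def cone (a : K) : TupleChain R K p →ₗ[R] TupleChain R K (p + 1) :=
  Finsupp.lmapDomain R R fun v => (Fin.cons a v : Fin (p + 1) → K)

/-- The map of formal chains induced by a map of points. -/
def map (φ : K → K') : TupleChain R K p →ₗ[R] TupleChain R K' p :=
  Finsupp.lmapDomain R R fun v => φ ∘ v

lemma apply_eq_of_single_one {ι M : Type*} [AddCommGroup M] [Module R M] (f g : (ι →₀ R) →ₗ[R] M)
    (h : ∀ i, f (single i 1) = g (single i 1)) (c : ι →₀ R) : f c = g c :=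
  LinearMap.congr_fun (Finsupp.lhom_ext' fun i => LinearMap.ext_ring (h i)) c

lemma boundary_single (v : Fin (p + 1) → K) :
    boundary (single v (1 : R)) =
      ∑ i : Fin (p + 1), (-1 : R) ^ (i : ℕ) • single (v ∘ i.succAbove) (1 : R) := by
  simp [boundary]

lemma cone_single (a : K) (v : Fin p → K) :
    cone a (single v (1 : R)) = single (Fin.cons a v) 1 := by
  simp [cone]

lemma map_single (φ : K → K') (v : Fin p → K) :
    map φ (single v (1 : R)) = single (φ ∘ v) 1 := by
  simp [map]

lemma boundary_cone_zero (a : K) (c : TupleChain R K 0) : boundary (cone a c) = c := by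
  refine apply_eq_of_single_one (boundary ∘ₗ cone a) LinearMap.id (fun v => ?_) c
  rw [LinearMap.comp_apply, cone_single, boundary_single, Fin.sum_univ_one, LinearMap.id_apply,
    Fin.val_zero, pow_zero, one_smul]
  congr 1

lemma boundary_cone (a : K) (c : TupleChain R K (p + 1)) :
    boundary (cone a c) = c - cone a (boundary c) := by
  refine apply_eq_of_single_one (boundary ∘ₗ cone a) (LinearMap.id - cone a ∘ₗ boundary)
    (fun v => ?_) c
  simp only [LinearMap.comp_apply, cone_single, boundary_single, LinearMap.sub_apply,
    LinearMap.id_apply, map_sum, map_smul]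
  rw [Fin.sum_univ_succ, sub_eq_add_neg, ← Finset.sum_neg_distrib]
  congr 1
  · rw [Fin.val_zero, pow_zero, one_smul]
    congr 1
  · refine Finset.sum_congr rfl fun i _ => ?_
    rw [Fin.val_succ, pow_succ, mul_neg_one, neg_smul]
    congr 3
    funext j
    cases j using Fin.cases <;> simp

lemma single_eq_cone_tail (v : Fin (p + 1) → K) :
    single v (1 : R) = cone (v 0) (single (Fin.tail v) 1) := by
  rw [cone_single, Fin.cons_self_tail]

lemma boundary_boundary (c : TupleChain R K (p + 2)) : boundary (boundary c) = 0 := by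
  refine apply_eq_of_single_one (boundary ∘ₗ boundary) 0 (fun v => ?_) c
  rw [LinearMap.comp_apply, single_eq_cone_tail, boundary_cone, map_sub, LinearMap.zero_apply]
  clear c
  induction p with
  | zero => rw [boundary_cone_zero, sub_self]
  | succ p ih =>
    rw [boundary_cone, single_eq_cone_tail (Fin.tail v), boundary_cone, map_sub, ih, map_zero,
      sub_zero, sub_self]

lemma map_boundary (φ : K → K') (c : TupleChain R K (p + 1)) :
    map φ (boundary c) = boundary (map φ c) := by
  refine apply_eq_of_single_one (map φ ∘ₗ boundary) (boundary ∘ₗ map φ) (fun v => ?_) c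
  simp only [LinearMap.comp_apply, boundary_single, map_single, map_sum, map_smul]
  rfl

lemma map_cone (φ : K → K') (a : K) (c : TupleChain R K p) :
    map φ (cone a c) = cone (φ a) (map φ c) := by
  refine apply_eq_of_single_one (map φ ∘ₗ cone a) (cone (φ a) ∘ₗ map φ) (fun v => ?_) c
  simp only [LinearMap.comp_apply, cone_single, map_single]
  congr 1
  funext j
  cases j using Fin.cases <;> simp

section Subdivision

variable (b : ∀ p, (Fin (p + 1) → K) → K)

/-- Barycentric subdivision of formal chains, for a choice `b` of the barycentres: a simplex is
replaced by the cone from its barycentre over the subdivision of its boundary. -/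
def subdivision : ∀ p, TupleChain R K p →ₗ[R] TupleChain R K p
  | 0 => LinearMap.id
  | p + 1 => Finsupp.linearCombination R fun v =>
      cone (b p v) (subdivision p (boundary (single v 1)))

/-- The chain homotopy between the barycentric subdivision and the identity. -/
def subdivisionHomotopy : ∀ p, TupleChain R K p →ₗ[R] TupleChain R K (p + 1)
  | 0 => 0
  | p + 1 => Finsupp.linearCombination R fun v =>
      cone (b p v) (subdivision b (p + 1) (single v 1) - single v 1 -
        subdivisionHomotopy p (boundary (single v 1)))

lemma subdivision_single (v : Fin (p + 1) → K) :
    subdivision b (p + 1) (single v (1 : R)) =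
      cone (b p v) (subdivision b p (boundary (single v 1))) := by
  simp [subdivision]

lemma subdivisionHomotopy_single (v : Fin (p + 1) → K) :
    subdivisionHomotopy b (p + 1) (single v (1 : R)) =
      cone (b p v) (subdivision b (p + 1) (single v 1) - single v 1 -
        subdivisionHomotopy b p (boundary (single v 1))) := by
  simp [subdivisionHomotopy]

lemma boundary_subdivision (c : TupleChain R K (p + 1)) :
    boundary (subdivision b (p + 1) c) = subdivision b p (boundary c) := by
  induction p with
  | zero =>
    refine apply_eq_of_single_one (boundary ∘ₗ subdivision b 1) (subdivision b 0 ∘ₗ boundary)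
      (fun v => ?_) c
    rw [LinearMap.comp_apply, LinearMap.comp_apply, subdivision_single, boundary_cone_zero]
  | succ p ih =>
    refine apply_eq_of_single_one (boundary ∘ₗ subdivision b (p + 2))
      (subdivision b (p + 1) ∘ₗ boundary) (fun v => ?_) c
    rw [LinearMap.comp_apply, LinearMap.comp_apply, subdivision_single, boundary_cone, ih,
      boundary_boundary, map_zero, map_zero, sub_zero]

lemma boundary_subdivisionHomotopy (c : TupleChain R K (p + 1)) :
    boundary (subdivisionHomotopy b (p + 1) c) =
      subdivision b (p + 1) c - c - subdivisionHomotopy b p (boundary c) := by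
  induction p with
  | zero =>
    refine apply_eq_of_single_one (boundary ∘ₗ subdivisionHomotopy b 1)
      (subdivision b 1 - LinearMap.id - subdivisionHomotopy b 0 ∘ₗ boundary) (fun v => ?_) c
    rw [LinearMap.comp_apply, subdivisionHomotopy_single, boundary_cone]
    simp only [map_sub, boundary_subdivision]
    simp [subdivisionHomotopy, subdivision]
  | succ p ih =>
    refine apply_eq_of_single_one (boundary ∘ₗ subdivisionHomotopy b (p + 2))
      (subdivision b (p + 2) - LinearMap.id - subdivisionHomotopy b (p + 1) ∘ₗ boundary)
      (fun v => ?_) c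
    have hcycle : boundary (subdivision b (p + 2) (single v 1) - single v 1 -
        subdivisionHomotopy b (p + 1) (boundary (single v (1 : R)))) = 0 := by
      rw [map_sub, map_sub, boundary_subdivision, ih, boundary_boundary, map_zero, sub_zero,
        sub_self]
    rw [LinearMap.comp_apply, subdivisionHomotopy_single, boundary_cone, hcycle, map_zero, sub_zero]
    rfl

variable {b} {b' : ∀ p, (Fin (p + 1) → K') → K'} {φ : K → K'}

lemma map_subdivision (hφ : ∀ p v, φ (b p v) = b' p (φ ∘ v)) (p : ℕ) (c : TupleChain R K p) :
    map φ (subdivision b p c) = subdivision b' p (map φ c) := by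
  induction p with
  | zero => rfl
  | succ p ih =>
    refine apply_eq_of_single_one (map φ ∘ₗ subdivision b (p + 1))
      (subdivision b' (p + 1) ∘ₗ map φ) (fun v => ?_) c
    rw [LinearMap.comp_apply, LinearMap.comp_apply, subdivision_single, map_cone, ih, map_boundary,
      hφ, map_single, subdivision_single]

lemma map_subdivisionHomotopy (hφ : ∀ p v, φ (b p v) = b' p (φ ∘ v)) (p : ℕ)
    (c : TupleChain R K p) :
    map φ (subdivisionHomotopy b p c) = subdivisionHomotopy b' p (map φ c) := by
  induction p with
  | zero => simp [subdivisionHomotopy]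
  | succ p ih =>
    refine apply_eq_of_single_one (map φ ∘ₗ subdivisionHomotopy b (p + 1))
      (subdivisionHomotopy b' (p + 1) ∘ₗ map φ) (fun v => ?_) c
    simp only [LinearMap.comp_apply, subdivisionHomotopy_single, map_cone, map_sub, ih,
      map_subdivision hφ, map_boundary, map_single, hφ]

end Subdivision

end TupleChain

end

section

/-! ### Subdivision of singular chains -/

namespace SingularChain

/-- The standard topological `n`-simplex. -/
abbrev TopSimplex (n : ℕ) : Type := stdSimplex ℝ (Fin (n + 1))

section ConvexComb

variable {ι κ μ : Type*} [Fintype ι] [Fintype κ] [Fintype μ]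

/-- The convex combination of the points `v i` of a simplex with weights `w i`, that is, the image
of `w` under the affine map with values `v i` at the vertices. -/
def convexComb (w : stdSimplex ℝ ι) (v : ι → stdSimplex ℝ κ) : stdSimplex ℝ κ :=
  ⟨fun k => ∑ i, w i * v i k,
    fun k => Finset.sum_nonneg fun i _ =>
      mul_nonneg (stdSimplex.zero_le _ _) (stdSimplex.zero_le _ _), by
    rw [Finset.sum_comm]
    simp only [← Finset.mul_sum, stdSimplex.sum_eq_one, mul_one]⟩

lemma convexComb_apply (w : stdSimplex ℝ ι) (v : ι → stdSimplex ℝ κ) (k : κ) :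
    convexComb w v k = ∑ i, w i * v i k := rfl

lemma convexComb_convexComb (w : stdSimplex ℝ ι) (v : ι → stdSimplex ℝ κ)
    (v' : κ → stdSimplex ℝ μ) :
    convexComb (convexComb w v) v' = convexComb w fun i => convexComb (v i) v' := by
  ext k
  simp only [convexComb_apply, Finset.sum_mul, Finset.mul_sum]
  rw [Finset.sum_comm]
  simp only [mul_assoc]

lemma convexComb_vertex [DecidableEq ι] (i : ι) (v : ι → stdSimplex ℝ κ) :
    convexComb (stdSimplex.vertex i) v = v i := by
  ext k
  simp [convexComb_apply, Pi.single_apply]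

lemma convexComb_vertices [DecidableEq ι] (w : stdSimplex ℝ ι) :
    convexComb w stdSimplex.vertex = w := by
  ext k
  simp [convexComb_apply, Pi.single_apply]

lemma map_eq_convexComb [DecidableEq κ] (f : ι → κ) (w : stdSimplex ℝ ι) :
    stdSimplex.map f w = convexComb w fun i => stdSimplex.vertex (f i) := by
  ext k
  simp [convexComb_apply, Pi.single_apply, FunOnFinite.linearMap_apply_apply, Finset.sum_filter,
    eq_comm]

lemma convexComb_map (f : ι → κ) (w : stdSimplex ℝ ι) (v : κ → stdSimplex ℝ μ) :
    convexComb (stdSimplex.map f w) v = convexComb w (v ∘ f) := by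
  classical
  rw [map_eq_convexComb, convexComb_convexComb]
  simp only [convexComb_vertex]
  rfl

lemma continuous_convexComb (v : ι → stdSimplex ℝ κ) :
    Continuous fun w : stdSimplex ℝ ι => convexComb w v := by
  refine Continuous.subtype_mk (continuous_pi fun k => continuous_finsetSum _ fun i _ => ?_) _
  exact ((continuous_apply i).comp continuous_subtype_val).mul continuous_const

lemma dist_convexComb_le_sum (w : stdSimplex ℝ ι) (v : ι → stdSimplex ℝ κ)
    (x : stdSimplex ℝ κ) : dist (convexComb w v) x ≤ ∑ i, w i * dist (v i) x := by
  have hcoord (y : stdSimplex ℝ κ) (k : κ) : |y k - x k| ≤ dist y x :=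
    dist_le_pi_dist y.1 x.1 k
  refine (dist_pi_le_iff (Finset.sum_nonneg fun i _ =>
    mul_nonneg (stdSimplex.zero_le w i) dist_nonneg)).2 fun k => ?_
  calc |convexComb w v k - x k| = |∑ i, w i * (v i k - x k)| := by
        simp only [mul_sub, Finset.sum_sub_distrib, ← Finset.sum_mul, stdSimplex.sum_eq_one,
          one_mul, convexComb_apply]
    _ ≤ ∑ i, |w i * (v i k - x k)| := Finset.abs_sum_le_sum_abs _ _
    _ ≤ ∑ i, w i * dist (v i) x := by
        refine Finset.sum_le_sum fun i _ => ?_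
        rw [abs_mul, abs_of_nonneg (stdSimplex.zero_le w i)]
        exact mul_le_mul_of_nonneg_left (hcoord _ k) (stdSimplex.zero_le w i)

lemma dist_convexComb_le {w : stdSimplex ℝ ι} {v : ι → stdSimplex ℝ κ} {x : stdSimplex ℝ κ}
    {r : ℝ} (h : ∀ i, dist (v i) x ≤ r) : dist (convexComb w v) x ≤ r :=
  calc dist (convexComb w v) x ≤ ∑ i, w i * dist (v i) x := dist_convexComb_le_sum w v x
    _ ≤ ∑ i, w i * r :=
        Finset.sum_le_sum fun i _ => mul_le_mul_of_nonneg_left (h i) (stdSimplex.zero_le w i)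
    _ = r := by rw [← Finset.sum_mul, stdSimplex.sum_eq_one, one_mul]

end ConvexComb

section Mesh

open Finsupp (single)
open TupleChain (subdivision)

/-- The barycentre of a tuple of points of a simplex. -/
def barycentre (n p : ℕ) (v : Fin (p + 1) → TopSimplex n) : TopSimplex n :=
  convexComb stdSimplex.barycenter v

variable {n p : ℕ} {δ : ℝ}

lemma dist_barycentre_le {v : Fin (p + 1) → TopSimplex n}
    (h : ∀ i j, dist (v i) (v j) ≤ δ) (j : Fin (p + 1)) :
    dist (barycentre n p v) (v j) ≤ p / (p + 1) * δ := by
  have hweight (i : Fin (p + 1)) :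
      (stdSimplex.barycenter : stdSimplex ℝ (Fin (p + 1))) i = ((p : ℝ) + 1)⁻¹ := by
    refine (stdSimplex.barycenter_apply i).trans ?_
    rw [Fintype.card_fin, Nat.cast_add_one]
  calc dist (barycentre n p v) (v j)
      ≤ ∑ i, ((p : ℝ) + 1)⁻¹ * dist (v i) (v j) := by
        refine (dist_convexComb_le_sum _ v (v j)).trans_eq (Finset.sum_congr rfl fun i _ => ?_)
        rw [hweight]
    _ = ∑ i ∈ Finset.univ.erase j, ((p : ℝ) + 1)⁻¹ * dist (v i) (v j) := by
        rw [← Finset.add_sum_erase _ _ (Finset.mem_univ j), dist_self, mul_zero, zero_add]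
    _ ≤ ∑ _i ∈ Finset.univ.erase j, ((p : ℝ) + 1)⁻¹ * δ :=
        Finset.sum_le_sum fun i _ => mul_le_mul_of_nonneg_left (h i j) (by positivity)
    _ = p / (p + 1) * δ := by
        rw [Finset.sum_const, Finset.card_erase_of_mem (Finset.mem_univ _), Finset.card_fin,
          nsmul_eq_mul, Nat.add_sub_cancel]
        ring

lemma map_mem_of_mem_supported {R ι M : Type*} [Ring R] [AddCommGroup M] [Module R M]
    {f : (ι →₀ R) →ₗ[R] M} {s : Set ι} {N : Submodule R M}
    (h : ∀ i ∈ s, f (single i 1) ∈ N) {c : ι →₀ R} (hc : c ∈ Finsupp.supported R R s) :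
    f c ∈ N := by
  have : Finsupp.supported R R s ≤ N.comap f := by
    rw [Finsupp.supported_eq_span_single, Submodule.span_le]
    rintro _ ⟨i, hi, rfl⟩
    exact h i hi
  exact this hc

/-- Tuples all of whose points are within distance `δ` of each other. -/
def tuplesOfDiamLE (n p : ℕ) (δ : ℝ) : Set (Fin p → TopSimplex n) :=
  {w | ∀ i j, dist (w i) (w j) ≤ δ}

/-- Tuples contained in every closed ball which contains the tuple `v`. -/
def tuplesInBallHull (v : Fin p → TopSimplex n) : Set (Fin p → TopSimplex n) :=
  {w | ∀ x r, (∀ j, dist (v j) x ≤ r) → ∀ i, dist (w i) x ≤ r}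

lemma cons_barycentre_mem_tuplesInBallHull {v : Fin (p + 1) → TopSimplex n} {i : Fin (p + 1)}
    {w : Fin p → TopSimplex n} (hw : w ∈ tuplesInBallHull (v ∘ i.succAbove)) :
    (Fin.cons (barycentre n p v) w : Fin (p + 1) → TopSimplex n) ∈ tuplesInBallHull v := by
  intro x r hx j
  cases j using Fin.cases with
  | zero => exact dist_convexComb_le hx
  | succ j => exact hw x r (fun _ => hx _) j

lemma cons_barycentre_mem_tuplesOfDiamLE {v : Fin (p + 1) → TopSimplex n}
    (hv : v ∈ tuplesOfDiamLE n (p + 1) δ) {i : Fin (p + 1)} {w : Fin p → TopSimplex n}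
    (hwball : w ∈ tuplesInBallHull (v ∘ i.succAbove))
    (hwdiam : w ∈ tuplesOfDiamLE n p (p / (p + 1) * δ)) :
    (Fin.cons (barycentre n p v) w : Fin (p + 1) → TopSimplex n) ∈
      tuplesOfDiamLE n (p + 1) (p / (p + 1) * δ) := by
  have hδ : 0 ≤ δ := dist_nonneg.trans (hv 0 0)
  have hapex (j : Fin p) : dist (w j) (barycentre n p v) ≤ p / (p + 1) * δ :=
    hwball _ _ (fun l => by rw [dist_comm]; exact dist_barycentre_le hv _) j
  intro j k
  cases j using Fin.cases with
  | zero =>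
    cases k using Fin.cases with
    | zero => rw [dist_self]; positivity
    | succ k => rw [dist_comm]; exact hapex k
  | succ j =>
    cases k using Fin.cases with
    | zero => exact hapex j
    | succ k => exact hwdiam j k

lemma tuplesOfDiamLE_mono {δ' : ℝ} (h : δ ≤ δ') : tuplesOfDiamLE n p δ ⊆ tuplesOfDiamLE n p δ' :=
  fun _ hw i j => (hw i j).trans h

variable {R : Type*} [Ring R]

lemma subdivision_single_mem_supported {v : Fin p → TopSimplex n} (hv : v ∈ tuplesOfDiamLE n p δ) :
    subdivision (barycentre n) p (single v (1 : R)) ∈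
      Finsupp.supported R R (tuplesInBallHull v ∩ tuplesOfDiamLE n p (p / (p + 1) * δ)) := by
  induction p with
  | zero =>
    exact Finsupp.single_mem_supported _ _ ⟨fun _ _ _ i => i.elim0, fun i => i.elim0⟩
  | succ p ih =>
    have hδ : 0 ≤ δ := dist_nonneg.trans (hv 0 0)
    have hratio : (p : ℝ) / (p + 1) ≤ ((p + 1 : ℕ) : ℝ) / ((p + 1 : ℕ) + 1) := by
      push_cast
      rw [div_le_div_iff₀ (by positivity) (by positivity)]
      nlinarith
    rw [TupleChain.subdivision_single, TupleChain.boundary_single, map_sum, map_sum]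
    refine Submodule.sum_mem _ fun i _ => ?_
    rw [map_smul, map_smul]
    refine Submodule.smul_mem _ _ (map_mem_of_mem_supported (fun w hw => ?_)
      (ih (v := v ∘ i.succAbove) fun _ _ => hv _ _))
    rw [TupleChain.cone_single]
    exact Finsupp.single_mem_supported _ _ ⟨cons_barycentre_mem_tuplesInBallHull hw.1,
      tuplesOfDiamLE_mono (by gcongr) (cons_barycentre_mem_tuplesOfDiamLE hv hw.1 hw.2)⟩

lemma subdivision_iterate_single_mem_supported {v : Fin p → TopSimplex n}
    (hv : v ∈ tuplesOfDiamLE n p δ) (k : ℕ) :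
    (subdivision (barycentre n) p)^[k] (single v (1 : R)) ∈
      Finsupp.supported R R (tuplesOfDiamLE n p ((p / (p + 1) : ℝ) ^ k * δ)) := by
  induction k with
  | zero => simpa using Finsupp.single_mem_supported R (1 : R) hv
  | succ k ih =>
    rw [Function.iterate_succ_apply', pow_succ', mul_assoc]
    exact map_mem_of_mem_supported (fun w hw => Finsupp.supported_mono Set.inter_subset_right
      (subdivision_single_mem_supported hw)) ih

end Mesh

end SingularChain

end

section

namespace SingularChain

open Finsupp (single)
open TupleChain (apply_eq_of_single_one)

variable {R : Type*} [Ring R] {Y : Type*} [TopologicalSpace Y] {n p q : ℕ}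

/-- Singular `n`-chains of `Y` with coefficients in `R`. -/
abbrev Chain (R : Type*) [Ring R] (Y : Type*) [TopologicalSpace Y] (n : ℕ) :=
  C(TopSimplex n, Y) →₀ R

/-- The inclusion of the `i`-th face of the standard simplex. -/
def face (n : ℕ) (i : Fin (n + 2)) : C(TopSimplex n, TopSimplex (n + 1)) :=
  ⟨stdSimplex.map i.succAbove, stdSimplex.continuous_map _⟩

/-- The singular boundary. -/
def boundary : Chain R Y (n + 1) →ₗ[R] Chain R Y n :=
  Finsupp.linearCombination R fun σ =>
    ∑ i : Fin (n + 2), (-1 : R) ^ (i : ℕ) • single (σ.comp (face n i)) 1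

lemma boundary_single (σ : C(TopSimplex (n + 1), Y)) :
    boundary (single σ (1 : R)) =
      ∑ i : Fin (n + 2), (-1 : R) ^ (i : ℕ) • single (σ.comp (face n i)) (1 : R) := by
  simp [boundary]

/-- The affine singular simplex with the given vertices. -/
def affineSimplex (v : Fin (p + 1) → TopSimplex n) : C(TopSimplex p, TopSimplex n) :=
  ⟨fun w => convexComb w v, continuous_convexComb v⟩

lemma affineSimplex_comp_face (v : Fin (p + 2) → TopSimplex n) (i : Fin (p + 2)) :
    (affineSimplex v).comp (face p i) = affineSimplex (v ∘ i.succAbove) := by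
  ext1 w
  exact convexComb_map _ _ _

lemma affineSimplex_comp_affineSimplex (v : Fin (p + 1) → TopSimplex n)
    (w : Fin (q + 1) → TopSimplex p) :
    (affineSimplex v).comp (affineSimplex w) = affineSimplex (affineSimplex v ∘ w) := by
  ext1 x
  exact convexComb_convexComb _ _ _

lemma affineSimplex_barycentre (v : Fin (p + 1) → TopSimplex n) (q : ℕ)
    (w : Fin (q + 1) → TopSimplex p) :
    affineSimplex v (barycentre p q w) = barycentre n q (affineSimplex v ∘ w) :=
  convexComb_convexComb _ _ _

/-- The tuple of the vertices of the standard simplex. -/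
def vertices (n : ℕ) : Fin (n + 1) → TopSimplex n := stdSimplex.vertex

lemma affineSimplex_vertices (n : ℕ) : affineSimplex (vertices n) = ContinuousMap.id _ := by
  ext1 w
  exact convexComb_vertices w

lemma affineSimplex_comp_vertices (v : Fin (p + 1) → TopSimplex n) :
    affineSimplex v ∘ vertices p = v := by
  funext i
  exact convexComb_vertex i v

/-- The singular chain in `Y` represented by a formal chain of tuples in the domain of `σ`. -/
def push (σ : C(TopSimplex n, Y)) : TupleChain R (TopSimplex n) (p + 1) →ₗ[R] Chain R Y p :=
  Finsupp.lmapDomain R R fun v => σ.comp (affineSimplex v)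

lemma push_single (σ : C(TopSimplex n, Y)) (v : Fin (p + 1) → TopSimplex n) :
    push σ (single v (1 : R)) = single (σ.comp (affineSimplex v)) 1 := by
  simp [push]

lemma push_vertices (σ : C(TopSimplex n, Y)) :
    push σ (single (vertices n) (1 : R)) = single σ 1 := by
  rw [push_single, affineSimplex_vertices, ContinuousMap.comp_id]

lemma boundary_push (σ : C(TopSimplex n, Y)) (c : TupleChain R (TopSimplex n) (p + 2)) :
    boundary (push σ c) = push σ (TupleChain.boundary c) := by
  refine apply_eq_of_single_one (boundary ∘ₗ push σ) (push σ ∘ₗ TupleChain.boundary)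
    (fun v => ?_) c
  simp only [LinearMap.comp_apply, push_single, boundary_single, TupleChain.boundary_single,
    map_sum, map_smul, ContinuousMap.comp_assoc, affineSimplex_comp_face]

lemma boundary_boundary (c : Chain R Y (n + 2)) : boundary (boundary c) = 0 := by
  refine apply_eq_of_single_one (boundary ∘ₗ boundary) 0 (fun σ => ?_) c
  rw [LinearMap.comp_apply, ← push_vertices, boundary_push, boundary_push,
    TupleChain.boundary_boundary, map_zero, LinearMap.zero_apply]

lemma push_comp_affineSimplex (σ : C(TopSimplex n, Y)) (v : Fin (p + 1) → TopSimplex n)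
    (c : TupleChain R (TopSimplex p) (q + 1)) :
    push (σ.comp (affineSimplex v)) c = push σ (TupleChain.map (affineSimplex v) c) := by
  refine apply_eq_of_single_one (push (σ.comp (affineSimplex v)))
    (push σ ∘ₗ TupleChain.map (affineSimplex v)) (fun w => ?_) c
  rw [LinearMap.comp_apply, TupleChain.map_single, push_single, push_single,
    ContinuousMap.comp_assoc, affineSimplex_comp_affineSimplex]

/-- Barycentric subdivision of singular chains. -/
def subdivision : Chain R Y n →ₗ[R] Chain R Y n :=
  Finsupp.linearCombination R fun σ =>
    push σ (TupleChain.subdivision (barycentre n) (n + 1) (single (vertices n) 1))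

/-- The chain homotopy between the barycentric subdivision of singular chains and the identity. -/
def subdivisionHomotopy : Chain R Y n →ₗ[R] Chain R Y (n + 1) :=
  Finsupp.linearCombination R fun σ =>
    push σ (TupleChain.subdivisionHomotopy (barycentre n) (n + 1) (single (vertices n) 1))

lemma subdivision_push (σ : C(TopSimplex n, Y)) (c : TupleChain R (TopSimplex n) (p + 1)) :
    subdivision (push σ c) = push σ (TupleChain.subdivision (barycentre n) (p + 1) c) := by
  refine apply_eq_of_single_one (subdivision ∘ₗ push σ)
    (push σ ∘ₗ TupleChain.subdivision (barycentre n) (p + 1)) (fun v => ?_) c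
  rw [LinearMap.comp_apply, LinearMap.comp_apply, push_single, subdivision,
    Finsupp.linearCombination_single, one_smul, push_comp_affineSimplex,
    TupleChain.map_subdivision (affineSimplex_barycentre v), TupleChain.map_single,
    affineSimplex_comp_vertices]

lemma subdivisionHomotopy_push (σ : C(TopSimplex n, Y))
    (c : TupleChain R (TopSimplex n) (p + 1)) :
    subdivisionHomotopy (push σ c) =
      push σ (TupleChain.subdivisionHomotopy (barycentre n) (p + 1) c) := by
  refine apply_eq_of_single_one (subdivisionHomotopy ∘ₗ push σ)
    (push σ ∘ₗ TupleChain.subdivisionHomotopy (barycentre n) (p + 1)) (fun v => ?_) c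
  rw [LinearMap.comp_apply, LinearMap.comp_apply, push_single, subdivisionHomotopy,
    Finsupp.linearCombination_single, one_smul, push_comp_affineSimplex,
    TupleChain.map_subdivisionHomotopy (affineSimplex_barycentre v), TupleChain.map_single,
    affineSimplex_comp_vertices]

lemma subdivision_iterate_push (σ : C(TopSimplex n, Y))
    (c : TupleChain R (TopSimplex n) (p + 1)) (k : ℕ) :
    subdivision^[k] (push σ c) =
      push σ ((TupleChain.subdivision (barycentre n) (p + 1))^[k] c) := by
  induction k with
  | zero => rfl
  | succ k ih =>
    rw [Function.iterate_succ_apply', ih, subdivision_push, Function.iterate_succ_apply']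

lemma boundary_subdivision (c : Chain R Y (n + 1)) :
    boundary (subdivision c) = subdivision (boundary c) := by
  refine apply_eq_of_single_one (boundary ∘ₗ subdivision) (subdivision ∘ₗ boundary)
    (fun σ => ?_) c
  rw [LinearMap.comp_apply, LinearMap.comp_apply, ← push_vertices, subdivision_push,
    boundary_push, boundary_push, subdivision_push, TupleChain.boundary_subdivision]

lemma boundary_subdivisionHomotopy_zero (c : Chain R Y 0) :
    boundary (subdivisionHomotopy c) = subdivision c - c := by
  refine apply_eq_of_single_one (boundary ∘ₗ subdivisionHomotopy) (subdivision - LinearMap.id)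
    (fun σ => ?_) c
  rw [LinearMap.comp_apply, LinearMap.sub_apply, ← push_vertices, subdivisionHomotopy_push,
    boundary_push, subdivision_push, TupleChain.boundary_subdivisionHomotopy, map_sub, map_sub,
    TupleChain.subdivisionHomotopy, LinearMap.zero_apply, map_zero, sub_zero, LinearMap.id_apply]

lemma boundary_subdivisionHomotopy (c : Chain R Y (n + 1)) :
    boundary (subdivisionHomotopy c) = subdivision c - c - subdivisionHomotopy (boundary c) := by
  refine apply_eq_of_single_one (boundary ∘ₗ subdivisionHomotopy)
    (subdivision - LinearMap.id - subdivisionHomotopy ∘ₗ boundary) (fun σ => ?_) c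
  rw [LinearMap.comp_apply, LinearMap.sub_apply, LinearMap.sub_apply, LinearMap.comp_apply,
    ← push_vertices, subdivisionHomotopy_push, boundary_push, subdivision_push, boundary_push,
    subdivisionHomotopy_push, TupleChain.boundary_subdivisionHomotopy, map_sub, map_sub,
    LinearMap.id_apply]

/-- The chains all of whose simplices lie in the set `U`. -/
def chainsIn (R : Type*) [Ring R] (U : Set Y) (n : ℕ) : Submodule R (Chain R Y n) :=
  Finsupp.supported R R {σ | ∀ x, σ x ∈ U}

variable {P U V : Set Y}

lemma push_mem_chainsIn {σ : C(TopSimplex n, Y)} (hσ : ∀ x, σ x ∈ U)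
    (c : TupleChain R (TopSimplex n) (p + 1)) : push σ c ∈ chainsIn R U p := by
  refine map_mem_of_mem_supported (s := Set.univ) (fun v _ => ?_) (by simp)
  rw [push_single]
  exact Finsupp.single_mem_supported _ _ fun x => hσ _

lemma boundary_mem_chainsIn {c : Chain R Y (n + 1)} (hc : c ∈ chainsIn R U (n + 1)) :
    boundary c ∈ chainsIn R U n := by
  refine map_mem_of_mem_supported (fun σ hσ => ?_) hc
  rw [← push_vertices, boundary_push]
  exact push_mem_chainsIn hσ _

lemma subdivision_mem_chainsIn {c : Chain R Y n} (hc : c ∈ chainsIn R U n) :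
    subdivision c ∈ chainsIn R U n := by
  refine map_mem_of_mem_supported (fun σ hσ => ?_) hc
  rw [← push_vertices, subdivision_push]
  exact push_mem_chainsIn hσ _

lemma subdivisionHomotopy_mem_chainsIn {c : Chain R Y n} (hc : c ∈ chainsIn R U n) :
    subdivisionHomotopy c ∈ chainsIn R U (n + 1) := by
  refine map_mem_of_mem_supported (fun σ hσ => ?_) hc
  rw [← push_vertices, subdivisionHomotopy_push]
  exact push_mem_chainsIn hσ _

lemma map_mem_sup {M N : Type*} [AddCommGroup M] [AddCommGroup N] [Module R M] [Module R N]
    {f : M →ₗ[R] N} {p q : Submodule R M} {p' q' : Submodule R N}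
    (hp : ∀ x ∈ p, f x ∈ p') (hq : ∀ x ∈ q, f x ∈ q') {x : M} (hx : x ∈ p ⊔ q) :
    f x ∈ p' ⊔ q' :=
  sup_le (a := p) (b := q) (c := (p' ⊔ q').comap f)
    (fun y hy => Submodule.mem_sup_left (hp y hy))
    (fun y hy => Submodule.mem_sup_right (hq y hy)) hx

lemma subdivision_mem_sup {c : Chain R Y n} (hc : c ∈ chainsIn R U n ⊔ chainsIn R V n) :
    subdivision c ∈ chainsIn R U n ⊔ chainsIn R V n :=
  map_mem_sup (f := subdivision (R := R) (Y := Y) (n := n))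
    (fun _ h => subdivision_mem_chainsIn h) (fun _ h => subdivision_mem_chainsIn h) hc

lemma subdivisionHomotopy_mem_sup {c : Chain R Y n} (hc : c ∈ chainsIn R U n ⊔ chainsIn R V n) :
    subdivisionHomotopy c ∈ chainsIn R U (n + 1) ⊔ chainsIn R V (n + 1) :=
  map_mem_sup (f := subdivisionHomotopy (R := R) (Y := Y) (n := n))
    (fun _ h => subdivisionHomotopy_mem_chainsIn h)
    (fun _ h => subdivisionHomotopy_mem_chainsIn h) hc

lemma exists_subdivision_iterate_vertices_mem_supported (R : Type*) [Ring R] (n : ℕ) {ε : ℝ}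
    (hε : 0 < ε) : ∃ k, (TupleChain.subdivision (barycentre n) (n + 1))^[k]
      (single (vertices n) (1 : R)) ∈ Finsupp.supported R R {w | ∀ i j, dist (w i) (w j) < ε} := by
  set ρ : ℝ := ((n + 1 : ℕ) : ℝ) / ((n + 1 : ℕ) + 1) with hρ
  set D := Metric.diam (Set.univ : Set (TopSimplex n))
  have hρ_lt : ρ < 1 := by
    rw [hρ, div_lt_one (by positivity)]
    exact lt_add_one _
  have hlim : Filter.Tendsto (fun k => ρ ^ k * D) Filter.atTop (nhds 0) := by
    simpa using (tendsto_pow_atTop_nhds_zero_of_lt_one (by positivity) hρ_lt).mul_const D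
  obtain ⟨k, hk⟩ := (hlim.eventually (gt_mem_nhds hε)).exists
  have hvertices : vertices n ∈ tuplesOfDiamLE n (n + 1) D := fun i j =>
    Metric.dist_le_diam_of_mem isCompact_univ.isBounded (Set.mem_univ _) (Set.mem_univ _)
  exact ⟨k, Finsupp.supported_mono (fun w hw i j => (hw i j).trans_lt hk)
    (subdivision_iterate_single_mem_supported hvertices k)⟩

lemma exists_subdivision_iterate_single_mem (hU : IsOpen U) (hV : IsOpen V) (hP : P ⊆ U ∪ V)
    {σ : C(TopSimplex n, Y)} (hσ : ∀ x, σ x ∈ P) :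
    ∃ k, subdivision^[k] (single σ (1 : R)) ∈ chainsIn R (P ∩ U) n ⊔ chainsIn R (P ∩ V) n := by
  obtain ⟨δ, hδ, hball⟩ := lebesgue_number_lemma_of_metric
    (s := (Set.univ : Set (TopSimplex n))) (c := fun b : Bool => σ ⁻¹' (bif b then U else V))
    isCompact_univ (fun b => (by cases b; exacts [hV, hU] : IsOpen (bif b then U else V)).preimage
      σ.continuous) (fun x _ => Set.mem_iUnion.2 <| by simpa [or_comm] using hP (hσ x))
  obtain ⟨k, hk⟩ := exists_subdivision_iterate_vertices_mem_supported R n (half_pos hδ)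
  refine ⟨k, ?_⟩
  rw [← push_vertices, subdivision_iterate_push]
  refine map_mem_of_mem_supported (fun w hw => ?_) hk
  rw [push_single]
  have hsmall (x : TopSimplex n) : affineSimplex w x ∈ Metric.ball (w 0) δ :=
    (dist_convexComb_le fun i => (hw i 0).le).trans_lt (half_lt_self hδ)
  obtain ⟨b, hb⟩ := hball (w 0) (Set.mem_univ _)
  cases b
  · exact Submodule.mem_sup_right (Finsupp.single_mem_supported _ _
      fun x => ⟨hσ _, hb (hsmall x)⟩)
  · exact Submodule.mem_sup_left (Finsupp.single_mem_supported _ _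
      fun x => ⟨hσ _, hb (hsmall x)⟩)

lemma exists_subdivision_iterate_mem (hU : IsOpen U) (hV : IsOpen V) (hP : P ⊆ U ∪ V)
    {c : Chain R Y n} (hc : c ∈ chainsIn R P n) :
    ∃ k, subdivision^[k] c ∈ chainsIn R (P ∩ U) n ⊔ chainsIn R (P ∩ V) n := by
  set small := chainsIn R (P ∩ U) n ⊔ chainsIn R (P ∩ V) n
  let N (k : ℕ) : Submodule R (Chain R Y n) := small.comap (subdivision ^ k)
  have hN (k : ℕ) (x : Chain R Y n) : x ∈ N k ↔ subdivision^[k] x ∈ small := by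
    rw [Submodule.mem_comap, Module.End.pow_apply]
  have hmono : Monotone N := monotone_nat_of_le_succ fun k x hx => by
    rw [hN, Function.iterate_succ_apply']
    exact subdivision_mem_sup ((hN k x).1 hx)
  have hle : chainsIn R P n ≤ ⨆ k, N k := by
    rw [chainsIn, Finsupp.supported_eq_span_single, Submodule.span_le]
    rintro _ ⟨σ, hσ, rfl⟩
    obtain ⟨k, hk⟩ := exists_subdivision_iterate_single_mem (R := R) hU hV hP hσ
    exact Submodule.mem_iSup_of_mem k ((hN k _).2 hk)
  obtain ⟨k, hk⟩ := (Submodule.mem_iSup_of_directed _ hmono.directed_le).1 (hle hc)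
  exact ⟨k, (hN k c).1 hk⟩

lemma exists_sub_boundary_mem (hU : IsOpen U) (hV : IsOpen V) (hP : P ⊆ U ∪ V)
    {c : Chain R Y (n + 1)} (hc : c ∈ chainsIn R P (n + 1))
    (hd : boundary c ∈ chainsIn R (P ∩ U) n ⊔ chainsIn R (P ∩ V) n) :
    ∃ b ∈ chainsIn R P (n + 2),
      c - boundary b ∈ chainsIn R (P ∩ U) (n + 1) ⊔ chainsIn R (P ∩ V) (n + 1) := by
  obtain ⟨k, hk⟩ := exists_subdivision_iterate_mem hU hV hP hc
  induction k generalizing c with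
  | zero => exact ⟨0, Submodule.zero_mem _, by simpa using hk⟩
  | succ k ih =>
    have hdsub : boundary (subdivision c) ∈
        chainsIn R (P ∩ U) n ⊔ chainsIn R (P ∩ V) n := by
      rw [boundary_subdivision]
      exact subdivision_mem_sup hd
    obtain ⟨b, hb, hsub⟩ := ih (subdivision_mem_chainsIn hc) hdsub hk
    have hhomotopy : subdivisionHomotopy (boundary c) ∈
        chainsIn R (P ∩ U) (n + 1) ⊔ chainsIn R (P ∩ V) (n + 1) :=
      subdivisionHomotopy_mem_sup hd
    refine ⟨b - subdivisionHomotopy c,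
      Submodule.sub_mem _ hb (subdivisionHomotopy_mem_chainsIn hc), ?_⟩
    have hsplit : c - boundary (b - subdivisionHomotopy c) =
        (subdivision c - boundary b) - subdivisionHomotopy (boundary c) := by
      rw [map_sub, boundary_subdivisionHomotopy]
      abel
    rw [hsplit]
    exact Submodule.sub_mem _ hsub hhomotopy

lemma exists_sub_boundary_mem_zero (hU : IsOpen U) (hV : IsOpen V) (hP : P ⊆ U ∪ V)
    {c : Chain R Y 0} (hc : c ∈ chainsIn R P 0) :
    ∃ b ∈ chainsIn R P 1, c - boundary b ∈ chainsIn R (P ∩ U) 0 ⊔ chainsIn R (P ∩ V) 0 := by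
  obtain ⟨k, hk⟩ := exists_subdivision_iterate_mem hU hV hP hc
  induction k generalizing c with
  | zero => exact ⟨0, Submodule.zero_mem _, by simpa using hk⟩
  | succ k ih =>
    obtain ⟨b, hb, hsub⟩ := ih (c := subdivision c) (subdivision_mem_chainsIn hc) hk
    refine ⟨b - subdivisionHomotopy c,
      Submodule.sub_mem _ hb (subdivisionHomotopy_mem_chainsIn hc), ?_⟩
    have hsplit : c - boundary (b - subdivisionHomotopy c) = subdivision c - boundary b := by
      rw [map_sub, boundary_subdivisionHomotopy_zero]
      abel
    rwa [hsplit]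

end SingularChain

end

section

/-! ### Subcomplexes and the Mayer–Vietoris sequence -/

open CategoryTheory Limits

section LinearComplex

variable {R : Type*} [Ring R] {M N : ℕ → Type u} [∀ n, AddCommGroup (M n)] [∀ n, Module R (M n)]
  [∀ n, AddCommGroup (N n)] [∀ n, Module R (N n)]

/-- The chain complex of modules given by a sequence of linear maps of square zero. -/
def linearComplex (d : ∀ n, M (n + 1) →ₗ[R] M n) (hd : ∀ n x, d n (d (n + 1) x) = 0) :
    ChainComplex (ModuleCat.{u} R) ℕ :=
  ChainComplex.of (fun n => ModuleCat.of R (M n)) (fun n => ModuleCat.ofHom (d n))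
    (fun n => by ext x; exact hd n x)

variable {d : ∀ n, M (n + 1) →ₗ[R] M n} (hd : ∀ n x, d n (d (n + 1) x) = 0)
  {d' : ∀ n, N (n + 1) →ₗ[R] N n} (hd' : ∀ n x, d' n (d' (n + 1) x) = 0)

lemma linearComplex_d (n : ℕ) : (linearComplex d hd).d (n + 1) n = ModuleCat.ofHom (d n) :=
  ChainComplex.of_d (fun n => ModuleCat.of R (M n)) (fun n => ModuleCat.ofHom (d n)) n

/-- The chain map given by linear maps commuting with the differentials. -/
def linearComplexMap (f : ∀ n, M n →ₗ[R] N n) (hf : ∀ n x, d' n (f (n + 1) x) = f n (d n x)) :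
    linearComplex d hd ⟶ linearComplex d' hd' :=
  ChainComplex.ofHom (X := linearComplex d hd) (Y := linearComplex d' hd')
    (fun n => ModuleCat.ofHom (f n))
    (fun n => by
      rw [linearComplex_d, linearComplex_d]
      ext x
      exact hf n x)

/-- The isomorphism given by linear equivalences commuting with the differentials. -/
def linearComplexIso (e : ∀ n, M n ≃ₗ[R] N n) (he : ∀ n x, d' n (e (n + 1) x) = e n (d n x)) :
    linearComplex d hd ≅ linearComplex d' hd' :=
  HomologicalComplex.Hom.isoOfComponents (fun n => (e n).toModuleIso) (by
    rintro i j hij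
    obtain rfl : j + 1 = i := hij
    rw [linearComplex_d, linearComplex_d]
    ext x
    exact he j x)

end LinearComplex

/-- A subcomplex: a family of submodules stable under the differential `d`. The equation `d² = 0`
is not part of the data; it is an argument `hd` of the associated complexes. -/
structure Subcomplex {R : Type*} [Ring R] {M : ℕ → Type u} [∀ n, AddCommGroup (M n)]
    [∀ n, Module R (M n)] (d : ∀ n, M (n + 1) →ₗ[R] M n) where
  /-- The underlying submodules. -/
  carrier : ∀ n, Submodule R (M n)
  map_d : ∀ n, ∀ x ∈ carrier (n + 1), d n x ∈ carrier n

namespace Subcomplex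

variable {R : Type*} [Ring R] {M : ℕ → Type u} [∀ n, AddCommGroup (M n)] [∀ n, Module R (M n)]
  {d : ∀ n, M (n + 1) →ₗ[R] M n} (hd : ∀ n x, d n (d (n + 1) x) = 0)

/-- The chain complex underlying a subcomplex. -/
def toComplex (p : Subcomplex d) : ChainComplex (ModuleCat.{u} R) ℕ :=
  linearComplex (M := fun n => p.carrier n) (fun n => (d n).restrict (p.map_d n))
    (fun n x => Subtype.ext (hd n x))

/-- The inclusion of a subcomplex in a larger one. -/
def inclusion (p q : Subcomplex d) (h : ∀ n, p.carrier n ≤ q.carrier n) :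
    p.toComplex hd ⟶ q.toComplex hd :=
  linearComplexMap _ _ (fun n => Submodule.inclusion (h n)) (fun _ _ => rfl)

lemma inclusion_comp (p q r : Subcomplex d) (h : ∀ n, p.carrier n ≤ q.carrier n)
    (h' : ∀ n, q.carrier n ≤ r.carrier n) :
    inclusion hd p q h ≫ inclusion hd q r h' =
      inclusion hd p r (fun n => (h n).trans (h' n)) := by
  ext n x; rfl

section Product

variable (p q : Subcomplex d)

/-- The direct sum of two subcomplexes. -/
def prodComplex : ChainComplex (ModuleCat.{u} R) ℕ :=
  linearComplex (M := fun n => p.carrier n × q.carrier n)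
    (fun n => ((d n).restrict (p.map_d n)).prodMap ((d n).restrict (q.map_d n)))
    (fun n x => Prod.ext (Subtype.ext (hd n x.1)) (Subtype.ext (hd n x.2)))

/-- The first inclusion into the direct sum. -/
def inl : p.toComplex hd ⟶ prodComplex hd p q :=
  linearComplexMap _ _ (fun _ => LinearMap.inl R _ _)
    (fun n _ => Prod.ext rfl (Subtype.ext (map_zero (d n))))

/-- The second inclusion into the direct sum. -/
def inr : q.toComplex hd ⟶ prodComplex hd p q :=
  linearComplexMap _ _ (fun _ => LinearMap.inr R _ _)
    (fun n _ => Prod.ext (Subtype.ext (map_zero (d n))) rfl)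

/-- The first projection of the direct sum. -/
def fst : prodComplex hd p q ⟶ p.toComplex hd :=
  linearComplexMap _ _ (fun _ => LinearMap.fst R _ _) (fun _ _ => rfl)

/-- The second projection of the direct sum. -/
def snd : prodComplex hd p q ⟶ q.toComplex hd :=
  linearComplexMap _ _ (fun _ => LinearMap.snd R _ _) (fun _ _ => rfl)

lemma inr_snd : inr hd p q ≫ snd hd p q = 𝟙 _ := by ext n x; rfl

/-- The short complex `p → p ⊕ q → q`. -/
def prodSequence : ShortComplex (ChainComplex (ModuleCat.{u} R) ℕ) :=
  ShortComplex.mk (inl hd p q) (snd hd p q) (by ext n x; rfl)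

/-- The evident splitting of `p → p ⊕ q → q`. -/
def prodSplitting : (prodSequence hd p q).Splitting where
  r := fst hd p q
  s := inr hd p q
  f_r := by ext n x; rfl
  s_g := inr_snd hd p q
  id := by
    ext n x
    exact Prod.ext (add_zero (show p.carrier n × q.carrier n from x).1)
      (zero_add (show p.carrier n × q.carrier n from x).2)

/-- The direct sum of two inclusions. -/
def inclusionProd {p q p' q' : Subcomplex d} (h : ∀ n, p.carrier n ≤ p'.carrier n)
    (h' : ∀ n, q.carrier n ≤ q'.carrier n) : prodComplex hd p q ⟶ prodComplex hd p' q' :=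
  linearComplexMap _ _
    (fun n => (Submodule.inclusion (h n)).prodMap (Submodule.inclusion (h' n))) (fun _ _ => rfl)

end Product

section MayerVietoris

variable (p q : Subcomplex d)

/-- The intersection of two subcomplexes. -/
def inf : Subcomplex d := ⟨fun n => p.carrier n ⊓ q.carrier n,
  fun n x hx => ⟨p.map_d n x hx.1, q.map_d n x hx.2⟩⟩

/-- The sum of two subcomplexes. -/
def sup : Subcomplex d := ⟨fun n => p.carrier n ⊔ q.carrier n,
  fun n _ hx => SingularChain.map_mem_sup (p.map_d n) (q.map_d n) hx⟩

/-- The map `x ↦ (x, -x)` from the intersection to the direct sum. -/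
def antidiagonal : (inf p q).toComplex hd ⟶ prodComplex hd p q :=
  linearComplexMap _ _ (fun n => (Submodule.inclusion (inf_le_left : _ ≤ p.carrier n)).prod
    (-Submodule.inclusion (inf_le_right : _ ≤ q.carrier n)))
    (fun n x => Prod.ext rfl (Subtype.ext (map_neg (d n) x.1)))

/-- The map `(x, y) ↦ x + y` from the direct sum to the sum. -/
def sumMap : prodComplex hd p q ⟶ (sup p q).toComplex hd :=
  linearComplexMap _ _ (fun n => (Submodule.inclusion (le_sup_left : p.carrier n ≤ _)).coprod
    (Submodule.inclusion (le_sup_right : q.carrier n ≤ _)))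
    (fun n x => Subtype.ext (map_add (d n) x.1.1 x.2.1))

/-- The Mayer–Vietoris sequence `p ∩ q → p ⊕ q → p + q`. -/
def mayerVietoris : ShortComplex (ChainComplex (ModuleCat.{u} R) ℕ) :=
  ShortComplex.mk (antidiagonal hd p q) (sumMap hd p q) (by
    ext n x
    exact Subtype.ext (add_neg_cancel (show (inf p q).carrier n from x).1))

lemma mayerVietoris_shortExact : (mayerVietoris hd p q).ShortExact := by
  refine HomologicalComplex.shortExact_of_degreewise_shortExact _ fun n => ?_
  refine ModuleCat.shortComplex_shortExact _ ?_ ?_ ?_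
  · rintro ⟨⟨a, ha⟩, ⟨b, hb⟩⟩
    constructor
    · intro h
      have hab : a + b = 0 := congrArg (Subtype.val (p := (· ∈ (sup p q).carrier n))) h
      refine ⟨⟨a, ha, ?_⟩, ?_⟩
      · rw [eq_neg_of_add_eq_zero_left hab]
        exact neg_mem hb
      · exact Prod.ext rfl (Subtype.ext (eq_neg_of_add_eq_zero_right hab).symm)
    · rintro ⟨x, hx⟩
      rw [← hx]
      exact Subtype.ext (add_neg_cancel (show (inf p q).carrier n from x).1)
  · intro x y hxy
    exact Subtype.ext (congrArg (fun z : p.carrier n × q.carrier n => z.1.1) hxy)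
  · rintro ⟨x, hx⟩
    obtain ⟨a, ha, b, hb, rfl⟩ := Submodule.mem_sup.1 hx
    exact ⟨((⟨a, ha⟩, ⟨b, hb⟩) : p.carrier n × q.carrier n), rfl⟩

/-- The map of Mayer–Vietoris sequences induced by two inclusions. -/
def mayerVietorisMap {p q p' q' : Subcomplex d} (h : ∀ n, p.carrier n ≤ p'.carrier n)
    (h' : ∀ n, q.carrier n ≤ q'.carrier n) : mayerVietoris hd p q ⟶ mayerVietoris hd p' q' where
  τ₁ := inclusion hd _ _ fun n => inf_le_inf (h n) (h' n)
  τ₂ := inclusionProd hd h h'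
  τ₃ := inclusion hd _ _ fun n => sup_le_sup (h n) (h' n)
  comm₁₂ := by
    ext n x
    rfl
  comm₂₃ := by
    ext n x
    rfl

end MayerVietoris

section Quotient

variable (p q : Subcomplex d)

/-- The submodule of `q` cut out by `p` in degree `n`. -/
def relative (n : ℕ) : Submodule R (q.carrier n) :=
  (p.carrier n).comap (q.carrier n).subtype

/-- The complex `q / (p ∩ q)`. -/
def quotientComplex : ChainComplex (ModuleCat.{u} R) ℕ :=
  linearComplex (M := fun n => q.carrier n ⧸ relative p q n)
    (fun n => Submodule.mapQ _ _ ((d n).restrict (q.map_d n)) fun x hx => p.map_d n x hx)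
    (fun n x => by
      obtain ⟨x, rfl⟩ := Submodule.mkQ_surjective _ x
      refine (Submodule.Quotient.mk_eq_zero _).2 ?_
      change d n (d (n + 1) x) ∈ p.carrier n
      rw [hd]
      exact Submodule.zero_mem _)

lemma quotientComplex_d_mk (n : ℕ) (x : q.carrier (n + 1)) :
    (quotientComplex hd p q).d (n + 1) n (Submodule.Quotient.mk x) =
      (Submodule.Quotient.mk ((d n).restrict (q.map_d n) x) : q.carrier n ⧸ relative p q n) :=
  ConcreteCategory.congr_hom (linearComplex_d (M := fun n => q.carrier n ⧸ relative p q n) _ n)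
    (Submodule.Quotient.mk x : q.carrier (n + 1) ⧸ relative p q (n + 1))

/-- The projection `q → q / (p ∩ q)`. -/
def toQuotient : q.toComplex hd ⟶ quotientComplex hd p q :=
  linearComplexMap _ _ (fun _ => Submodule.mkQ _) (fun _ _ => rfl)

/-- The short complex `p → q → q / p`. -/
def quotientSequence (h : ∀ n, p.carrier n ≤ q.carrier n) :
    ShortComplex (ChainComplex (ModuleCat.{u} R) ℕ) :=
  ShortComplex.mk (inclusion hd p q h) (toQuotient hd p q) (by
    ext n x
    exact (Submodule.Quotient.mk_eq_zero _).2 x.2)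

lemma quotientSequence_shortExact (h : ∀ n, p.carrier n ≤ q.carrier n) :
    (quotientSequence hd p q h).ShortExact := by
  refine HomologicalComplex.shortExact_of_degreewise_shortExact _ fun n => ?_
  refine ModuleCat.shortComplex_shortExact _ ?_ ?_ ?_
  · intro x
    constructor
    · intro hx
      have hxp : x.1 ∈ p.carrier n := (Submodule.Quotient.mk_eq_zero (relative p q n)).1 hx
      exact ⟨(⟨x.1, hxp⟩ : p.carrier n), rfl⟩
    · rintro ⟨y, rfl⟩
      exact (Submodule.Quotient.mk_eq_zero _).2 y.2
  · exact Submodule.inclusion_injective (h n)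
  · exact Submodule.mkQ_surjective _

lemma quotientComplex_exactAt_zero
    (h : ∀ c ∈ q.carrier 0, ∃ b ∈ q.carrier 1, c - d 0 b ∈ p.carrier 0) :
    (quotientComplex hd p q).ExactAt 0 := by
  rw [HomologicalComplex.exactAt_iff' _ 1 0 0 (by simp) (by simp),
    ShortComplex.moduleCat_exact_iff]
  intro x _
  obtain ⟨c, rfl⟩ := Submodule.mkQ_surjective _ x
  obtain ⟨b, hb, hcb⟩ := h c.1 c.2
  exact ⟨Submodule.Quotient.mk (⟨b, hb⟩ : q.carrier 1), (quotientComplex_d_mk hd p q 0 _).trans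
    ((Submodule.Quotient.eq (relative p q 0)).2 hcb).symm⟩

lemma quotientComplex_exactAt_succ {n : ℕ}
    (h : ∀ c ∈ q.carrier (n + 1), d n c ∈ p.carrier n →
      ∃ b ∈ q.carrier (n + 2), c - d (n + 1) b ∈ p.carrier (n + 1)) :
    (quotientComplex hd p q).ExactAt (n + 1) := by
  rw [HomologicalComplex.exactAt_iff' _ (n + 2) (n + 1) n (by simp) (by simp),
    ShortComplex.moduleCat_exact_iff]
  intro x hx
  obtain ⟨c, rfl⟩ := Submodule.mkQ_surjective _ x
  have hc : d n c ∈ p.carrier n := (Submodule.Quotient.mk_eq_zero (relative p q n)).1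
    ((quotientComplex_d_mk hd p q n c).symm.trans hx)
  obtain ⟨b, hb, hcb⟩ := h c.1 c.2 hc
  exact ⟨Submodule.Quotient.mk (⟨b, hb⟩ : q.carrier (n + 2)),
    (quotientComplex_d_mk hd p q (n + 1) _).trans
      ((Submodule.Quotient.eq (relative p q (n + 1))).2 hcb).symm⟩

lemma isIso_homologyMap_inclusion (h : ∀ n, p.carrier n ≤ q.carrier n)
    (h_zero : ∀ c ∈ q.carrier 0, ∃ b ∈ q.carrier 1, c - d 0 b ∈ p.carrier 0)
    (h_succ : ∀ n, ∀ c ∈ q.carrier (n + 1), d n c ∈ p.carrier n →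
      ∃ b ∈ q.carrier (n + 2), c - d (n + 1) b ∈ p.carrier (n + 1)) (n : ℕ) :
    IsIso (HomologicalComplex.homologyMap (inclusion hd p q h) n) := by
  have hexact : ∀ n, (quotientComplex hd p q).ExactAt n
    | 0 => quotientComplex_exactAt_zero hd p q h_zero
    | n + 1 => quotientComplex_exactAt_succ hd p q (h_succ n)
  have hzero := fun n => (hexact n).isZero_homology
  have hS := quotientSequence_shortExact hd p q h
  have : Mono (HomologicalComplex.homologyMap (inclusion hd p q h) n) :=
    (hS.homology_exact₁ (n + 1) n rfl).mono_g ((hzero (n + 1)).eq_of_src _ _)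
  have : Epi (HomologicalComplex.homologyMap (inclusion hd p q h) n) :=
    (hS.homology_exact₂ n).epi_f ((hzero n).eq_of_tgt _ _)
  exact isIso_of_mono_of_epi _

end Quotient

end Subcomplex

end

section

/-! ### Finite homology and Euler characteristics of chain complexes -/

open CategoryTheory Limits HomologicalComplex

/-- The total homology of a chain complex is finitely generated. -/
def FiniteTotalHomology {R : Type*} [Ring R] (K : ChainComplex (ModuleCat.{u} R) ℕ) : Prop :=
  (∀ n, Module.Finite R (K.homology n)) ∧ ∃ N : ℕ, ∀ n, N < n → Subsingleton (K.homology n)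

section Comparison

variable {R : Type*} [Ring R] {K L : ChainComplex (ModuleCat.{u} R) ℕ}

lemma FiniteTotalHomology.of_iso (e : ∀ n, K.homology n ≅ L.homology n)
    (hK : FiniteTotalHomology K) : FiniteTotalHomology L := by
  obtain ⟨hfin, N, hN⟩ := hK
  refine ⟨fun n => ?_, N, fun n hn => ?_⟩
  · have := hfin n
    exact Module.Finite.equiv (e n).toLinearEquiv
  · have := hN n hn
    exact (e n).toLinearEquiv.symm.toEquiv.subsingleton

lemma FiniteTotalHomology.of_retract (i : K ⟶ L) (r : L ⟶ K) (h : i ≫ r = 𝟙 K)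
    (hL : FiniteTotalHomology L) : FiniteTotalHomology K := by
  have hsurj : ∀ n, Function.Surjective (homologyMap r n).hom := fun n x =>
    ⟨homologyMap i n x, by
      have hcomp : homologyMap i n ≫ homologyMap r n = 𝟙 _ := by
        rw [← homologyMap_comp, h, homologyMap_id]
      exact ConcreteCategory.congr_hom hcomp x⟩
  obtain ⟨hfin, N, hN⟩ := hL
  refine ⟨fun n => ?_, N, fun n hn => ?_⟩
  · have := hfin n
    exact Module.Finite.of_surjective _ (hsurj n)
  · have := hN n hn
    exact (hsurj n).subsingleton

lemma homologyEulerChar_congr (e : ∀ n, K.homology n ≅ L.homology n) :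
    K.homologyEulerChar = L.homologyEulerChar :=
  finsum_congr fun n => by rw [(e n).toLinearEquiv.finrank_eq]

lemma homologyEulerChar_eq_sum_range [Nontrivial R] {N : ℕ}
    (h : ∀ n, N < n → Subsingleton (K.homology n)) :
    K.homologyEulerChar =
      ∑ n ∈ Finset.range (N + 1), (-1 : ℤ) ^ n * Module.finrank R (K.homology n) := by
  rw [homologyEulerChar_eq_sum_finSet_of_finrankSupport_subset K (Finset.range (N + 1))]
  · exact Finset.sum_congr rfl fun n _ => by simp
  · intro n hn
    by_contra hn'
    have := h n (by simpa using hn')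
    exact hn Module.finrank_zero_of_subsingleton

end Comparison

section ExactSequence

lemma finite_X₂_of_exact {R : Type*} [Ring R] [IsNoetherianRing R]
    {S : ShortComplex (ModuleCat.{u} R)} (hS : S.Exact) [Module.Finite R S.X₁]
    [Module.Finite R S.X₃] : Module.Finite R S.X₂ :=
  have := isNoetherian_of_range_eq_ker S.f.hom S.g.hom hS.moduleCat_range_eq_ker
  inferInstance

lemma subsingleton_X₂_of_exact {R : Type*} [Ring R] {S : ShortComplex (ModuleCat.{u} R)}
    (hS : S.Exact) [Subsingleton S.X₁] [Subsingleton S.X₃] : Subsingleton S.X₂ :=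
  ModuleCat.subsingleton_of_isZero <| hS.isZero_X₂
    ((ModuleCat.isZero_of_subsingleton _).eq_of_src _ _)
    ((ModuleCat.isZero_of_subsingleton _).eq_of_tgt _ _)

/-- The rank of a linear map, as an integer. -/
def rangeRank {k : Type*} [Field k] {A B : ModuleCat.{u} k} (φ : A ⟶ B) : ℤ :=
  Module.finrank k (LinearMap.range φ.hom)

lemma finrank_X₂_of_exact {k : Type*} [Field k] {S : ShortComplex (ModuleCat.{u} k)}
    (hS : S.Exact) [Module.Finite k S.X₂] :
    (Module.finrank k S.X₂ : ℤ) = rangeRank S.f + rangeRank S.g := by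
  simp only [rangeRank]
  rw [hS.moduleCat_range_eq_ker, add_comm]
  exact_mod_cast (LinearMap.finrank_range_add_finrank_ker S.g.hom).symm

lemma alternating_sum_add_of_exact {a b c α β r : ℕ → ℤ} (ha : ∀ n, a n = r n + α n)
    (hb : ∀ n, b n = α n + β n) (hc₀ : c 0 = β 0) (hc : ∀ n, c (n + 1) = β (n + 1) + r n)
    (m : ℕ) :
    ∑ n ∈ Finset.range (m + 1), (-1) ^ n * a n + ∑ n ∈ Finset.range (m + 1), (-1) ^ n * c n =
      ∑ n ∈ Finset.range (m + 1), (-1) ^ n * b n + (-1) ^ m * r m := by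
  induction m with
  | zero =>
    simp only [zero_add, Finset.range_one, Finset.sum_singleton, pow_zero, one_mul, ha, hb, hc₀]
    ring
  | succ m ih =>
    simp only [Finset.sum_range_succ _ (m + 1), ha (m + 1), hb (m + 1), hc m, pow_succ]
    linear_combination ih

end ExactSequence

section ShortExact

variable {R : Type*} [Ring R] {S : ShortComplex (ChainComplex (ModuleCat.{u} R) ℕ)}

lemma homologyMap_g_zero_surjective (hS : S.ShortExact) :
    Function.Surjective (homologyMap S.g 0).hom := by
  have := hS.epi_g
  have h := epi_homologyMap_of_epi_of_not_rel S.g 0 (fun j => by simp)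
  exact (ModuleCat.epi_iff_surjective _).1 h

lemma FiniteTotalHomology.of_shortExact₂ [IsNoetherianRing R] (hS : S.ShortExact)
    (h₁ : FiniteTotalHomology S.X₁) (h₃ : FiniteTotalHomology S.X₃) :
    FiniteTotalHomology S.X₂ := by
  obtain ⟨hfin₁, N₁, hN₁⟩ := h₁
  obtain ⟨hfin₃, N₃, hN₃⟩ := h₃
  refine ⟨fun n => ?_, max N₁ N₃, fun n hn => ?_⟩
  · have : Module.Finite R (S.map (homologyFunctor _ _ n)).X₁ := hfin₁ n
    have : Module.Finite R (S.map (homologyFunctor _ _ n)).X₃ := hfin₃ n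
    exact finite_X₂_of_exact (hS.homology_exact₂ n)
  · have := hN₁ n (lt_of_le_of_lt (le_max_left _ _) hn)
    have := hN₃ n (lt_of_le_of_lt (le_max_right _ _) hn)
    exact subsingleton_X₂_of_exact (hS.homology_exact₂ n)

lemma FiniteTotalHomology.of_shortExact₃ [IsNoetherianRing R] (hS : S.ShortExact)
    (h₁ : FiniteTotalHomology S.X₁) (h₂ : FiniteTotalHomology S.X₂) :
    FiniteTotalHomology S.X₃ := by
  obtain ⟨hfin₁, N₁, hN₁⟩ := h₁
  obtain ⟨hfin₂, N₂, hN₂⟩ := h₂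
  refine ⟨fun n => ?_, max (N₁ + 1) N₂, fun n hn => ?_⟩
  · have := hfin₂ n
    cases n with
    | zero => exact Module.Finite.of_surjective _ (homologyMap_g_zero_surjective hS)
    | succ n =>
      have := hfin₁ n
      exact finite_X₂_of_exact (hS.homology_exact₃ (n + 1) n rfl)
  · have := hN₂ n (lt_of_le_of_lt (le_max_right _ _) hn)
    obtain ⟨m, rfl⟩ : ∃ m, n = m + 1 := ⟨n - 1, by omega⟩
    have := hN₁ m (by omega)
    exact subsingleton_X₂_of_exact (hS.homology_exact₃ (m + 1) m rfl)

end ShortExact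

section EulerChar

variable {k : Type*} [Field k]

lemma homologyEulerChar_X₂ {S : ShortComplex (ChainComplex (ModuleCat.{u} k) ℕ)}
    (hS : S.ShortExact) (h₁ : FiniteTotalHomology S.X₁) (h₃ : FiniteTotalHomology S.X₃) :
    S.X₂.homologyEulerChar = S.X₁.homologyEulerChar + S.X₃.homologyEulerChar := by
  obtain ⟨hfin₂, N₂, hN₂⟩ := FiniteTotalHomology.of_shortExact₂ hS h₁ h₃
  obtain ⟨hfin₁, N₁, hN₁⟩ := h₁
  obtain ⟨hfin₃, N₃, hN₃⟩ := h₃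
  let N := N₁ + N₂ + N₃
  have hX₁ : ∀ n, (Module.finrank k (S.X₁.homology n) : ℤ) =
      rangeRank (hS.δ (n + 1) n rfl) + rangeRank (homologyMap S.f n) := fun n =>
    have := hfin₁ n
    finrank_X₂_of_exact (hS.homology_exact₁ (n + 1) n rfl)
  have hX₂ : ∀ n, (Module.finrank k (S.X₂.homology n) : ℤ) =
      rangeRank (homologyMap S.f n) + rangeRank (homologyMap S.g n) := fun n =>
    have : Module.Finite k (S.map (homologyFunctor _ _ n)).X₂ := hfin₂ n
    finrank_X₂_of_exact (hS.homology_exact₂ n)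
  have hX₃_zero : (Module.finrank k (S.X₃.homology 0) : ℤ) = rangeRank (homologyMap S.g 0) := by
    rw [rangeRank, LinearMap.range_eq_top.2 (homologyMap_g_zero_surjective hS), finrank_top]
  have hX₃_succ : ∀ n, (Module.finrank k (S.X₃.homology (n + 1)) : ℤ) =
      rangeRank (homologyMap S.g (n + 1)) + rangeRank (hS.δ (n + 1) n rfl) := fun n =>
    have := hfin₃ (n + 1)
    finrank_X₂_of_exact (hS.homology_exact₃ (n + 1) n rfl)
  have hδ : rangeRank (hS.δ (N + 1) N rfl) = 0 := by
    have := hN₃ (N + 1) (by omega)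
    rw [(ModuleCat.isZero_of_subsingleton _).eq_of_src (hS.δ (N + 1) N rfl) 0]
    simp [rangeRank]
  have key := alternating_sum_add_of_exact hX₁ hX₂
    (c := fun n => Module.finrank k (S.X₃.homology n)) hX₃_zero hX₃_succ N
  rw [homologyEulerChar_eq_sum_range (N := N) fun n hn => hN₁ n (by omega),
    homologyEulerChar_eq_sum_range (N := N) fun n hn => hN₂ n (by omega),
    homologyEulerChar_eq_sum_range (N := N) fun n hn => hN₃ n (by omega)]
  rw [key, hδ, mul_zero, add_zero]

namespace Subcomplex

variable {M : ℕ → Type u} [∀ n, AddCommGroup (M n)] [∀ n, Module k (M n)]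
  {d : ∀ n, M (n + 1) →ₗ[k] M n} (hd : ∀ n x, d n (d (n + 1) x) = 0) (p q : Subcomplex d)

lemma finiteTotalHomology_right (h : FiniteTotalHomology (prodComplex hd p q)) :
    FiniteTotalHomology (q.toComplex hd) :=
  .of_retract _ _ (inr_snd hd p q) h

lemma finiteTotalHomology_prodComplex (hp : FiniteTotalHomology (p.toComplex hd))
    (hq : FiniteTotalHomology (q.toComplex hd)) : FiniteTotalHomology (prodComplex hd p q) :=
  .of_shortExact₂ (prodSplitting hd p q).shortExact hp hq

lemma homologyEulerChar_prodComplex (hp : FiniteTotalHomology (p.toComplex hd))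
    (hq : FiniteTotalHomology (q.toComplex hd)) :
    (prodComplex hd p q).homologyEulerChar =
      (p.toComplex hd).homologyEulerChar + (q.toComplex hd).homologyEulerChar :=
  homologyEulerChar_X₂ (S := prodSequence hd p q) (prodSplitting hd p q).shortExact hp hq

end Subcomplex

end EulerChar

end

section

/-! ### Comparison with the singular chain complex -/

open CategoryTheory Limits

namespace SingularChain

section Comparison

open scoped Simplicial

variable (Y : Type u) [TopologicalSpace Y]

/-- The coefficient module `ℚ`, lifted to the universe of the spaces. -/
abbrev coeff : ModuleCat.{u} ℚ := ModuleCat.of ℚ (ULift.{u} ℚ)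

/-- The singular simplicial set of `Y`. -/
abbrev singularSet : SSet.{u} := TopCat.toSSet.obj (TopCat.of Y)

/-- The elements of the singular simplicial set are the continuous maps from the standard
simplices. -/
def simplexEquiv (n : ℕ) : (singularSet Y) _⦋n⦌ ≃ C(TopSimplex n, Y) :=
  TopCat.toSSetObjEquiv (TopCat.of Y) (Opposite.op ⦋n⦌)

lemma simplexEquiv_δ (n : ℕ) (i : Fin (n + 2)) (x : (singularSet Y) _⦋n + 1⦌) :
    simplexEquiv Y n ((singularSet Y).δ i x) = (simplexEquiv Y (n + 1) x).comp (face n i) := by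
  rfl

/-- The map from the coproduct of copies of `ℚ` to the finitely supported functions. -/
def toChain (n : ℕ) :
    ((singularSet Y).chainComplex coeff.{u}).X n ⟶ ModuleCat.of ℚ (Chain ℚ Y n) :=
  ((singularSet Y).isColimitChainComplexXCofan coeff n).desc (Cofan.mk _ fun x =>
    ModuleCat.ofHom ((Finsupp.lsingle (simplexEquiv Y n x)) ∘ₗ ULift.moduleEquiv.toLinearMap))

lemma ι_toChain (n : ℕ) (x : (singularSet Y) _⦋n⦌) :
    (singularSet Y).ιChainComplex x ≫ toChain Y n =
      ModuleCat.ofHom ((Finsupp.lsingle (simplexEquiv Y n x)) ∘ₗ ULift.moduleEquiv.toLinearMap) :=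
  ((singularSet Y).isColimitChainComplexXCofan coeff n).fac _ ⟨x⟩

/-- The inverse of `toChain`. -/
def ofChain (n : ℕ) :
    ModuleCat.of ℚ (Chain ℚ Y n) ⟶ ((singularSet Y).chainComplex coeff.{u}).X n :=
  ModuleCat.ofHom (Finsupp.linearCombination ℚ fun σ =>
    (singularSet Y).ιChainComplex (R := coeff) ((simplexEquiv Y n).symm σ) (ULift.up 1))

lemma toChain_ofChain (n : ℕ) : toChain Y n ≫ ofChain Y n = 𝟙 _ := by
  refine SSet.chainComplex_hom_ext fun x => ?_
  rw [← Category.assoc, ι_toChain, Category.comp_id]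
  ext ⟨r⟩
  change (Finsupp.linearCombination ℚ _) (Finsupp.single (simplexEquiv Y n x) r) = _
  refine (Finsupp.linearCombination_single ℚ _ _).trans ?_
  rw [Equiv.symm_apply_apply]
  refine (map_smul ((singularSet Y).ιChainComplex (R := coeff) x).hom r (ULift.up 1)).symm.trans ?_
  exact congrArg _ (ULift.ext _ _ (mul_one r))

lemma ofChain_toChain (n : ℕ) : ofChain Y n ≫ toChain Y n = 𝟙 _ := by
  refine ModuleCat.hom_ext (Finsupp.lhom_ext' fun σ => LinearMap.ext_ring ?_)
  change toChain Y n (Finsupp.linearCombination ℚ _ (Finsupp.single σ 1)) = Finsupp.single σ 1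
  rw [Finsupp.linearCombination_single, one_smul]
  refine (ConcreteCategory.congr_hom (ι_toChain Y n ((simplexEquiv Y n).symm σ))
    (ULift.up 1)).trans ?_
  change Finsupp.single _ (1 : ℚ) = _
  rw [Equiv.apply_symm_apply]

lemma toChain_boundary (n : ℕ) : toChain Y (n + 1) ≫ ModuleCat.ofHom boundary =
    ((singularSet Y).chainComplex coeff.{u}).d (n + 1) n ≫ toChain Y n := by
  refine SSet.chainComplex_hom_ext fun x => ?_
  rw [← Category.assoc, ι_toChain, ← Category.assoc, SSet.ιChainComplex_d, Preadditive.sum_comp]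
  simp only [Preadditive.zsmul_comp, ι_toChain, simplexEquiv_δ]
  refine ModuleCat.hom_ext (LinearMap.ext fun ⟨r⟩ => ?_)
  have hr : Finsupp.single (simplexEquiv Y (n + 1) x) r =
      r • Finsupp.single (simplexEquiv Y (n + 1) x) (1 : ℚ) := by simp
  change boundary (Finsupp.single (simplexEquiv Y (n + 1) x) r) = _
  rw [hr, map_smul, boundary_single, Finset.smul_sum, ModuleCat.hom_sum, LinearMap.sum_apply]
  refine Finset.sum_congr rfl fun i _ => ?_
  rw [ModuleCat.hom_zsmul, LinearMap.smul_apply]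
  change _ = (-1 : ℤ) ^ (i : ℕ) • Finsupp.single _ r
  rw [← Int.cast_smul_eq_zsmul ℚ]
  simp [mul_comm]

/-- The complex of finitely supported singular chains with rational coefficients. -/
def finsuppComplex : ChainComplex (ModuleCat.{u} ℚ) ℕ :=
  linearComplex (fun _ => boundary (R := ℚ) (Y := Y)) fun _ => boundary_boundary

/-- The singular chain complex is the complex of finitely supported chains. -/
def singularIso : SurfaceFibration.singularChains Y ≅ finsuppComplex Y :=
  HomologicalComplex.Hom.isoOfComponents
    (fun n => ⟨toChain Y n, ofChain Y n, toChain_ofChain Y n, ofChain_toChain Y n⟩) (by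
    rintro i j hij
    obtain rfl : j + 1 = i := hij
    exact (congrArg _ (linearComplex_d _ j)).trans (toChain_boundary Y j))

end Comparison

section Subspace

variable {Y : Type u} [TopologicalSpace Y]

/-- The subcomplex of chains of simplices with image in `U`. -/
def subcomplexIn (U : Set Y) : Subcomplex fun n => boundary (R := ℚ) (Y := Y) (n := n) :=
  ⟨chainsIn ℚ U, fun _ _ h => boundary_mem_chainsIn h⟩

/-- Simplices of a subspace are simplices with image in the subset. -/
def simplexInEquiv (U : Set Y) (n : ℕ) :
    C(TopSimplex n, U) ≃ {σ : C(TopSimplex n, Y) | ∀ x, σ x ∈ U} where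
  toFun σ := ⟨⟨fun x => σ x, continuous_subtype_val.comp σ.continuous⟩, fun x => (σ x).2⟩
  invFun σ := ⟨fun x => ⟨σ.1 x, σ.2 x⟩, σ.1.continuous.subtype_mk _⟩
  left_inv _ := rfl
  right_inv _ := rfl

/-- Chains on a subspace are chains with image in the subset. -/
def chainInEquiv (U : Set Y) (n : ℕ) : Chain ℚ U n ≃ₗ[ℚ] chainsIn ℚ U n :=
  (Finsupp.domLCongr (simplexInEquiv U n)).trans (Finsupp.supportedEquivFinsupp _).symm

lemma chainInEquiv_single (U : Set Y) (n : ℕ) (σ : C(TopSimplex n, U)) :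
    (chainInEquiv U n (Finsupp.single σ 1) : Chain ℚ Y n) =
      Finsupp.single (simplexInEquiv U n σ).1 1 := by
  change (((Finsupp.supportedEquivFinsupp {σ : C(TopSimplex n, Y) | ∀ x, σ x ∈ U}).symm
    (Finsupp.domLCongr (simplexInEquiv U n) (Finsupp.single σ (1 : ℚ))) :
      Finsupp.supported ℚ ℚ {σ : C(TopSimplex n, Y) | ∀ x, σ x ∈ U}) : Chain ℚ Y n) = _
  rw [Finsupp.domLCongr_single]
  exact Finsupp.supportedEquivFinsupp_symm_single _ _ _

lemma boundary_chainInEquiv (U : Set Y) (n : ℕ) (c : Chain ℚ U (n + 1)) :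
    boundary (chainInEquiv U (n + 1) c : Chain ℚ Y (n + 1)) = chainInEquiv U n (boundary c) := by
  have h : boundary (R := ℚ) ∘ₗ (chainsIn ℚ U (n + 1)).subtype ∘ₗ
      (chainInEquiv U (n + 1)).toLinearMap =
      (chainsIn ℚ U n).subtype ∘ₗ (chainInEquiv U n).toLinearMap ∘ₗ boundary := by
    refine Finsupp.lhom_ext' fun σ => LinearMap.ext_ring ?_
    simp only [LinearMap.comp_apply, Finsupp.lsingle_apply, LinearEquiv.coe_coe,
      Submodule.subtype_apply, chainInEquiv_single, boundary_single, map_sum, map_smul]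
    rfl
  exact LinearMap.congr_fun h c

/-- The complex of chains with image in `U`. -/
abbrev complexIn (U : Set Y) : ChainComplex (ModuleCat.{u} ℚ) ℕ :=
  (subcomplexIn U).toComplex fun _ => boundary_boundary

/-- The chain complex of a subspace is the complex of chains with image in the subset. -/
def subspaceIso (U : Set Y) : finsuppComplex U ≅ complexIn U :=
  linearComplexIso _ _ (chainInEquiv U) fun n c => Subtype.ext (boundary_chainInEquiv U n c)

/-- The homology of a subspace is that of the chains with image in the subset. -/
def homologyIso (U : Set Y) (n : ℕ) :
    (SurfaceFibration.singularChains U).homology n ≅ (complexIn U).homology n :=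
  (HomologicalComplex.homologyFunctor _ _ n).mapIso (singularIso U ≪≫ subspaceIso U)

lemma inf_subcomplexIn (U V : Set Y) :
    (subcomplexIn U).inf (subcomplexIn V) = subcomplexIn (U ∩ V) := by
  unfold Subcomplex.inf subcomplexIn
  congr 1
  funext n
  change chainsIn ℚ U n ⊓ chainsIn ℚ V n = chainsIn ℚ (U ∩ V) n
  rw [chainsIn, chainsIn, chainsIn, ← Finsupp.supported_inter]
  congr 1
  ext σ
  exact forall_and.symm

lemma subcomplexIn_mono {U V : Set Y} (h : U ⊆ V) (n : ℕ) :
    (subcomplexIn U).carrier n ≤ (subcomplexIn V).carrier n :=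
  Finsupp.supported_mono fun _ hσ x => h (hσ x)

/-- The inclusion of the chains that are sums of chains in `P ∩ U` and in `P ∩ V`. -/
abbrev smallInclusion (P U V : Set Y) :
    ((subcomplexIn (P ∩ U)).sup (subcomplexIn (P ∩ V))).toComplex (fun _ => boundary_boundary) ⟶
      complexIn P :=
  Subcomplex.inclusion _ _ _ fun n =>
    sup_le (subcomplexIn_mono Set.inter_subset_left n) (subcomplexIn_mono Set.inter_subset_left n)

lemma isIso_homologyMap_smallInclusion {P U V : Set Y} (hU : IsOpen U) (hV : IsOpen V)
    (hP : P ⊆ U ∪ V) (n : ℕ) : IsIso (HomologicalComplex.homologyMap (smallInclusion P U V) n) :=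
  Subcomplex.isIso_homologyMap_inclusion _ _ _ _
    (fun _ hc => exists_sub_boundary_mem_zero hU hV hP hc)
    (fun _ _ hc hd => exists_sub_boundary_mem hU hV hP hc hd) n

/-- Small chains compute the homology. -/
def smallIso {P U V : Set Y} (hU : IsOpen U) (hV : IsOpen V) (hP : P ⊆ U ∪ V) (n : ℕ) :
    (((subcomplexIn (P ∩ U)).sup (subcomplexIn (P ∩ V))).toComplex
      fun _ => boundary_boundary).homology n ≅ (complexIn P).homology n :=
  have := isIso_homologyMap_smallInclusion hU hV hP n
  asIso (HomologicalComplex.homologyMap (smallInclusion P U V) n)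

end Subspace

end SingularChain

end

section

/-! ### Topological properties of the Euler number -/

open CategoryTheory Limits AlgebraicTopology HomologicalComplex

namespace SurfaceFibration

variable {Y Z : Type u} [TopologicalSpace Y] [TopologicalSpace Z]

section HomotopyInvariance

/-- The map on singular chains induced by a continuous map. -/
def chainsMap (f : C(Y, Z)) : singularChains Y ⟶ singularChains Z :=
  ((singularChainComplexFunctor (ModuleCat.{u} ℚ)).obj (ModuleCat.of ℚ (ULift.{u} ℚ))).map
    (TopCat.ofHom f)

lemma homologyMap_chainsMap_comp {W : Type u} [TopologicalSpace W] (g : C(Z, W)) (f : C(Y, Z))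
    (n : ℕ) : homologyMap (chainsMap (g.comp f)) n =
      homologyMap (chainsMap f) n ≫ homologyMap (chainsMap g) n := by
  rw [← homologyMap_comp]
  congr 1
  exact Functor.map_comp _ _ _

lemma homologyMap_chainsMap_id (n : ℕ) :
    homologyMap (chainsMap (ContinuousMap.id Y)) n = 𝟙 _ := by
  rw [← homologyMap_id]
  congr 1
  exact CategoryTheory.Functor.map_id _ _

lemma homologyMap_chainsMap_congr {f g : C(Y, Z)} (h : f.Homotopic g) (n : ℕ) :
    homologyMap (chainsMap f) n = homologyMap (chainsMap g) n :=
  TopCat.Homotopy.congr_homologyMap_singularChainComplexFunctor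
    (f := TopCat.ofHom f) (g := TopCat.ofHom g) h.some _ n

/-- Homotopy equivalent spaces have isomorphic homology. -/
def homologyIsoOfHomotopyEquiv (e : ContinuousMap.HomotopyEquiv Y Z) (n : ℕ) :
    (singularChains Y).homology n ≅ (singularChains Z).homology n where
  hom := homologyMap (chainsMap e.toFun) n
  inv := homologyMap (chainsMap e.invFun) n
  hom_inv_id := by
    rw [← homologyMap_chainsMap_comp, homologyMap_chainsMap_congr e.left_inv,
      homologyMap_chainsMap_id]
  inv_hom_id := by
    rw [← homologyMap_chainsMap_comp, homologyMap_chainsMap_congr e.right_inv,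
      homologyMap_chainsMap_id]

lemma HasFiniteHomology.of_homotopyEquiv (e : ContinuousMap.HomotopyEquiv Y Z)
    (h : HasFiniteHomology Y) : HasFiniteHomology Z :=
  FiniteTotalHomology.of_iso (homologyIsoOfHomotopyEquiv e) h

lemma HasFiniteHomology.of_homeomorph (e : Y ≃ₜ Z) (h : HasFiniteHomology Y) :
    HasFiniteHomology Z :=
  h.of_homotopyEquiv e.toHomotopyEquiv

lemma eulerNumber_congr (e : ContinuousMap.HomotopyEquiv Y Z) : eulerNumber Y = eulerNumber Z :=
  homologyEulerChar_congr (homologyIsoOfHomotopyEquiv e)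

lemma eulerNumber_congr_homeomorph (e : Y ≃ₜ Z) : eulerNumber Y = eulerNumber Z :=
  eulerNumber_congr e.toHomotopyEquiv

end HomotopyInvariance

section Contractible

lemma subsingleton_homology_punit (n : ℕ) (hn : n ≠ 0) :
    Subsingleton ((singularChains PUnit.{u + 1}).homology n) :=
  ModuleCat.subsingleton_of_isZero (isZero_singularHomologyFunctor_of_totallyDisconnectedSpace
    (ModuleCat.{u} ℚ) n (ModuleCat.of ℚ (ULift.{u} ℚ)) (TopCat.of PUnit.{u + 1}) hn)

/-- The zeroth homology of a point. -/
def homologyZeroPUnit : (singularChains PUnit.{u + 1}).homology 0 ≃ₗ[ℚ] ULift.{u} ℚ :=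
  (asIso ((TopCat.of PUnit.{u + 1}).singularHomology₀ε
    (ModuleCat.of ℚ (ULift.{u} ℚ)))).toLinearEquiv

lemma hasFiniteHomology_punit : HasFiniteHomology PUnit.{u + 1} := by
  refine ⟨fun n => ?_, 0, fun n hn => subsingleton_homology_punit n hn.ne'⟩
  obtain rfl | hn := eq_or_ne n 0
  · exact Module.Finite.equiv homologyZeroPUnit.symm
  · have := subsingleton_homology_punit n hn
    exact inferInstanceAs (Module.Finite ℚ ((singularChains PUnit.{u + 1}).homology n))

lemma eulerNumber_punit : eulerNumber PUnit.{u + 1} = 1 := by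
  rw [eulerNumber, homologyEulerChar_eq_sum_range (N := 0) fun n hn =>
    subsingleton_homology_punit n hn.ne']
  simp [homologyZeroPUnit.finrank_eq]

lemma hasFiniteHomology_of_contractible (Y : Type u) [TopologicalSpace Y] [ContractibleSpace Y] :
    HasFiniteHomology Y :=
  hasFiniteHomology_punit.of_homotopyEquiv (ContractibleSpace.hequiv PUnit.{u + 1} Y).some

lemma eulerNumber_of_contractible (Y : Type u) [TopologicalSpace Y] [ContractibleSpace Y] :
    eulerNumber Y = 1 :=
  (eulerNumber_congr (ContractibleSpace.hequiv PUnit.{u + 1} Y).some).symm.trans eulerNumber_punit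

end Contractible

section Empty

variable (Y : Type u) [TopologicalSpace Y] [IsEmpty Y]

lemma subsingleton_homology_of_isEmpty (n : ℕ) : Subsingleton ((singularChains Y).homology n) := by
  have hchain : Subsingleton (SingularChain.Chain ℚ Y n) := by
    have : IsEmpty C(SingularChain.TopSimplex n, Y) :=
      ⟨fun σ => isEmptyElim (σ (Classical.arbitrary _))⟩
    infer_instance
  refine ModuleCat.subsingleton_of_isZero (ExactAt.isZero_homology ?_)
  refine ExactAt.of_iso ?_ (SingularChain.singularIso Y).symm
  rw [exactAt_iff, ShortComplex.moduleCat_exact_iff]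
  intro x _
  exact ⟨0, hchain.elim _ _⟩

lemma hasFiniteHomology_of_isEmpty : HasFiniteHomology Y :=
  ⟨fun n => have := subsingleton_homology_of_isEmpty Y n
    inferInstanceAs (Module.Finite ℚ ((singularChains Y).homology n)),
    0, fun n _ => subsingleton_homology_of_isEmpty Y n⟩

lemma eulerNumber_of_isEmpty : eulerNumber Y = 0 := by
  have h := subsingleton_homology_of_isEmpty Y
  rw [eulerNumber, homologyEulerChar_eq_sum_range (N := 0) fun n _ => h n]
  simp [Module.finrank_zero_of_subsingleton]

end Empty

section MayerVietoris

open SingularChain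

lemma hasFiniteHomology_iff (U : Set Y) :
    HasFiniteHomology U ↔ FiniteTotalHomology (complexIn U) :=
  ⟨FiniteTotalHomology.of_iso (homologyIso U),
    FiniteTotalHomology.of_iso fun n => (homologyIso U n).symm⟩

lemma eulerNumber_eq (U : Set Y) : eulerNumber U = (complexIn U).homologyEulerChar :=
  homologyEulerChar_congr (homologyIso U)

variable {P U V : Set Y} (hU : IsOpen U) (hV : IsOpen V) (hP : P ⊆ U ∪ V)

include hU hV hP

theorem mayerVietoris_union (hPU : HasFiniteHomology ↥(P ∩ U)) (hPV : HasFiniteHomology ↥(P ∩ V))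
    (hPUV : HasFiniteHomology ↥((P ∩ U) ∩ (P ∩ V))) :
    HasFiniteHomology P ∧
      eulerNumber P + eulerNumber ↥((P ∩ U) ∩ (P ∩ V)) =
        eulerNumber ↥(P ∩ U) + eulerNumber ↥(P ∩ V) := by
  rw [hasFiniteHomology_iff] at *
  simp only [eulerNumber_eq]
  rw [complexIn, ← inf_subcomplexIn] at hPUV
  rw [complexIn.eq_1 ((P ∩ U) ∩ (P ∩ V)), ← inf_subcomplexIn]
  have hS := Subcomplex.mayerVietoris_shortExact (fun _ => boundary_boundary)
    (subcomplexIn (P ∩ U)) (subcomplexIn (P ∩ V))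
  have hsum := FiniteTotalHomology.of_shortExact₃ hS hPUV
    (Subcomplex.finiteTotalHomology_prodComplex _ _ _ hPU hPV)
  refine ⟨hsum.of_iso (smallIso hU hV hP), ?_⟩
  rw [← homologyEulerChar_congr (smallIso hU hV hP),
    ← Subcomplex.homologyEulerChar_prodComplex _ _ _ hPU hPV]
  exact ((homologyEulerChar_X₂ hS hPUV hsum).trans (add_comm _ _)).symm

theorem mayerVietoris_right (h : HasFiniteHomology P)
    (hPUV : HasFiniteHomology ↥((P ∩ U) ∩ (P ∩ V))) : HasFiniteHomology ↥(P ∩ V) := by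
  rw [hasFiniteHomology_iff] at *
  rw [complexIn, ← inf_subcomplexIn] at hPUV
  have hS := Subcomplex.mayerVietoris_shortExact (fun _ => boundary_boundary)
    (subcomplexIn (P ∩ U)) (subcomplexIn (P ∩ V))
  exact Subcomplex.finiteTotalHomology_right _ _ _
    (.of_shortExact₂ hS hPUV (h.of_iso fun n => (smallIso hU hV hP n).symm))

end MayerVietoris

end SurfaceFibration

end

section

/-! ### Finiteness of the homology of compact manifolds -/

open CategoryTheory Limits HomologicalComplex

lemma finite_range_of_forall_ker_mem {R M N P : Type*} [Ring R] [IsNoetherianRing R]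
    [AddCommGroup M] [AddCommGroup N] [AddCommGroup P] [Module R M] [Module R N] [Module R P]
    (g : M →ₗ[R] N) (b : M →ₗ[R] P) [Module.Finite R (LinearMap.range b)] (W : Submodule R N)
    [Module.Finite R W] (h : ∀ x, b x = 0 → g x ∈ W) : Module.Finite R (LinearMap.range g) := by
  have : Module.Finite R (M ⧸ LinearMap.ker b) := Module.Finite.equiv b.quotKerEquivRange.symm
  let gBar : (M ⧸ LinearMap.ker b) →ₗ[R] N ⧸ W :=
    (LinearMap.ker b).liftQ (W.mkQ ∘ₗ g) fun x hx => by simpa using h x hx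
  have hrange : (LinearMap.range g).map W.mkQ = LinearMap.range gBar := by
    rw [← LinearMap.range_comp, Submodule.range_liftQ]
  rw [Module.Finite.iff_fg]
  refine Submodule.fg_of_fg_map_of_fg_inf_ker W.mkQ ?_ ?_
  · rw [hrange, ← Module.Finite.iff_fg]
    infer_instance
  · rw [Submodule.ker_mkQ, ← Module.Finite.iff_fg]
    exact Module.Finite.of_injective (Submodule.inclusion inf_le_right)
      (Submodule.inclusion_injective _)

section FiniteTotalRank

variable {R : Type*} [Ring R] {K L L' : ChainComplex (ModuleCat.{u} R) ℕ}

/-- The map induced by a chain map on total homology has finitely generated range. -/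
def FiniteTotalRank (φ : K ⟶ L) : Prop :=
  (∀ n, Module.Finite R (LinearMap.range (homologyMap φ n).hom)) ∧
    ∃ N : ℕ, ∀ n, N < n → homologyMap φ n = 0

lemma FiniteTotalRank.finiteTotalHomology (h : FiniteTotalRank (𝟙 K)) :
    FiniteTotalHomology K := by
  obtain ⟨hfin, N, hN⟩ := h
  refine ⟨fun n => ?_, N, fun n hn => ModuleCat.subsingleton_of_isZero
    ((IsZero.iff_id_eq_zero _).2 ((homologyMap_id K n).symm.trans (hN n hn)))⟩
  have hrange : LinearMap.range (homologyMap (𝟙 K) n).hom = ⊤ := by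
    rw [homologyMap_id]
    exact LinearMap.range_id
  have := hfin n
  rw [hrange] at this
  exact Module.Finite.equiv Submodule.topEquiv

lemma FiniteTotalHomology.finiteTotalRank [IsNoetherianRing R] (hL : FiniteTotalHomology L)
    (φ : K ⟶ L) : FiniteTotalRank φ := by
  obtain ⟨hfin, N, hN⟩ := hL
  exact ⟨fun n => have := hfin n; inferInstance, N, fun n hn =>
    have := hN n hn; (ModuleCat.isZero_of_subsingleton _).eq_of_tgt _ _⟩

namespace FiniteTotalRank

lemma comp_right {φ : K ⟶ L} (hφ : FiniteTotalRank φ) (ψ : L ⟶ L') : FiniteTotalRank (φ ≫ ψ) := by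
  obtain ⟨hfin, N, hN⟩ := hφ
  refine ⟨fun n => ?_, N, fun n hn => by rw [homologyMap_comp, hN n hn, zero_comp]⟩
  rw [homologyMap_comp, ModuleCat.hom_comp, LinearMap.range_comp]
  have := hfin n
  infer_instance

lemma exists_homologyMap_g_eq_of_δ_eq_zero {S₁ S₂ : ShortComplex (ChainComplex (ModuleCat.{u} R) ℕ)}
    (hS₁ : S₁.ShortExact) (hS₂ : S₂.ShortExact) (φ : S₁ ⟶ S₂) (n : ℕ)
    (x : S₁.X₃.homology (n + 1))
    (hx : homologyMap φ.τ₁ n (hS₁.δ (n + 1) n rfl x) = 0) :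
    ∃ y, homologyMap S₂.g (n + 1) y = homologyMap φ.τ₃ (n + 1) x := by
  have hδ : hS₂.δ (n + 1) n rfl (homologyMap φ.τ₃ (n + 1) x) = 0 :=
    (ConcreteCategory.congr_hom
      (HomologySequence.δ_naturality φ hS₁ hS₂ (n + 1) n rfl) x).symm.trans hx
  exact (ShortComplex.moduleCat_exact_iff _).1 (hS₂.homology_exact₃ (n + 1) n rfl) _ hδ

variable [IsNoetherianRing R]

lemma comp_left {ψ : L ⟶ L'} (hψ : FiniteTotalRank ψ) (φ : K ⟶ L) : FiniteTotalRank (φ ≫ ψ) := by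
  obtain ⟨hfin, N, hN⟩ := hψ
  refine ⟨fun n => ?_, N, fun n hn => by rw [homologyMap_comp, hN n hn, comp_zero]⟩
  rw [homologyMap_comp, ModuleCat.hom_comp]
  have := hfin n
  exact Module.Finite.of_injective (Submodule.inclusion (LinearMap.range_comp_le_range _ _))
    (Submodule.inclusion_injective _)

lemma add {φ ψ : K ⟶ L} (hφ : FiniteTotalRank φ) (hψ : FiniteTotalRank ψ) :
    FiniteTotalRank (φ + ψ) := by
  obtain ⟨hfin, N, hN⟩ := hφ
  obtain ⟨hfin', N', hN'⟩ := hψ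
  refine ⟨fun n => ?_, max N N', fun n hn => ?_⟩
  · have := hfin n
    have := hfin' n
    rw [homologyMap_add, ModuleCat.hom_add]
    refine Module.Finite.of_injective (Submodule.inclusion (?_ : _ ≤
      LinearMap.range (homologyMap φ n).hom ⊔ LinearMap.range (homologyMap ψ n).hom))
      (Submodule.inclusion_injective _)
    exact LinearMap.range_add_le _ _
  · rw [homologyMap_add, hN n ((le_max_left _ _).trans_lt hn),
      hN' n ((le_max_right _ _).trans_lt hn), add_zero]

lemma of_isIso_comp {φ : K ⟶ L} {ψ : L ⟶ L'} (hφ : ∀ n, IsIso (homologyMap φ n))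
    (h : FiniteTotalRank (φ ≫ ψ)) : FiniteTotalRank ψ := by
  obtain ⟨hfin, N, hN⟩ := h
  have hcomp (n : ℕ) : homologyMap ψ n = inv (homologyMap φ n) ≫ homologyMap (φ ≫ ψ) n := by
    rw [homologyMap_comp, IsIso.inv_hom_id_assoc]
  refine ⟨fun n => ?_, N, fun n hn => by rw [hcomp, hN n hn, comp_zero]⟩
  rw [hcomp, ModuleCat.hom_comp]
  have := hfin n
  exact Module.Finite.of_injective (Submodule.inclusion (LinearMap.range_comp_le_range _ _))
    (Submodule.inclusion_injective _)

theorem of_shortExact {S₁ S₂ : ShortComplex (ChainComplex (ModuleCat.{u} R) ℕ)}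
    (hS₁ : S₁.ShortExact) (hS₂ : S₂.ShortExact) (φ : S₁ ⟶ S₂) (hφ : FiniteTotalRank φ.τ₁)
    {ψ : S₂.X₃ ⟶ L} (hψ : FiniteTotalRank (S₂.g ≫ ψ)) : FiniteTotalRank (φ.τ₃ ≫ ψ) := by
  obtain ⟨hfin₁, N₁, hN₁⟩ := hφ
  obtain ⟨hfin₂, N₂, hN₂⟩ := hψ
  have hlift (n : ℕ) (x : S₁.X₃.homology n) (y : S₂.X₂.homology n)
      (hxy : homologyMap S₂.g n y = homologyMap φ.τ₃ n x) :
      homologyMap (φ.τ₃ ≫ ψ) n x = homologyMap (S₂.g ≫ ψ) n y := by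
    simp only [homologyMap_comp, ConcreteCategory.comp_apply, hxy]
  refine ⟨fun n => ?_, max (N₁ + 1) N₂, fun n hn => ?_⟩
  · have := hfin₂ n
    cases n with
    | zero =>
      refine Module.Finite.of_injective (Submodule.inclusion (?_ : _ ≤
        LinearMap.range (homologyMap (S₂.g ≫ ψ) 0).hom)) (Submodule.inclusion_injective _)
      rintro _ ⟨x, rfl⟩
      obtain ⟨y, hy⟩ := homologyMap_g_zero_surjective hS₂ (homologyMap φ.τ₃ 0 x)
      exact ⟨y, (hlift 0 x y hy).symm⟩
    | succ n =>
      have := hfin₁ n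
      have : Module.Finite R (LinearMap.range
          ((homologyMap φ.τ₁ n).hom ∘ₗ (hS₁.δ (n + 1) n rfl).hom)) :=
        Module.Finite.of_injective (Submodule.inclusion (LinearMap.range_comp_le_range _ _))
          (Submodule.inclusion_injective _)
      refine finite_range_of_forall_ker_mem _
        ((homologyMap φ.τ₁ n).hom ∘ₗ (hS₁.δ (n + 1) n rfl).hom)
        (LinearMap.range (homologyMap (S₂.g ≫ ψ) (n + 1)).hom) fun x hx => ?_
      obtain ⟨y, hy⟩ := exists_homologyMap_g_eq_of_δ_eq_zero hS₁ hS₂ φ n x hx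
      exact ⟨y, (hlift (n + 1) x y hy).symm⟩
  · obtain ⟨m, rfl⟩ : ∃ m, n = m + 1 := ⟨n - 1, by omega⟩
    refine ModuleCat.hom_ext (LinearMap.ext fun x => ?_)
    obtain ⟨y, hy⟩ := exists_homologyMap_g_eq_of_δ_eq_zero hS₁ hS₂ φ m x
      (by rw [hN₁ m (by omega)]; rfl)
    refine (hlift (m + 1) x y hy).trans ?_
    rw [hN₂ (m + 1) (by omega)]
    rfl

end FiniteTotalRank

end FiniteTotalRank

namespace SurfaceFibration

open SingularChain

variable {Y : Type u} [TopologicalSpace Y]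

/-- The inclusion of the chains in `V` in the chains in `U`. -/
def chainInclusion {V U : Set Y} (h : V ⊆ U) : complexIn V ⟶ complexIn U :=
  Subcomplex.inclusion _ _ _ (subcomplexIn_mono h)

lemma chainInclusion_comp {W V U : Set Y} (h : W ⊆ V) (h' : V ⊆ U) :
    chainInclusion h ≫ chainInclusion h' = chainInclusion (h.trans h') :=
  Subcomplex.inclusion_comp ..

lemma sumMap_comp_inclusion {A B U : Set Y} (hA : A ⊆ U) (hB : B ⊆ U)
    (h : ∀ n, ((subcomplexIn A).sup (subcomplexIn B)).carrier n ≤ (subcomplexIn U).carrier n) :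
    Subcomplex.sumMap (fun _ => boundary_boundary) (subcomplexIn A) (subcomplexIn B) ≫
        Subcomplex.inclusion _ _ (subcomplexIn U) h =
      Subcomplex.fst _ _ _ ≫ chainInclusion hA + Subcomplex.snd _ _ _ ≫ chainInclusion hB := by
  ext n x; rfl

lemma isIso_homologyMap_inclusion_union {A B : Set Y} (hA : IsOpen A) (hB : IsOpen B)
    (h : ∀ n, ((subcomplexIn A).sup (subcomplexIn B)).carrier n ≤
      (subcomplexIn (A ∪ B)).carrier n) (n : ℕ) :
    IsIso (homologyMap (Subcomplex.inclusion (fun _ => boundary_boundary)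
      ((subcomplexIn A).sup (subcomplexIn B)) (subcomplexIn (A ∪ B)) h) n) := by
  have transport {A' B' : Set Y} (eA : A' = A) (eB : B' = B) {h'}
      (hiso : IsIso (homologyMap (Subcomplex.inclusion (fun _ => boundary_boundary)
        ((subcomplexIn A').sup (subcomplexIn B')) (subcomplexIn (A ∪ B)) h') n)) :
      IsIso (homologyMap (Subcomplex.inclusion (fun _ => boundary_boundary)
        ((subcomplexIn A).sup (subcomplexIn B)) (subcomplexIn (A ∪ B)) h) n) := by
    subst eA eB
    exact hiso
  exact transport Set.union_inter_cancel_left Set.union_inter_cancel_right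
    (isIso_homologyMap_smallInclusion hA hB subset_rfl n)

theorem finiteTotalRank_union {A₁ A₂ B₁ B₂ U : Set Y} (hA₁ : IsOpen A₁) (hB₁ : IsOpen B₁)
    (hA : A₁ ⊆ A₂) (hB : B₁ ⊆ B₂) {hAU : A₂ ⊆ U} {hBU : B₂ ⊆ U}
    (rA : FiniteTotalRank (chainInclusion hAU)) (rB : FiniteTotalRank (chainInclusion hBU))
    (rAB : FiniteTotalRank (chainInclusion (Set.inter_subset_inter hA hB))) :
    FiniteTotalRank (chainInclusion (Set.union_subset (hA.trans hAU) (hB.trans hBU))) := by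
  let φ := Subcomplex.mayerVietorisMap (fun _ => boundary_boundary) (subcomplexIn_mono hA)
    (subcomplexIn_mono hB)
  have hφ : FiniteTotalRank φ.τ₁ := by
    have h : ∀ {p q : Subcomplex fun n => boundary (R := ℚ) (Y := Y) (n := n)}
        (_ : p = subcomplexIn (A₁ ∩ B₁)) (_ : q = subcomplexIn (A₂ ∩ B₂))
        (hpq : ∀ n, p.carrier n ≤ q.carrier n),
        FiniteTotalRank (Subcomplex.inclusion (fun _ => boundary_boundary) p q hpq) := by
      rintro _ _ rfl rfl _
      exact rAB
    exact h (inf_subcomplexIn _ _) (inf_subcomplexIn _ _) _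
  have hU (n : ℕ) : ((subcomplexIn A₂).sup (subcomplexIn B₂)).carrier n ≤
      (subcomplexIn U).carrier n :=
    sup_le (subcomplexIn_mono hAU n) (subcomplexIn_mono hBU n)
  have hsum : FiniteTotalRank (Subcomplex.sumMap (fun _ => boundary_boundary) (subcomplexIn A₂)
      (subcomplexIn B₂) ≫ Subcomplex.inclusion _ _ (subcomplexIn U) hU) := by
    rw [sumMap_comp_inclusion hAU hBU]
    exact (rA.comp_left _).add (rB.comp_left _)
  have hsmall := FiniteTotalRank.of_shortExact (Subcomplex.mayerVietoris_shortExact _ _ _)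
    (Subcomplex.mayerVietoris_shortExact _ _ _) φ hφ hsum
  have hunion (n : ℕ) : ((subcomplexIn A₁).sup (subcomplexIn B₁)).carrier n ≤
      (subcomplexIn (A₁ ∪ B₁)).carrier n :=
    sup_le (subcomplexIn_mono Set.subset_union_left n) (subcomplexIn_mono Set.subset_union_right n)
  refine FiniteTotalRank.of_isIso_comp (isIso_homologyMap_inclusion_union hA₁ hB₁ hunion) ?_
  have hfactor : Subcomplex.inclusion (fun _ => boundary_boundary) _ _ hunion ≫
      chainInclusion (Set.union_subset (hA.trans hAU) (hB.trans hBU)) =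
      φ.τ₃ ≫ Subcomplex.inclusion _ _ _ hU := by ext n x; rfl
  rwa [hfactor]

/-- Every neighbourhood of `A` contains a smaller one whose inclusion has finite rank on total
homology. Unlike finiteness of homology, this is inherited by unions of compact sets without
control on the shape of the intersections of their neighbourhoods. -/
def IsHomologicallyTame (A : Set Y) : Prop :=
  ∀ U, IsOpen U → A ⊆ U → ∃ V, IsOpen V ∧ A ⊆ V ∧ ∃ h : V ⊆ U, FiniteTotalRank (chainInclusion h)

lemma finiteTotalRank_chainInclusion {V U : Set Y} (h : V ⊆ U) (hV : HasFiniteHomology V) :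
    FiniteTotalRank (chainInclusion h) := by
  rw [← Category.id_comp (chainInclusion h)]
  exact FiniteTotalRank.comp_right (((hasFiniteHomology_iff V).1 hV).finiteTotalRank _) _

lemma IsHomologicallyTame.union [T2Space Y] {A B : Set Y} (hA : IsCompact A) (hB : IsCompact B)
    (tA : IsHomologicallyTame A) (tB : IsHomologicallyTame B)
    (tAB : IsHomologicallyTame (A ∩ B)) : IsHomologicallyTame (A ∪ B) := by
  intro U hU hABU
  obtain ⟨A₂, hA₂, hAA₂, hAU, rA⟩ := tA U hU (Set.subset_union_left.trans hABU)
  obtain ⟨B₂, hB₂, hBB₂, hBU, rB⟩ := tB U hU (Set.subset_union_right.trans hABU)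
  obtain ⟨V, hV, hABV, hVAB, rV⟩ :=
    tAB (A₂ ∩ B₂) (hA₂.inter hB₂) (Set.inter_subset_inter hAA₂ hBB₂)
  obtain ⟨G, H, hG, hH, hAG, hBH, hGH⟩ := SeparatedNhds.of_isCompact_isCompact
    (hA.diff hV) (hB.diff hV) (by
      rw [Set.disjoint_left]
      rintro x ⟨hxA, hxV⟩ ⟨hxB, -⟩
      exact hxV (hABV ⟨hxA, hxB⟩))
  have hAG' : A ⊆ A₂ ∩ (V ∪ G) := fun x hx =>
    ⟨hAA₂ hx, or_iff_not_imp_left.2 fun hxV => hAG ⟨hx, hxV⟩⟩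
  have hBH' : B ⊆ B₂ ∩ (V ∪ H) := fun x hx =>
    ⟨hBB₂ hx, or_iff_not_imp_left.2 fun hxV => hBH ⟨hx, hxV⟩⟩
  have hinter : A₂ ∩ (V ∪ G) ∩ (B₂ ∩ (V ∪ H)) ⊆ V := by
    rintro x ⟨⟨-, hxV | hxG⟩, -, hxV' | hxH⟩
    exacts [hxV, hxV, hxV', (Set.disjoint_left.1 hGH hxG hxH).elim]
  refine ⟨_, (hA₂.inter (hV.union hG)).union (hB₂.inter (hV.union hH)),
    Set.union_subset_union hAG' hBH', _, finiteTotalRank_union (hA₂.inter (hV.union hG))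
      (hB₂.inter (hV.union hH)) Set.inter_subset_left Set.inter_subset_left rA rB ?_⟩
  rw [← chainInclusion_comp hinter hVAB]
  exact rV.comp_left _

lemma IsHomologicallyTame.hasFiniteHomology (h : IsHomologicallyTame (Set.univ : Set Y)) :
    HasFiniteHomology Y := by
  obtain ⟨V, -, hV, hVU, hr⟩ := h Set.univ isOpen_univ subset_rfl
  obtain rfl := Set.univ_subset_iff.1 hV
  exact ((hasFiniteHomology_iff _).2 hr.finiteTotalHomology).of_homeomorph (Homeomorph.Set.univ Y)

/-- The part of the domain of a chart lying over a subset of its target. -/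
def chartSetHomeomorph {Y Z : Type*} [TopologicalSpace Y] [TopologicalSpace Z]
    (e : OpenPartialHomeomorph Y Z) {S : Set Z} (hS : S ⊆ e.target) :
    ↥(e.source ∩ e ⁻¹' S) ≃ₜ S :=
  e.homeomorphOfImageSubsetSource Set.inter_subset_left (by
    rw [e.image_source_inter_eq']
    ext z
    refine ⟨fun ⟨hz, hz'⟩ => ?_, fun hz => ⟨hS hz, ?_⟩⟩
    · simpa only [Set.mem_preimage, e.right_inv hz] using hz'
    · simpa only [Set.mem_preimage, e.right_inv (hS hz)] using hz)

variable {E : Type*} [NormedAddCommGroup E] [NormedSpace ℝ E] (e : OpenPartialHomeomorph Y E)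

lemma hasFiniteHomology_chart_convex {D : Set E} (hD : Convex ℝ D) (hDe : D ⊆ e.target) :
    HasFiniteHomology ↥(e.source ∩ e ⁻¹' D) := by
  rcases D.eq_empty_or_nonempty with rfl | hne
  · have : IsEmpty ↥(e.source ∩ e ⁻¹' (∅ : Set E)) := by simp
    exact hasFiniteHomology_of_isEmpty _
  · have : ContractibleSpace D := hD.contractibleSpace hne
    have := (chartSetHomeomorph e hDe).contractibleSpace
    exact hasFiniteHomology_of_contractible _

lemma hasFiniteHomology_union {U V : Set Y} (hU : IsOpen U) (hV : IsOpen V)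
    (fU : HasFiniteHomology U) (fV : HasFiniteHomology V)
    (fUV : HasFiniteHomology ↥(U ∩ V)) : HasFiniteHomology ↥(U ∪ V) := by
  refine (mayerVietoris_union hU hV subset_rfl ?_ ?_ ?_).1
  · rwa [Set.union_inter_cancel_left]
  · rwa [Set.union_inter_cancel_right]
  · rwa [Set.union_inter_cancel_left, Set.union_inter_cancel_right]

lemma hasFiniteHomology_chart_iUnion {ι : Type*} (t : Finset ι)
    (D : ι → Set E) (hD : ∀ i, Convex ℝ (D i)) (hO : ∀ i, IsOpen (D i))
    (hDe : ∀ i, D i ⊆ e.target) :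
    HasFiniteHomology ↥(⋃ i ∈ t, e.source ∩ e ⁻¹' D i) := by
  classical
  induction t using Finset.induction_on generalizing D with
  | empty =>
    have : IsEmpty ↥(⋃ i ∈ (∅ : Finset ι), e.source ∩ e ⁻¹' D i) := by simp
    exact hasFiniteHomology_of_isEmpty _
  | insert a t _ ih =>
    have hopen (i : ι) : IsOpen (e.source ∩ e ⁻¹' D i) := e.isOpen_inter_preimage (hO i)
    have hinter : (e.source ∩ e ⁻¹' D a) ∩ ⋃ i ∈ t, e.source ∩ e ⁻¹' D i =
        ⋃ i ∈ t, e.source ∩ e ⁻¹' (D a ∩ D i) := by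
      simp only [Set.inter_iUnion₂, Set.preimage_inter, ← Set.inter_inter_distrib_left]
    rw [Finset.set_biUnion_insert]
    refine hasFiniteHomology_union (hopen a) (isOpen_biUnion fun i _ => hopen i)
      (hasFiniteHomology_chart_convex e (hD a) (hDe a)) (ih D hD hO hDe) ?_
    rw [hinter]
    exact ih (fun i => D a ∩ D i) (fun i => (hD a).inter (hD i))
      (fun i => (hO a).inter (hO i)) (fun i => Set.inter_subset_left.trans (hDe a))

lemma isHomologicallyTame_of_subset_chart {A : Set Y} (hA : IsCompact A) (hAe : A ⊆ e.source) :
    IsHomologicallyTame A := by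
  intro U hU hAU
  have hopen : IsOpen (e.target ∩ e.symm ⁻¹' U) := e.isOpen_inter_preimage_symm hU
  have hmem : ∀ x ∈ A, ∃ r > 0, Metric.ball (e x) r ⊆ e.target ∩ e.symm ⁻¹' U := fun x hx =>
    Metric.isOpen_iff.1 hopen (e x) ⟨e.map_source (hAe hx), by
      simpa only [Set.mem_preimage, e.left_inv (hAe hx)] using hAU hx⟩
  choose! r hr hball using hmem
  obtain ⟨t, htA⟩ := hA.elim_nhds_subcover'
    (fun x _ => e.source ∩ e ⁻¹' Metric.ball (e x) (r x))
    (fun x hx => (e.isOpen_inter_preimage Metric.isOpen_ball).mem_nhds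
      ⟨hAe hx, Metric.mem_ball_self (hr x hx)⟩)
  refine ⟨⋃ x ∈ t, e.source ∩ e ⁻¹' Metric.ball (e x) (r x),
    isOpen_biUnion fun i _ => e.isOpen_inter_preimage Metric.isOpen_ball, htA,
    Set.iUnion₂_subset fun x _ y hy => ?_, finiteTotalRank_chainInclusion _ ?_⟩
  · simpa only [Set.mem_preimage, e.left_inv hy.1] using (hball x x.2 hy.2).2
  · exact hasFiniteHomology_chart_iUnion e t (fun x => Metric.ball (e x) (r x))
      (fun i => convex_ball _ _) (fun i => Metric.isOpen_ball)
      (fun i => (hball i i.2).trans Set.inter_subset_left)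

theorem hasFiniteHomology_of_charts [T2Space Y] [CompactSpace Y]
    (h : ∀ y : Y, ∃ e : OpenPartialHomeomorph Y E, y ∈ e.source) : HasFiniteHomology Y := by
  classical
  choose e he using h
  have hcompact (y : Y) : ∃ K, IsCompact K ∧ y ∈ interior K ∧ K ⊆ (e y).source :=
    exists_compact_subset (e y).open_source (he y)
  choose K hKc hyK hKe using hcompact
  obtain ⟨t, ht⟩ := isCompact_univ.elim_nhds_subcover (fun y : Y => interior (K y))
    (fun y _ => isOpen_interior.mem_nhds (hyK y))
  have htame (t : Finset Y) : IsHomologicallyTame (⋃ y ∈ t, K y) := by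
    induction t using Finset.induction_on with
    | empty =>
      simp only [Finset.notMem_empty, Set.iUnion_of_empty, Set.iUnion_empty]
      exact fun U _ _ => ⟨∅, isOpen_empty, subset_rfl, Set.empty_subset _,
        finiteTotalRank_chainInclusion _ (hasFiniteHomology_of_isEmpty _)⟩
    | insert a t _ ih =>
      rw [Finset.set_biUnion_insert]
      have hc : IsCompact (⋃ y ∈ t, K y) := t.isCompact_biUnion fun y _ => hKc y
      exact .union (hKc a) hc (isHomologicallyTame_of_subset_chart (e a) (hKc a) (hKe a)) ih
        (isHomologicallyTame_of_subset_chart (e a) ((hKc a).inter hc)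
          (Set.inter_subset_left.trans (hKe a)))
  have huniv : (⋃ y ∈ t, K y) = Set.univ := Set.eq_univ_of_univ_subset <|
    ht.2.trans (Set.iUnion₂_mono fun y _ => interior_subset)
  exact (huniv ▸ htame t).hasFiniteHomology

end SurfaceFibration

end

section

/-! ### Annuli -/

namespace SurfaceFibration

section Union

variable {Y : Type u} [TopologicalSpace Y] {U V : Set Y}

lemma eulerNumber_of_union_eq_univ (hU : IsOpen U) (hV : IsOpen V) (hUV : U ∪ V = Set.univ)
    (fU : HasFiniteHomology U) (fV : HasFiniteHomology V) (fUV : HasFiniteHomology ↥(U ∩ V)) :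
    HasFiniteHomology Y ∧ eulerNumber Y + eulerNumber ↥(U ∩ V) = eulerNumber U + eulerNumber V := by
  have h := mayerVietoris_union (P := Set.univ) hU hV hUV.ge (by rwa [Set.univ_inter])
    (by rwa [Set.univ_inter]) (by rwa [Set.univ_inter, Set.univ_inter])
  rw [Set.univ_inter, Set.univ_inter, eulerNumber_congr_homeomorph (Homeomorph.Set.univ Y)] at h
  exact ⟨h.1.of_homeomorph (Homeomorph.Set.univ Y), h.2⟩

lemma eulerNumber_of_disjoint {P : Set Y} (hU : IsOpen U) (hV : IsOpen V) (hP : P ⊆ U ∪ V)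
    (hUV : Disjoint (P ∩ U) (P ∩ V)) (fU : HasFiniteHomology ↥(P ∩ U))
    (fV : HasFiniteHomology ↥(P ∩ V)) :
    HasFiniteHomology P ∧ eulerNumber P = eulerNumber ↥(P ∩ U) + eulerNumber ↥(P ∩ V) := by
  have : IsEmpty ↥((P ∩ U) ∩ (P ∩ V)) := Set.isEmpty_coe_sort.2 hUV.inter_eq
  obtain ⟨hfin, heuler⟩ := mayerVietoris_union hU hV hP fU fV (hasFiniteHomology_of_isEmpty _)
  rw [eulerNumber_of_isEmpty ↥((P ∩ U) ∩ (P ∩ V)), add_zero] at heuler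
  exact ⟨hfin, heuler⟩

end Union

/-- The restriction to a subset of a homeomorphism onto a subspace. -/
def preimageHomeomorph {Y Z : Type*} [TopologicalSpace Y] [TopologicalSpace Z] {T : Set Z}
    (k : Y ≃ₜ T) (S : Set Z) : ↥{y | (k y : Z) ∈ S} ≃ₜ ↥(T ∩ S) where
  toFun y := ⟨k y, (k y).2, y.2⟩
  invFun z := ⟨k.symm ⟨z, z.2.1⟩, by simpa using z.2.2⟩
  left_inv y := by simp
  right_inv z := by simp
  continuous_toFun := by fun_prop
  continuous_invFun := by fun_prop

/-- The open annulus `r < |z| < R` in the plane. -/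
def annulus (r R : ℝ) : Set ℂ := {z | r < ‖z‖ ∧ ‖z‖ < R}

/-- The open rectangle onto which the logarithm maps the part of the annulus `r < |z| < R` where
the argument is in `(a, b)`. -/
def logRectangle (r R a b : ℝ) : Set ℂ := Set.Ioo (Real.log r) (Real.log R) ×ℂ Set.Ioo a b

variable {r R : ℝ}

section Sectors

variable {z : ℂ}

lemma log_mem_logRectangle (hr : 0 < r) (hR : r < R) {a b : ℝ} (hz : z ≠ 0) :
    Complex.log z ∈ logRectangle r R a b ↔ z ∈ annulus r R ∧ a < z.arg ∧ z.arg < b := by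
  have hz' : 0 < ‖z‖ := norm_pos_iff.2 hz
  rw [logRectangle, Complex.mem_reProdIm, Complex.log_re, Complex.log_im, Set.mem_Ioo, Set.mem_Ioo,
    Real.log_lt_log_iff hr hz', Real.log_lt_log_iff hz' (hr.trans hR)]
  rfl

lemma arg_pos_iff_of_mem_slitPlane (hz : z ∈ Complex.slitPlane) : 0 < z.arg ↔ 0 < z.im := by
  rcases eq_or_ne z.im 0 with him | him
  · have harg : z.arg = 0 := Complex.arg_eq_zero_iff.2
      ⟨((Complex.mem_slitPlane_iff.1 hz).resolve_right (not_not.2 him)).le, him⟩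
    rw [harg, him]
  · have harg : z.arg ≠ 0 := fun h => him (Complex.arg_eq_zero_iff.1 h).2
    rw [lt_iff_le_and_ne, lt_iff_le_and_ne, Complex.arg_nonneg_iff, and_iff_left harg.symm,
      and_iff_left him.symm]

lemma contractibleSpace_slitPlane_inter_log (hr : 0 < r) (hR : r < R) {a b : ℝ} (hab : a < b)
    (ha : -Real.pi ≤ a) (hb : b ≤ Real.pi) :
    ContractibleSpace ↥(Complex.slitPlane ∩ Complex.log ⁻¹' logRectangle r R a b) := by
  have hconvex : Convex ℝ (logRectangle r R a b) := 
    ((convex_Ioo (Real.log r) (Real.log R)).linear_preimage Complex.reLm).inter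
      ((convex_Ioo a b).linear_preimage Complex.imLm)
  obtain ⟨x, hx⟩ := Set.nonempty_Ioo.2 (Real.log_lt_log hr hR)
  obtain ⟨y, hy⟩ := Set.nonempty_Ioo.2 hab
  have : ContractibleSpace (logRectangle r R a b) := hconvex.contractibleSpace ⟨⟨x, y⟩, hx, hy⟩
  have htarget : logRectangle r R a b ⊆ Complex.expOpenPartialHomeomorph.symm.target :=
    fun w hw => ⟨ha.trans_lt hw.2.1, hw.2.2.trans_le hb⟩
  exact (chartSetHomeomorph Complex.expOpenPartialHomeomorph.symm htarget).contractibleSpace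

lemma contractibleSpace_annulus_inter_slitPlane (hr : 0 < r) (hR : r < R) :
    ContractibleSpace ↥(annulus r R ∩ Complex.slitPlane) := by
  have hlog : annulus r R ∩ Complex.slitPlane =
      Complex.slitPlane ∩ Complex.log ⁻¹' logRectangle r R (-Real.pi) Real.pi := by
    rw [Set.inter_comm]
    ext z
    refine and_congr_right fun hz => ?_
    rw [Set.mem_preimage, log_mem_logRectangle hr hR (Complex.slitPlane_ne_zero hz)]
    exact (and_iff_left ⟨Complex.neg_pi_lt_arg z, (Complex.arg_le_pi z).lt_of_ne
      (Complex.mem_slitPlane_iff_arg.1 hz).1⟩).symm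
  rw [hlog]
  exact contractibleSpace_slitPlane_inter_log hr hR (neg_lt_self Real.pi_pos) le_rfl le_rfl

lemma contractibleSpace_annulus_inter_upperHalfPlane (hr : 0 < r) (hR : r < R) :
    ContractibleSpace ↥(annulus r R ∩ {z | 0 < z.im}) := by
  have hlog : annulus r R ∩ {z | 0 < z.im} =
      Complex.slitPlane ∩ Complex.log ⁻¹' logRectangle r R 0 Real.pi := by
    ext z
    constructor
    · rintro ⟨hzA, hz⟩
      have hslit : z ∈ Complex.slitPlane := Complex.mem_slitPlane_iff.2 (.inr hz.ne')
      exact ⟨hslit, (log_mem_logRectangle hr hR (Complex.slitPlane_ne_zero hslit)).2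
        ⟨hzA, (arg_pos_iff_of_mem_slitPlane hslit).2 hz, (Complex.arg_le_pi z).lt_of_ne
          (Complex.mem_slitPlane_iff_arg.1 hslit).1⟩⟩
    · rintro ⟨hslit, hz⟩
      have hz' := (log_mem_logRectangle hr hR (Complex.slitPlane_ne_zero hslit)).1 hz
      exact ⟨hz'.1, (arg_pos_iff_of_mem_slitPlane hslit).1 hz'.2.1⟩
  rw [hlog]
  exact contractibleSpace_slitPlane_inter_log hr hR Real.pi_pos (neg_nonpos.2 Real.pi_pos.le) le_rfl

end Sectors

/-- The central symmetry of an annulus. -/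
def annulusNeg : annulus r R ≃ₜ annulus r R :=
  (Homeomorph.neg ℂ).subtype fun z => by simp [annulus]

variable {Y : Type u} [TopologicalSpace Y] (k : Y ≃ₜ annulus r R)

include k

lemma contractibleSpace_preimage_annulus (S : Set ℂ) [ContractibleSpace ↥(annulus r R ∩ S)] :
    ContractibleSpace ↥{y | (k y : ℂ) ∈ S} :=
  (preimageHomeomorph k S).contractibleSpace

lemma eulerNumber_annulus_inter_im_ne_zero (hr : 0 < r) (hR : r < R) :
    HasFiniteHomology ↥{y | (k y : ℂ).im ≠ 0} ∧ eulerNumber ↥{y | (k y : ℂ).im ≠ 0} = 2 := by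
  have him : Continuous fun y => (k y : ℂ).im := by fun_prop
  have := contractibleSpace_annulus_inter_upperHalfPlane hr hR
  have hupper : ({y | (k y : ℂ).im ≠ 0} ∩ {y | 0 < (k y : ℂ).im}) =
      {y | (k y : ℂ) ∈ {z : ℂ | 0 < z.im}} :=
    Set.inter_eq_right.2 fun y hy => (hy : 0 < (k y : ℂ).im).ne'
  have hlower : ({y | (k y : ℂ).im ≠ 0} ∩ {y | (k y : ℂ).im < 0}) =
      {y | (k.trans annulusNeg y : ℂ) ∈ {z : ℂ | 0 < z.im}} := by
    ext y
    change (k y : ℂ).im ≠ 0 ∧ (k y : ℂ).im < 0 ↔ 0 < (-(k y : ℂ)).im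
    rw [Complex.neg_im, neg_pos]
    exact and_iff_right_of_imp ne_of_lt
  have hc₁ : ContractibleSpace ↥({y | (k y : ℂ).im ≠ 0} ∩ {y | 0 < (k y : ℂ).im}) := by
    rw [hupper]
    exact contractibleSpace_preimage_annulus k _
  have hc₂ : ContractibleSpace ↥({y | (k y : ℂ).im ≠ 0} ∩ {y | (k y : ℂ).im < 0}) := by
    rw [hlower]
    exact contractibleSpace_preimage_annulus _ _
  obtain ⟨hfin, heuler⟩ := eulerNumber_of_disjoint (P := {y | (k y : ℂ).im ≠ 0})
    (isOpen_lt continuous_const him) (isOpen_lt him continuous_const)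
    (fun y hy => (lt_or_gt_of_ne hy).symm)
    (Set.disjoint_left.2 fun y hy hy' => lt_asymm (α := ℝ) hy.2 hy'.2)
    (hasFiniteHomology_of_contractible _) (hasFiniteHomology_of_contractible _)
  exact ⟨hfin, heuler.trans (congrArg₂ (· + ·) (eulerNumber_of_contractible _)
    (eulerNumber_of_contractible _))⟩

theorem eulerNumber_of_homeomorph_annulus (hr : 0 < r) (hR : r < R) :
    HasFiniteHomology Y ∧ eulerNumber Y = 0 := by
  let U := {y | (k y : ℂ) ∈ Complex.slitPlane}
  let V := {y | (k.trans annulusNeg y : ℂ) ∈ Complex.slitPlane}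
  have := contractibleSpace_annulus_inter_slitPlane hr hR
  have hcU : ContractibleSpace U := contractibleSpace_preimage_annulus _ _
  have hcV : ContractibleSpace V := contractibleSpace_preimage_annulus _ _
  have hU : IsOpen U := Complex.isOpen_slitPlane.preimage (by fun_prop)
  have hV : IsOpen V := Complex.isOpen_slitPlane.preimage (by fun_prop)
  have mem_U (y : Y) : y ∈ U ↔ 0 < (k y : ℂ).re ∨ (k y : ℂ).im ≠ 0 := Complex.mem_slitPlane_iff
  have mem_V (y : Y) : y ∈ V ↔ (k y : ℂ).re < 0 ∨ (k y : ℂ).im ≠ 0 := by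
    change -(k y : ℂ) ∈ Complex.slitPlane ↔ _
    rw [Complex.mem_slitPlane_iff, Complex.neg_re, Complex.neg_im, neg_pos, neg_ne_zero]
  have hunion : U ∪ V = Set.univ := Set.eq_univ_of_forall fun y => by
    by_contra! h
    simp only [Set.mem_union, mem_U, mem_V, not_or, not_lt, not_not] at h
    exact norm_pos_iff.1 (hr.trans (k y).2.1) (Complex.ext (le_antisymm h.1.1 h.2.1) h.1.2)
  have hinter : U ∩ V = {y | (k y : ℂ).im ≠ 0} := by
    ext y
    rw [Set.mem_inter_iff, mem_U, mem_V, Set.mem_ofPred_eq]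
    refine ⟨fun ⟨h, h'⟩ => ?_, fun h => ⟨.inr h, .inr h⟩⟩
    exact h.elim (fun h => h'.resolve_left h.not_gt) id
  obtain ⟨hfin, heuler⟩ := eulerNumber_annulus_inter_im_ne_zero k hr hR
  rw [← hinter] at hfin heuler
  obtain ⟨h, h'⟩ := eulerNumber_of_union_eq_univ hU hV hunion
    (hasFiniteHomology_of_contractible U) (hasFiniteHomology_of_contractible V) hfin
  rw [heuler, eulerNumber_of_contractible U, eulerNumber_of_contractible V] at h'
  exact ⟨h, by linarith⟩

end SurfaceFibration

end

section

/-! ### The local contribution of a double point -/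

namespace SurfaceFibration

section Conic

/-- The part of the conic `x * y = c` where `x` lies in the annulus `r < |x| < R`. -/
def conicPart (c : ℂ) (r R : ℝ) : Set (ℂ × ℂ) := {v | v.1 * v.2 = c ∧ v.1 ∈ annulus r R}

/-- The part of the conic `x * y = c` between two bidiscs. -/
def conicShell (c : ℂ) (δ ε : ℝ) : Set (ℂ × ℂ) := {v | v.1 * v.2 = c ∧ δ < ‖v‖ ∧ ‖v‖ < ε}

variable {c : ℂ} {r R δ ε : ℝ}

/-- A conic is parametrised by its first coordinate. -/
def conicHomeomorph (hr : 0 < r) : conicPart c r R ≃ₜ annulus r R where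
  toFun v := ⟨v.1.1, v.2.2⟩
  invFun z := ⟨(z, c / z), mul_div_cancel₀ _ (norm_pos_iff.1 (hr.trans z.2.1)), z.2⟩
  left_inv v := Subtype.ext <| Prod.ext rfl <|
    (eq_div_of_mul_eq (norm_pos_iff.1 (hr.trans v.2.2.1)) ((mul_comm _ _).trans v.2.1)).symm
  right_inv _ := rfl
  continuous_toFun := by fun_prop
  continuous_invFun := Continuous.subtype_mk (continuous_subtype_val.prodMk
    (continuous_const.div continuous_subtype_val fun z => norm_pos_iff.1 (hr.trans z.2.1))) _

/-- The exchange of the two coordinates on a conic. -/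
def conicShellSwap : conicShell c δ ε ≃ₜ conicShell c δ ε :=
  (Homeomorph.prodComm ℂ ℂ).subtype fun v => by
    simp only [conicShell, Set.mem_ofPred_eq, Prod.norm_def, Homeomorph.coe_prodComm, Prod.fst_swap,
      Prod.snd_swap, max_comm, mul_comm]

lemma conicShell_inter (hc : ‖c‖ ≤ δ * ε) :
    conicShell c δ ε ∩ {v | δ < ‖v.1‖} = conicPart c δ ε := by
  ext ⟨x, y⟩
  constructor
  · rintro ⟨⟨hxy, -, hε⟩, hx⟩
    exact ⟨hxy, hx, (norm_fst_le _).trans_lt hε⟩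
  · rintro ⟨hxy : x * y = c, hx : δ < ‖x‖, hxε : ‖x‖ < ε⟩
    have hy : ‖y‖ < ε := by
      rw [← hxy, norm_mul] at hc
      refine lt_of_mul_lt_mul_left (hc.trans_lt ?_) (norm_nonneg x)
      gcongr
      exact (norm_nonneg x).trans_lt hxε
    exact ⟨⟨hxy, hx.trans_le (norm_fst_le (x, y)), Prod.norm_mk x y ▸ max_lt hxε hy⟩, hx⟩

lemma conicPart_eq (hc : c ≠ 0) (hε : 0 < ε) :
    conicPart c (‖c‖ / ε) ε = {v : ℂ × ℂ | ‖v‖ < ε ∧ v.1 * v.2 = c} := by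
  ext ⟨x, y⟩
  rw [Set.mem_ofPred_eq, Prod.norm_mk, max_lt_iff, and_comm (b := x * y = c)]
  refine and_congr_right fun hxy : x * y = c => ?_
  have hx : 0 < ‖x‖ := norm_pos_iff.2 (left_ne_zero_of_mul (hxy.trans_ne hc))
  change ‖c‖ / ε < ‖x‖ ∧ ‖x‖ < ε ↔ _
  rw [div_lt_iff₀ hε, ← hxy, norm_mul, mul_lt_mul_iff_right₀ hx, and_comm]

variable {Y : Type u} [TopologicalSpace Y]

lemma eulerNumber_of_homeomorph_conicPart (k : Y ≃ₜ conicPart c r R) (hr : 0 < r) (hR : r < R) :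
    HasFiniteHomology Y ∧ eulerNumber Y = 0 :=
  eulerNumber_of_homeomorph_annulus (k.trans (conicHomeomorph hr)) hr hR

lemma eulerNumber_conicShell_fst (k : Y ≃ₜ conicShell c δ ε) (hδ : 0 < δ) (hε : δ < ε)
    (hc : ‖c‖ ≤ δ * ε) : HasFiniteHomology ↥{y | δ < ‖(k y : ℂ × ℂ).1‖} ∧
      eulerNumber ↥{y | δ < ‖(k y : ℂ × ℂ).1‖} = 0 :=
  eulerNumber_of_homeomorph_conicPart ((preimageHomeomorph k {v | δ < ‖v.1‖}).trans
    (.setCongr (conicShell_inter hc))) hδ hε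

lemma eulerNumber_of_homeomorph_conicShell (k : Y ≃ₜ conicShell c δ ε) (hδ : 0 < δ) (hε : δ < ε)
    (hc : ‖c‖ ≤ δ * δ) : HasFiniteHomology Y ∧ eulerNumber Y = 0 := by
  let U := {y | δ < ‖(k y : ℂ × ℂ).1‖}
  let V := {y | δ < ‖(k.trans conicShellSwap y : ℂ × ℂ).1‖}
  have hcε : ‖c‖ ≤ δ * ε := hc.trans (by gcongr)
  obtain ⟨fU, eU⟩ := eulerNumber_conicShell_fst k hδ hε hcε
  obtain ⟨fV, eV⟩ := eulerNumber_conicShell_fst (k.trans conicShellSwap) hδ hε hcε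
  have hunion : U ∪ V = Set.univ := Set.eq_univ_of_forall fun y => lt_max_iff.1 (k y).2.2.1
  have hinter : U ∩ V = ∅ := by
    rw [Set.eq_empty_iff_forall_notMem]
    rintro y ⟨hx : δ < ‖(k y : ℂ × ℂ).1‖, hy : δ < ‖(k y : ℂ × ℂ).2‖⟩
    have hxy : ‖(k y : ℂ × ℂ).1‖ * ‖(k y : ℂ × ℂ).2‖ = ‖c‖ := by rw [← norm_mul, (k y).2.1]
    exact (hxy.trans_le hc).not_gt (mul_lt_mul'' hx hy hδ.le hδ.le)
  have : IsEmpty ↥(U ∩ V) := Set.isEmpty_coe_sort.2 hinter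
  obtain ⟨hfin, heuler⟩ := eulerNumber_of_union_eq_univ (isOpen_lt (by fun_prop) (by fun_prop))
    (isOpen_lt (by fun_prop) (by fun_prop)) hunion fU fV (hasFiniteHomology_of_isEmpty _)
  rw [eulerNumber_of_isEmpty ↥(U ∩ V)] at heuler
  exact ⟨hfin, by linarith⟩

end Conic

section Cutoff

/-- A piecewise linear cutoff function, equal to `1` up to `1 / 3` and to `0` from `2 / 3` on. -/
def cutoff (t : ℝ) : ℝ := max 0 (min 1 (2 - 3 * t))

lemma cutoff_nonneg (t : ℝ) : 0 ≤ cutoff t := le_max_left _ _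

lemma cutoff_le_one (t : ℝ) : cutoff t ≤ 1 := max_le zero_le_one (min_le_left _ _)

lemma cutoff_eq_one {t : ℝ} (h : t ≤ 1 / 3) : cutoff t = 1 := by
  rw [cutoff, min_eq_left (by linarith), max_eq_right zero_le_one]

lemma cutoff_eq_zero {t : ℝ} (h : 2 / 3 ≤ t) : cutoff t = 0 :=
  max_eq_left ((min_le_right _ _).trans (by linarith))

lemma lipschitzWith_cutoff : LipschitzWith 3 cutoff := by
  refine LipschitzWith.const_max (LipschitzWith.const_min ?_ 1) 0
  refine LipschitzWith.of_dist_le_mul fun x y => ?_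
  rw [Real.dist_eq, Real.dist_eq, show (2 - 3 * x) - (2 - 3 * y) = -3 * (x - y) by ring, abs_mul]
  norm_num

end Cutoff

section NodeModel

/-- The partial smoothing of the double point `x * y = 0`: it agrees with the conic `x * y = c`
away from the origin and with `x * y = 0` near the origin. -/
def nodeModel (c : ℂ) (ε : ℝ) : Set (ℂ × ℂ) :=
  {v | ‖v‖ < ε ∧ v.1 * v.2 = c * (1 - cutoff (‖v‖ / ε) : ℝ)}

/-- The function whose graph is the branch `|y| ≤ |x|` of `nodeModel c ε`. -/
def nodeBranch (c : ℂ) (ε : ℝ) (x : ℂ) : ℂ := c * (1 - cutoff (‖x‖ / ε) : ℝ) / x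

variable {c : ℂ} {ε : ℝ}

lemma nodeBranch_eq_zero (hε : 0 < ε) {x : ℂ} (hx : ‖x‖ ≤ ε / 3) : nodeBranch c ε x = 0 := by
  rw [nodeBranch, cutoff_eq_one (by rw [div_le_iff₀ hε]; linarith), sub_self, Complex.ofReal_zero,
    mul_zero, zero_div]

lemma nodeBranch_zero : nodeBranch c ε 0 = 0 := div_zero _

lemma continuous_nodeBranch (hε : 0 < ε) : Continuous (nodeBranch c ε) := by
  refine continuous_iff_continuousAt.2 fun x => ?_
  rcases eq_or_ne x 0 with rfl | hx
  · refine ContinuousAt.congr (f := fun _ => (0 : ℂ)) continuousAt_const ?_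
    filter_upwards [Metric.ball_mem_nhds (0 : ℂ) (by positivity : 0 < ε / 3)] with y hy
    exact (nodeBranch_eq_zero hε (mem_ball_zero_iff.1 hy).le).symm
  · have := lipschitzWith_cutoff.continuous
    exact ContinuousAt.div (by fun_prop) continuousAt_id hx

lemma mul_nodeBranch (x : ℂ) : x * nodeBranch c ε x = c * (1 - cutoff (‖x‖ / ε) : ℝ) := by
  rcases eq_or_ne x 0 with rfl | hx
  · rw [norm_zero, zero_div, cutoff_eq_one (by norm_num), sub_self, Complex.ofReal_zero, mul_zero,
      zero_mul]
  · rw [nodeBranch, mul_div_cancel₀ _ hx]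

lemma norm_mul_one_sub_cutoff_le (t : ℝ) : ‖c * (1 - cutoff t : ℝ)‖ ≤ ‖c‖ := by
  rw [norm_mul, Complex.norm_real, Real.norm_of_nonneg (sub_nonneg.2 (cutoff_le_one t))]
  exact mul_le_of_le_one_right (norm_nonneg _) (by linarith [cutoff_nonneg t])

lemma eq_nodeBranch {v : ℂ × ℂ} (hv : v ∈ nodeModel c ε) (h : ‖v.2‖ ≤ ‖v.1‖) :
    v.2 = nodeBranch c ε v.1 := by
  rcases eq_or_ne v.1 0 with hx | hx
  · rw [hx, norm_zero] at h
    rw [hx, nodeBranch_zero, norm_le_zero_iff.1 h]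
  · have hmul := hv.2
    rw [Prod.norm_def, max_eq_left h] at hmul
    rw [nodeBranch, ← hmul, mul_div_cancel_left₀ _ hx]

lemma swap_mem_nodeModel {v : ℂ × ℂ} : v.swap ∈ nodeModel c ε ↔ v ∈ nodeModel c ε := by
  simp only [nodeModel, Set.mem_ofPred_eq, Prod.norm_def, Prod.fst_swap, Prod.snd_swap, max_comm,
    mul_comm]

lemma nodeModel_induction {p : ℂ × ℂ → Prop} (hswap : ∀ v, p v.swap → p v)
    (h : ∀ v ∈ nodeModel c ε, ‖v.2‖ ≤ ‖v.1‖ → p v) {v : ℂ × ℂ} (hv : v ∈ nodeModel c ε) : p v :=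
  (le_total ‖v.2‖ ‖v.1‖).elim (h v hv) fun hle => hswap v (h _ (swap_mem_nodeModel.2 hv) hle)

/-- The contraction of `nodeModel c ε` to the origin along its branches. Both branches contribute,
but one of `a` and `b` vanishes on the model, since the branches only meet at the origin. -/
def nodeContraction (c : ℂ) (ε : ℝ) (t : ℝ) (v : ℂ × ℂ) : ℂ × ℂ :=
  let a : ℂ := if ‖v.2‖ ≤ ‖v.1‖ then v.1 else 0
  let b : ℂ := if ‖v.1‖ ≤ ‖v.2‖ then v.2 else 0
  (t * a + nodeBranch c ε (t * b), nodeBranch c ε (t * a) + t * b)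

lemma nodeContraction_swap (t : ℝ) (v : ℂ × ℂ) :
    nodeContraction c ε t v.swap = (nodeContraction c ε t v).swap :=
  Prod.ext (add_comm _ _) (add_comm _ _)

lemma nodeContraction_zero (v : ℂ × ℂ) : nodeContraction c ε 0 v = 0 := by
  simp [nodeContraction, nodeBranch_zero]

variable (hε : 0 < ε) (hc : ‖c‖ < (ε / 3) ^ 2)

include hε hc

lemma norm_nodeBranch_le (x : ℂ) : ‖nodeBranch c ε x‖ ≤ ‖x‖ := by
  rcases le_or_gt ‖x‖ (ε / 3) with h | h
  · rw [nodeBranch_eq_zero hε h, norm_zero]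
    exact norm_nonneg x
  · have hx : 0 < ‖x‖ := (by positivity : 0 < ε / 3).trans h
    rw [nodeBranch, norm_div, div_le_iff₀ hx, ← sq]
    exact (norm_mul_one_sub_cutoff_le _).trans (hc.le.trans (by gcongr))

lemma eq_zero_of_norm_eq {v : ℂ × ℂ} (hv : v ∈ nodeModel c ε) (h : ‖v.2‖ = ‖v.1‖) : v = 0 := by
  have hx : v.1 = 0 := by
    rcases le_or_gt ‖v.1‖ (ε / 3) with hle | hlt
    · rw [eq_nodeBranch hv h.le, nodeBranch_eq_zero hε hle, norm_zero] at h
      exact norm_eq_zero.1 h.symm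
    · have hsq : ‖v.1‖ ^ 2 ≤ ‖c‖ := by
        rw [sq]
        nth_rw 2 [← h]
        rw [← norm_mul, hv.2]
        exact norm_mul_one_sub_cutoff_le _
      have hlt' : (ε / 3) ^ 2 < ‖v.1‖ ^ 2 := by gcongr
      exact absurd (hlt'.trans_le hsq) hc.not_gt
  rw [hx, norm_zero, norm_eq_zero] at h
  exact Prod.ext hx h

lemma nodeBranch_mem {x : ℂ} (hx : ‖x‖ < ε) : (x, nodeBranch c ε x) ∈ nodeModel c ε := by
  have hnorm : ‖(x, nodeBranch c ε x)‖ = ‖x‖ := max_eq_left (norm_nodeBranch_le hε hc x)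
  exact ⟨hnorm.trans_lt hx, by rw [hnorm, mul_nodeBranch]⟩

lemma nodeContraction_of_le {v : ℂ × ℂ} (hv : v ∈ nodeModel c ε) (h : ‖v.2‖ ≤ ‖v.1‖) (t : ℝ) :
    nodeContraction c ε t v = (t * v.1, nodeBranch c ε (t * v.1)) := by
  rcases h.lt_or_eq with hlt | heq
  · simp [nodeContraction, h, hlt.not_ge, nodeBranch_zero]
  · rw [eq_zero_of_norm_eq hε hc hv heq]
    simp [nodeContraction, nodeBranch_zero]

lemma nodeContraction_mem {v : ℂ × ℂ} (hv : v ∈ nodeModel c ε) {t : ℝ}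
    (ht : t ∈ Set.Icc (0 : ℝ) 1) : nodeContraction c ε t v ∈ nodeModel c ε := by
  refine nodeModel_induction (p := fun v => nodeContraction c ε t v ∈ nodeModel c ε)
    (fun v hv => ?_) (fun v hv h => ?_) hv
  · rwa [nodeContraction_swap, swap_mem_nodeModel] at hv
  · rw [nodeContraction_of_le hε hc hv h]
    refine nodeBranch_mem hε hc ?_
    rw [norm_mul, Complex.norm_real, Real.norm_of_nonneg ht.1]
    exact (mul_le_of_le_one_left (norm_nonneg _) ht.2).trans_lt ((norm_fst_le v).trans_lt hv.1)

lemma nodeContraction_one {v : ℂ × ℂ} (hv : v ∈ nodeModel c ε) : nodeContraction c ε 1 v = v := by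
  refine nodeModel_induction (p := fun v => nodeContraction c ε 1 v = v)
    (fun v hv => ?_) (fun v hv h => ?_) hv
  · exact Prod.swap_injective ((nodeContraction_swap 1 v).symm.trans hv)
  · rw [nodeContraction_of_le hε hc hv h, Complex.ofReal_one, one_mul, ← eq_nodeBranch hv h]

lemma continuous_nodeContraction :
    Continuous fun p : ℝ × nodeModel c ε => nodeContraction c ε p.1 p.2 := by
  have ha : Continuous fun v : nodeModel c ε => if ‖v.1.2‖ ≤ ‖v.1.1‖ then v.1.1 else 0 :=
    Continuous.if_le (by fun_prop) continuous_const (by fun_prop) (by fun_prop) fun v hv => by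
      rw [eq_zero_of_norm_eq hε hc v.2 hv, Prod.fst_zero]
  have hb : Continuous fun v : nodeModel c ε => if ‖v.1.1‖ ≤ ‖v.1.2‖ then v.1.2 else 0 :=
    Continuous.if_le (by fun_prop) continuous_const (by fun_prop) (by fun_prop) fun v hv => by
      rw [eq_zero_of_norm_eq hε hc v.2 hv.symm, Prod.snd_zero]
  have hta := (Complex.continuous_ofReal.comp continuous_fst).mul
    (ha.comp (continuous_snd (X := ℝ)))
  have htb := (Complex.continuous_ofReal.comp continuous_fst).mul
    (hb.comp (continuous_snd (X := ℝ)))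
  exact (hta.add ((continuous_nodeBranch hε).comp htb)).prodMk
    (((continuous_nodeBranch hε).comp hta).add htb)

theorem contractibleSpace_nodeModel : ContractibleSpace (nodeModel c ε) := by
  have hzero : (0 : ℂ × ℂ) ∈ nodeModel c ε := by
    simpa only [nodeBranch_zero, Prod.mk_zero_zero] using
      nodeBranch_mem hε hc (x := 0) (by rwa [norm_zero])
  rw [contractible_iff_id_nullhomotopic]
  refine ⟨⟨0, hzero⟩, ⟨⟨⟨fun p => ⟨nodeContraction c ε (unitInterval.symm p.1) p.2,
    nodeContraction_mem hε hc p.2.2 (unitInterval.symm p.1).2⟩, ?_⟩, fun v => ?_, fun v => ?_⟩⟩⟩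
  · have hsymm : Continuous fun p : unitInterval × nodeModel c ε =>
        (((unitInterval.symm p.1 : unitInterval) : ℝ), p.2) := by fun_prop
    exact ((continuous_nodeContraction hε hc).comp hsymm).subtype_mk _
  · exact Subtype.ext (by simp [nodeContraction_one hε hc v.2])
  · exact Subtype.ext (by simp [nodeContraction_zero])

end NodeModel

section Replace

variable {Y : Type u} [TopologicalSpace Y]

section ChartBall

variable {E : Type*} [PseudoMetricSpace E]

/-- The open ball with centre `a` and radius `r` in the coordinates of the chart `e`. -/
def chartBall (e : OpenPartialHomeomorph Y E) (a : E) (r : ℝ) : Set Y :=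
  e.source ∩ e ⁻¹' Metric.ball a r

/-- The closed ball with centre `a` and radius `r` in the coordinates of the chart `e`. -/
def chartClosedBall (e : OpenPartialHomeomorph Y E) (a : E) (r : ℝ) : Set Y :=
  e.source ∩ e ⁻¹' Metric.closedBall a r

variable (e : OpenPartialHomeomorph Y E) (a : E) {r R : ℝ}

lemma isOpen_chartBall : IsOpen (chartBall e a r) := e.isOpen_inter_preimage Metric.isOpen_ball

lemma chartClosedBall_subset_chartBall (h : r < R) : chartClosedBall e a r ⊆ chartBall e a R :=
  Set.inter_subset_inter_right _ (Set.preimage_mono (Metric.closedBall_subset_ball h))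

variable {e a} in
lemma isClosed_chartClosedBall [T2Space Y] [ProperSpace E] (h : Metric.closedBall a r ⊆ e.target) :
    IsClosed (chartClosedBall e a r) := by
  rw [chartClosedBall, ← e.symm_image_eq_source_inter_preimage h]
  exact ((isCompact_closedBall a r).image_of_continuousOn (e.continuousOn_symm.mono h)).isClosed

end ChartBall

variable {P Q : Set Y}

lemma eulerNumber_replace {N K : Set Y} (hN : IsOpen N) (hK : IsClosed K) (hKN : K ⊆ N)
    (hPQ : P ∩ Kᶜ = Q ∩ Kᶜ) (hPN : ContractibleSpace ↥(P ∩ N))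
    (hQN : HasFiniteHomology ↥(Q ∩ N) ∧ eulerNumber ↥(Q ∩ N) = 0)
    (hQNK : HasFiniteHomology ↥((Q ∩ N) ∩ (Q ∩ Kᶜ)) ∧ eulerNumber ↥((Q ∩ N) ∩ (Q ∩ Kᶜ)) = 0)
    (hQ : HasFiniteHomology Q) :
    HasFiniteHomology P ∧ eulerNumber P = eulerNumber Q + 1 := by
  have hcover (R : Set Y) : R ⊆ N ∪ Kᶜ := fun y _ => (em (y ∈ K)).imp (@hKN y) id
  have hoverlap : (P ∩ N) ∩ (P ∩ Kᶜ) = (Q ∩ N) ∩ (Q ∩ Kᶜ) := by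
    rw [← Set.inter_inter_distrib_left, ← Set.inter_inter_distrib_left, Set.inter_comm N,
      ← Set.inter_assoc, ← Set.inter_assoc, hPQ]
  have hQK := mayerVietoris_right hN hK.isOpen_compl (hcover Q) hQ hQNK.1
  have eQ := (mayerVietoris_union hN hK.isOpen_compl (hcover Q) hQN.1 hQK hQNK.1).2
  rw [hQN.2, hQNK.2] at eQ
  obtain ⟨hP, eP⟩ := mayerVietoris_union hN hK.isOpen_compl (hcover P)
    (hasFiniteHomology_of_contractible _) (by rwa [hPQ]) (by rw [hoverlap]; exact hQNK.1)
  rw [eulerNumber_of_contractible ↥(P ∩ N), hoverlap, hQNK.2, hPQ] at eP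
  exact ⟨hP, by linarith⟩

theorem eulerNumber_node [T2Space Y] (φ : OpenPartialHomeomorph Y (ℂ × ℂ)) {c : ℂ} {ε : ℝ}
    (hε : 0 < ε) (hc₀ : c ≠ 0) (hc : ‖c‖ < (ε / 3) ^ 2) (hball : Metric.ball 0 ε ⊆ φ.target)
    (hP : P ∩ chartBall φ 0 ε = φ.source ∩ φ ⁻¹' nodeModel c ε)
    (hQ : Q ∩ chartBall φ 0 ε = φ.source ∩ φ ⁻¹' {v | ‖v‖ < ε ∧ v.1 * v.2 = c})
    (hPQ : P ∩ (chartClosedBall φ 0 (2 * ε / 3))ᶜ = Q ∩ (chartClosedBall φ 0 (2 * ε / 3))ᶜ)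
    (hQf : HasFiniteHomology Q) :
    HasFiniteHomology P ∧ eulerNumber P = eulerNumber Q + 1 := by
  have hlt : 2 * ε / 3 < ε := by linarith
  have hoverlap : (Q ∩ chartBall φ 0 ε) ∩ (Q ∩ (chartClosedBall φ 0 (2 * ε / 3))ᶜ) =
      φ.source ∩ φ ⁻¹' conicShell c (2 * ε / 3) ε := by
    ext q
    have hq := Set.ext_iff.1 hQ q
    simp only [conicShell, chartBall, chartClosedBall, Set.mem_inter_iff, Set.mem_compl_iff,
      Set.mem_preimage, mem_ball_zero_iff, mem_closedBall_zero_iff, Set.mem_ofPred_eq,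
      ← not_le] at hq ⊢
    tauto
  refine eulerNumber_replace (isOpen_chartBall φ 0)
    (isClosed_chartClosedBall ((Metric.closedBall_subset_ball hlt).trans hball))
    (chartClosedBall_subset_chartBall φ 0 hlt) hPQ ?_ ?_ ?_ hQf
  · rw [hP]
    have := contractibleSpace_nodeModel hε hc
    exact (chartSetHomeomorph φ (S := nodeModel c ε) fun v hv =>
      hball (mem_ball_zero_iff.2 hv.1)).contractibleSpace
  · rw [hQ, ← conicPart_eq hc₀ hε]
    refine eulerNumber_of_homeomorph_conicPart (chartSetHomeomorph φ fun v hv => ?_)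
      (by positivity) ?_
    · rw [conicPart_eq hc₀ hε] at hv
      exact hball (mem_ball_zero_iff.2 hv.1)
    · rw [div_lt_iff₀ hε]
      nlinarith
  · rw [hoverlap]
    exact eulerNumber_of_homeomorph_conicShell (chartSetHomeomorph φ fun v hv =>
      hball (mem_ball_zero_iff.2 hv.2.2)) (by positivity) (by linarith) (by nlinarith)

end Replace

end SurfaceFibration

end

section

/-! ### Bump functions in charts -/

open Filter Topology

namespace SurfaceFibration

/-- The map `g` is Lipschitz on a neighbourhood of `x`. -/
def LipschitzNear {E F : Type*} [PseudoEMetricSpace E] [PseudoEMetricSpace F] (g : E → F) (x : E) :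
    Prop :=
  ∃ K, ∃ t ∈ 𝓝 x, LipschitzOnWith K g t

namespace LipschitzNear

variable {E F G : Type*} [PseudoEMetricSpace E] [PseudoEMetricSpace F] [PseudoEMetricSpace G]
  {f : E → F} {x : E}

lemma of_lipschitzWith {K} (hf : LipschitzWith K f) (x : E) : LipschitzNear f x :=
  ⟨K, Set.univ, univ_mem, hf.lipschitzOnWith⟩

lemma continuousAt (hf : LipschitzNear f x) : ContinuousAt f x := by
  obtain ⟨K, t, ht, h⟩ := hf
  exact h.continuousOn.continuousAt ht

lemma comp {g : F → G} (hg : LipschitzNear g (f x)) (hf : LipschitzNear f x) :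
    LipschitzNear (g ∘ f) x := by
  have hc := hf.continuousAt
  obtain ⟨K, t, ht, h⟩ := hf
  obtain ⟨K', t', ht', h'⟩ := hg
  exact ⟨K' * K, t ∩ f ⁻¹' t', inter_mem ht (hc ht'),
    h'.comp (h.mono Set.inter_subset_left) fun y hy => hy.2⟩

lemma prodMk {g : E → G} (hf : LipschitzNear f x) (hg : LipschitzNear g x) :
    LipschitzNear (fun y => (f y, g y)) x := by
  obtain ⟨K, t, ht, h⟩ := hf
  obtain ⟨K', t', ht', h'⟩ := hg
  exact ⟨max K K', t ∩ t', inter_mem ht ht',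
    (h.mono Set.inter_subset_left).prodMk (h'.mono Set.inter_subset_right)⟩

lemma congr {g : E → F} (hf : LipschitzNear f x) (h : f =ᶠ[𝓝 x] g) : LipschitzNear g x := by
  obtain ⟨K, t, ht, hK⟩ := hf
  refine ⟨K, t ∩ {y | f y = g y}, inter_mem ht h, fun a ha b hb => ?_⟩
  rw [← show f a = g a from ha.2, ← show f b = g b from hb.2]
  exact hK ha.1 hb.1

end LipschitzNear

variable {X : Type*} [TopologicalSpace X] {E : Type*}

/-- All transition maps of a family of charts are locally Lipschitz. -/
def LipschitzCompatible [PseudoEMetricSpace E] (𝒞 : Set (OpenPartialHomeomorph X E)) : Prop :=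
  ∀ ψ ∈ 𝒞, ∀ ψ' ∈ 𝒞, ∀ q ∈ ψ.source, q ∈ ψ'.source → LipschitzNear (ψ' ∘ ψ.symm) (ψ q)

/-- The function `σ` is locally Lipschitz in a family of charts. -/
def ChartLipschitz [PseudoEMetricSpace E] (𝒞 : Set (OpenPartialHomeomorph X E)) (σ : X → ℝ) :
    Prop :=
  ∀ ψ ∈ 𝒞, ∀ q ∈ ψ.source, LipschitzNear (σ ∘ ψ.symm) (ψ q)

namespace ChartLipschitz

variable [PseudoEMetricSpace E] {𝒞 : Set (OpenPartialHomeomorph X E)} {σ τ : X → ℝ}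

lemma const (a : ℝ) : ChartLipschitz 𝒞 fun _ => a :=
  fun _ _ _ _ => .of_lipschitzWith (LipschitzWith.const a) _

lemma comp {g : ℝ → ℝ} {K} (hg : LipschitzWith K g) (hσ : ChartLipschitz 𝒞 σ) :
    ChartLipschitz 𝒞 fun q => g (σ q) :=
  fun ψ hψ q hq => (LipschitzNear.of_lipschitzWith hg _).comp (hσ ψ hψ q hq)

lemma comp₂ {g : ℝ × ℝ → ℝ} {K} (hg : LipschitzWith K g) (hσ : ChartLipschitz 𝒞 σ)
    (hτ : ChartLipschitz 𝒞 τ) : ChartLipschitz 𝒞 fun q => g (σ q, τ q) :=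
  fun ψ hψ q hq => (LipschitzNear.of_lipschitzWith hg _).comp ((hσ ψ hψ q hq).prodMk (hτ ψ hψ q hq))

lemma add (hσ : ChartLipschitz 𝒞 σ) (hτ : ChartLipschitz 𝒞 τ) :
    ChartLipschitz 𝒞 fun q => σ q + τ q :=
  comp₂ (LipschitzWith.prod_fst.add LipschitzWith.prod_snd) hσ hτ

protected lemma min (hσ : ChartLipschitz 𝒞 σ) (hτ : ChartLipschitz 𝒞 τ) :
    ChartLipschitz 𝒞 fun q => min (σ q) (τ q) :=
  comp₂ (LipschitzWith.prod_fst.min LipschitzWith.prod_snd) hσ hτ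

lemma sum {ι : Type*} (t : Finset ι) {f : ι → X → ℝ} (hf : ∀ i ∈ t, ChartLipschitz 𝒞 (f i)) :
    ChartLipschitz 𝒞 fun q => ∑ i ∈ t, f i q := by
  classical
  induction t using Finset.induction_on with
  | empty => simpa only [Finset.sum_empty] using const 0
  | insert a t ha ih =>
    simp only [Finset.sum_insert ha]
    exact (hf a (Finset.mem_insert_self a t)).add
      (ih fun i hi => hf i (Finset.mem_insert_of_mem hi))

end ChartLipschitz

variable [NormedAddCommGroup E]

open Classical in
/-- The bump function which is `1` within distance `r / 3` of `a` in the coordinates of `ψ`, and `0`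
beyond distance `2 * r / 3`. -/
def bump (ψ : OpenPartialHomeomorph X E) (a : E) (r : ℝ) (q : X) : ℝ :=
  if q ∈ ψ.source then cutoff (‖ψ q - a‖ / r) else 0

variable {ψ : OpenPartialHomeomorph X E} {a : E} {r : ℝ} {q : X}

lemma bump_of_mem (hq : q ∈ ψ.source) : bump ψ a r q = cutoff (‖ψ q - a‖ / r) := if_pos hq

lemma bump_nonneg (q : X) : 0 ≤ bump ψ a r q := by
  unfold bump
  split_ifs
  exacts [cutoff_nonneg _, le_rfl]

lemma bump_eq_one (hr : 0 < r) (hq : q ∈ chartBall ψ a (r / 3)) : bump ψ a r q = 1 := by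
  have hdist : ‖ψ q - a‖ < r / 3 := mem_ball_iff_norm.1 hq.2
  rw [bump_of_mem hq.1, cutoff_eq_one]
  rw [div_le_iff₀ hr]
  linarith

lemma bump_eq_zero (hr : 0 < r) (hq : q ∉ chartClosedBall ψ a (2 * r / 3)) :
    bump ψ a r q = 0 := by
  unfold bump
  split_ifs with hqψ
  · have hdist : 2 * r / 3 < ‖ψ q - a‖ :=
      lt_of_not_ge fun h => hq ⟨hqψ, mem_closedBall_iff_norm.2 h⟩
    refine cutoff_eq_zero ?_
    rw [le_div_iff₀ hr]
    linarith
  · rfl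

lemma exists_lipschitzWith_cutoff_norm (a : E) (r : ℝ) :
    ∃ K, LipschitzWith K fun v : E => cutoff (‖v - a‖ / r) := by
  have hnorm : LipschitzWith (1 * (1 + 0)) fun v : E => ‖v - a‖ :=
    lipschitzWith_one_norm.comp (LipschitzWith.id.sub (LipschitzWith.const a))
  have hdiv : LipschitzWith ‖r⁻¹‖₊ fun x : ℝ => x / r := by
    simpa only [div_eq_mul_inv, smul_eq_mul, mul_comm] using lipschitzWith_smul (β := ℝ) r⁻¹
  exact ⟨_, lipschitzWith_cutoff.comp (hdiv.comp hnorm)⟩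

variable [ProperSpace E] [T2Space X]

lemma isOpen_compl_bumpSupport (hr : 0 < r) (hψ : Metric.ball a r ⊆ ψ.target) :
    IsOpen (chartClosedBall ψ a (2 * r / 3))ᶜ :=
  (isClosed_chartClosedBall
    ((Metric.closedBall_subset_ball (by linarith)).trans hψ)).isOpen_compl

lemma continuous_bump (hr : 0 < r) (hψ : Metric.ball a r ⊆ ψ.target) :
    Continuous (bump ψ a r) := by
  refine continuous_iff_continuousAt.2 fun q => ?_
  by_cases hq : q ∈ chartClosedBall ψ a (2 * r / 3)
  · obtain ⟨K, hK⟩ := exists_lipschitzWith_cutoff_norm a r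
    refine ContinuousAt.congr (hK.continuous.continuousAt.comp (ψ.continuousAt hq.1)) ?_
    filter_upwards [ψ.open_source.mem_nhds hq.1] with p hp
    exact (bump_of_mem hp).symm
  · refine ContinuousAt.congr (f := fun _ => (0 : ℝ)) continuousAt_const ?_
    filter_upwards [(isOpen_compl_bumpSupport hr hψ).mem_nhds hq] with p hp
    exact (bump_eq_zero hr hp).symm

lemma chartLipschitz_bump {𝒞 : Set (OpenPartialHomeomorph X E)} (h𝒞 : LipschitzCompatible 𝒞)
    (hψ𝒞 : ψ ∈ 𝒞) (hr : 0 < r) (hψ : Metric.ball a r ⊆ ψ.target) :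
    ChartLipschitz 𝒞 (bump ψ a r) := by
  intro φ hφ q hq
  have hφq : Tendsto φ.symm (𝓝 (φ q)) (𝓝 q) := φ.tendsto_symm hq
  by_cases hqψ : q ∈ chartClosedBall ψ a (2 * r / 3)
  · obtain ⟨K, hK⟩ := exists_lipschitzWith_cutoff_norm a r
    refine ((LipschitzNear.of_lipschitzWith hK _).comp (h𝒞 φ hφ ψ hψ𝒞 q hq hqψ.1)).congr ?_
    filter_upwards [hφq (ψ.open_source.mem_nhds hqψ.1)] with v hv
    exact (bump_of_mem hv).symm
  · refine (LipschitzNear.of_lipschitzWith (LipschitzWith.const (0 : ℝ)) _).congr ?_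
    filter_upwards [hφq ((isOpen_compl_bumpSupport hr hψ).mem_nhds hqψ)] with v hv
    exact (bump_eq_zero hr hv).symm

end SurfaceFibration

end

section

/-! ### Moving a fibre inside a chart -/

open Filter Topology

namespace SurfaceFibration

lemma continuous_fixedPoint {Z α : Type*} [TopologicalSpace Z] [MetricSpace α] [CompleteSpace α]
    [Nonempty α] {K : NNReal} {g : Z → α → α} (hg : ∀ z, ContractingWith K (g z))
    (hc : ∀ a, Continuous fun z => g z a) : Continuous fun z => (hg z).fixedPoint := by
  refine continuous_iff_continuousAt.2 fun z => tendsto_iff_dist_tendsto_zero.2 ?_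
  let a := (hg z).fixedPoint
  have hmove : Tendsto (fun w => dist a (g w a) / (1 - K)) (𝓝 z) (𝓝 0) := by
    have hza : g z a = a := (hg z).fixedPoint_isFixedPt
    have hcont : Continuous fun w => dist a (g w a) / (1 - K : ℝ) :=
      (continuous_const.dist (hc a)).div_const _
    simpa only [hza, dist_self, zero_div] using hcont.tendsto z
  refine squeeze_zero (fun _ => dist_nonneg) (fun w => ?_) hmove
  rw [dist_comm]
  exact (hg w).dist_fixedPoint_le a

variable {X : Type*} {W : Set X} {F : X → ℂ} {c : ℂ}

/-- The locus `F = c σ` in `W`. For `σ` with values in `[0, 1]` it interpolates between the fibres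
of `F` over `0` and `c`. -/
def dampedFibre (W : Set X) (F : X → ℂ) (c : ℂ) (σ : X → ℝ) : Set X := {q ∈ W | F q = c * σ q}

lemma dampedFibre_zero : dampedFibre W F c 0 = W ∩ F ⁻¹' {0} := by
  ext q
  simp only [dampedFibre, Pi.zero_apply, Complex.ofReal_zero, mul_zero, Set.mem_ofPred_eq,
    Set.mem_inter_iff, Set.mem_preimage, Set.mem_singleton_iff]

lemma dampedFibre_one : dampedFibre W F c 1 = W ∩ F ⁻¹' {c} := by
  ext q
  simp only [dampedFibre, Pi.one_apply, Complex.ofReal_one, mul_one, Set.mem_ofPred_eq,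
    Set.mem_inter_iff, Set.mem_preimage, Set.mem_singleton_iff]

lemma norm_mul_ofReal_le {u : ℝ} (hu : u ∈ Set.Icc 0 1) : ‖c * u‖ ≤ ‖c‖ := by
  rw [norm_mul, Complex.norm_real, Real.norm_of_nonneg hu.1]
  exact mul_le_of_le_one_right (norm_nonneg c) hu.2

lemma dampedFibre_congr {O : Set X} (hO : ∀ q ∈ W, ‖F q‖ ≤ ‖c‖ → q ∈ O) {σ τ : X → ℝ}
    (hσ : ∀ q, σ q ∈ Set.Icc 0 1) (hτ : ∀ q, τ q ∈ Set.Icc 0 1) (h : Set.EqOn σ τ O) :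
    dampedFibre W F c σ = dampedFibre W F c τ := by
  have hsub {ρ : X → ℝ} (hρ : ∀ q, ρ q ∈ Set.Icc 0 1) : dampedFibre W F c ρ ⊆ O := fun q hq =>
    hO q hq.1 (hq.2 ▸ norm_mul_ofReal_le (hρ q))
  ext q
  exact ⟨fun hq => ⟨hq.1, h (hsub hσ hq) ▸ hq.2⟩, fun hq => ⟨hq.1, (h (hsub hτ hq)).symm ▸ hq.2⟩⟩

variable [TopologicalSpace X] {ψ : OpenPartialHomeomorph X (ℂ × ℂ)} {z : ℂ} {r : ℝ}

/-- A chart in which `F` is the first coordinate, together with a bidisc of radius `r` around the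
point `z` of the fibre `F = 0` whose closure is covered by the chart. -/
structure IsSmoothChart (W : Set X) (F : X → ℂ) (ψ : OpenPartialHomeomorph X (ℂ × ℂ)) (z : ℂ)
    (r : ℝ) : Prop where
  source_subset : ψ.source ⊆ W
  fst_eq : ∀ q ∈ ψ.source, (ψ q).1 = F q
  pos : 0 < r
  closedBall_subset : Metric.closedBall (0, z) r ⊆ ψ.target

/-- On the discs `u ↦ (c u, w)`, `w ∈ Ω`, of a chart, `σ` is a contraction in the real parameter
`u ∈ [0, 1]`. -/
def ContractsAlong (ψ : OpenPartialHomeomorph X (ℂ × ℂ)) (c : ℂ) (Ω : Set ℂ) (σ : X → ℝ) : Prop :=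
  ∀ w ∈ Ω, LipschitzOnWith 2⁻¹ (fun u : ℝ => σ (ψ.symm (c * u, w))) (Set.Icc 0 1)

lemma eventually_lipschitzOnWith_segment {f : ℂ × ℂ → ℝ} (hf : LipschitzNear f (0, z)) :
    ∀ᶠ p : ℂ × ℂ in 𝓝 (0, z),
      LipschitzOnWith 2⁻¹ (fun u : ℝ => f (p.1 * u, p.2)) (Set.Icc 0 1) := by
  obtain ⟨L, t, ht, hL⟩ := hf
  obtain ⟨δ, hδ, hball⟩ := Metric.mem_nhds_iff.1 ht
  have hsmall : ∀ᶠ p : ℂ × ℂ in 𝓝 (0, z), L * ‖p.1‖ < 2⁻¹ :=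
    ContinuousAt.eventually_lt (by fun_prop) continuousAt_const (by simp)
  filter_upwards [Metric.ball_mem_nhds _ hδ, hsmall] with p hpδ hpL
  have hmem : Set.MapsTo (fun u : ℝ => (p.1 * u, p.2)) (Set.Icc 0 1) t := by
    intro u hu
    rw [← ball_prod_same] at hpδ
    refine hball (ball_prod_same (0 : ℂ) z δ ▸ ⟨mem_ball_zero_iff.2 ?_, hpδ.2⟩)
    exact (norm_mul_ofReal_le hu).trans_lt (mem_ball_zero_iff.1 hpδ.1)
  refine LipschitzOnWith.of_dist_le_mul fun u hu v hv => ?_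
  have hdist : dist (p.1 * u, p.2) (p.1 * v, p.2) = ‖p.1‖ * dist u v := by
    rw [Prod.dist_eq, dist_self, max_eq_left dist_nonneg, dist_eq_norm, ← mul_sub, norm_mul,
      ← Complex.ofReal_sub, Complex.norm_real, ← dist_eq_norm]
  calc dist (f (p.1 * u, p.2)) (f (p.1 * v, p.2))
      ≤ L * dist (p.1 * u, p.2) (p.1 * v, p.2) := hL.dist_le_mul _ (hmem hu) _ (hmem hv)
    _ = L * ‖p.1‖ * dist u v := by rw [hdist, mul_assoc]
    _ ≤ 2⁻¹ * dist u v := by gcongr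

lemma eventually_contractsAlong {𝒞 : Set (OpenPartialHomeomorph X (ℂ × ℂ))} {σ : X → ℝ}
    (hσ : ChartLipschitz 𝒞 σ) (hψ𝒞 : ψ ∈ 𝒞) (hψ : IsSmoothChart W F ψ z r) :
    ∀ᶠ c : ℂ in 𝓝 0, ContractsAlong ψ c (Metric.ball z r) σ := by
  have hcover : ∀ᶠ c : ℂ in 𝓝 0, ∀ w ∈ Metric.closedBall z r,
      LipschitzOnWith 2⁻¹ (fun u : ℝ => σ (ψ.symm (c * u, w))) (Set.Icc 0 1) := by
    refine (isCompact_closedBall z r).eventually_forall_of_forall_eventually fun w hw => ?_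
    have hw : ((0 : ℂ), w) ∈ ψ.target := hψ.closedBall_subset
      (closedBall_prod_same (0 : ℂ) z r ▸ ⟨Metric.mem_closedBall_self hψ.pos.le, hw⟩)
    have hnear := hσ ψ hψ𝒞 _ (ψ.map_target hw)
    rw [ψ.right_inv hw] at hnear
    exact eventually_lipschitzOnWith_segment hnear
  exact hcover.mono fun c hc w hw => hc w (Metric.ball_subset_closedBall hw)

/-- In the chart `ψ`, the locus `F = c σ` is the graph `x = c * U y` over `Ω`: the value `U y` is
the unique fixed point of `u ↦ σ (c u, y)` in `[0, 1]`. -/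
structure IsGraphOver (ψ : OpenPartialHomeomorph X (ℂ × ℂ)) (c : ℂ) (Ω : Set ℂ) (σ : X → ℝ)
    (U : ℂ → ℝ) : Prop where
  continuousOn : ContinuousOn U Ω
  mem : ∀ w ∈ Ω, U w ∈ Set.Icc 0 1
  eq_iff : ∀ w ∈ Ω, ∀ u ∈ Set.Icc (0 : ℝ) 1, σ (ψ.symm (c * u, w)) = u ↔ u = U w

open Classical in
/-- In the chart `ψ`, replace the first coordinate by the graph `c * U`, over `Ω`. -/
def slide (ψ : OpenPartialHomeomorph X (ℂ × ℂ)) (c : ℂ) (Ω : Set ℂ) (U : ℂ → ℝ) (q : X) : X :=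
  if q ∈ ψ.source ∧ (ψ q).2 ∈ Ω then ψ.symm (c * U (ψ q).2, (ψ q).2) else q

section Slide

variable {Ω : Set ℂ} {σ σ' : X → ℝ} {U U' : ℂ → ℝ}

lemma slide_of_mem {q : X} (hq : q ∈ ψ.source) (hqΩ : (ψ q).2 ∈ Ω) :
    slide ψ c Ω U q = ψ.symm (c * U (ψ q).2, (ψ q).2) := if_pos ⟨hq, hqΩ⟩

lemma slide_of_notMem {q : X} (hq : ¬(q ∈ ψ.source ∧ (ψ q).2 ∈ Ω)) : slide ψ c Ω U q = q :=
  if_neg hq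

lemma exists_isGraphOver (hc : ∀ u ∈ Set.Icc (0 : ℝ) 1, ∀ w ∈ Ω, (c * u, w) ∈ ψ.target)
    (hσ : ∀ q, σ q ∈ Set.Icc 0 1) (hσc : Continuous σ) (hσψ : ContractsAlong ψ c Ω σ) :
    ∃ U, IsGraphOver ψ c Ω σ U := by
  classical
  let g (w : Ω) (u : Set.Icc (0 : ℝ) 1) : Set.Icc (0 : ℝ) 1 := ⟨σ (ψ.symm (c * u, w)), hσ _⟩
  have hg (w : Ω) : ContractingWith 2⁻¹ (g w) :=
    ⟨inv_lt_one_of_one_lt₀ one_lt_two, fun u v => hσψ w w.2 u.2 v.2⟩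
  have hgc (u : Set.Icc (0 : ℝ) 1) : Continuous fun w => g w u := by
    refine Continuous.subtype_mk (hσc.comp ?_) _
    exact ψ.continuousOn_symm.comp_continuous (by fun_prop) fun w => hc u u.2 w w.2
  refine ⟨fun w => if h : w ∈ Ω then (hg ⟨w, h⟩).fixedPoint else 0, ?_, ?_, ?_⟩
  · rw [continuousOn_iff_continuous_domRestrict]
    refine (continuous_subtype_val.comp (continuous_fixedPoint hg hgc)).congr fun w => ?_
    simp only [Set.domRestrict_apply, dif_pos w.2, Function.comp_apply]
  · intro w hw
    rw [dif_pos hw]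
    exact Subtype.prop _
  · intro w hw u hu
    rw [dif_pos hw]
    constructor
    · intro hfix
      have := (hg ⟨w, hw⟩).fixedPoint_unique (x := ⟨u, hu⟩) (Subtype.ext hfix)
      exact congrArg Subtype.val this
    · rintro rfl
      exact congrArg Subtype.val (hg ⟨w, hw⟩).fixedPoint_isFixedPt

namespace IsSmoothChart

lemma mem_target (hψ : IsSmoothChart W F ψ z r) (hc : ‖c‖ ≤ r) {u : ℝ} (hu : u ∈ Set.Icc 0 1)
    {w : ℂ} (hw : w ∈ Metric.ball z r) : (c * u, w) ∈ ψ.target :=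
  hψ.closedBall_subset <| closedBall_prod_same (0 : ℂ) z r ▸
    ⟨mem_closedBall_zero_iff.2 ((norm_mul_ofReal_le hu).trans hc), Metric.ball_subset_closedBall hw⟩

lemma snd_mem_ball (hψ : IsSmoothChart W F ψ z r) {q : X}
    (hq : q ∈ chartClosedBall ψ (0, z) (2 * r / 3)) : (ψ q).2 ∈ Metric.ball z r := by
  have hqz : ψ q ∈ Metric.closedBall (0, z) (2 * r / 3) := hq.2
  rw [← closedBall_prod_same] at hqz
  exact Metric.closedBall_subset_ball (by linarith [hψ.pos]) hqz.2

lemma symm_graph_eq (hψ : IsSmoothChart W F ψ z r) (hU : IsGraphOver ψ c Ω σ U)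
    (hσ : ∀ q, σ q ∈ Set.Icc 0 1) {q : X} (hq : F q = c * σ q) (hqψ : q ∈ ψ.source)
    (hqΩ : (ψ q).2 ∈ Ω) : ψ.symm (c * U (ψ q).2, (ψ q).2) = q := by
  have hψq : ψ.symm (c * σ q, (ψ q).2) = q := by
    rw [← hq, ← hψ.fst_eq q hqψ, ψ.left_inv hqψ]
  rw [← (hU.eq_iff _ hqΩ (σ q) (hσ q)).1 (congrArg σ hψq), hψq]

end IsSmoothChart

section SameOutside

variable (hψ : IsSmoothChart W F ψ z r) (hc : ‖c‖ ≤ r)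
  (hσσ' : Set.EqOn σ σ' (chartClosedBall ψ (0, z) (2 * r / 3))ᶜ)
  (hU' : IsGraphOver ψ c (Metric.ball z r) σ' U')

include hψ hc hσσ' hU' in
lemma slide_mem_dampedFibre {q : X} (hq : q ∈ dampedFibre W F c σ) :
    slide ψ c (Metric.ball z r) U' q ∈ dampedFibre W F c σ' := by
  by_cases h : q ∈ ψ.source ∧ (ψ q).2 ∈ Metric.ball z r
  · have hmem := hψ.mem_target hc (hU'.mem _ h.2) h.2
    rw [slide_of_mem h.1 h.2]
    refine ⟨hψ.source_subset (ψ.map_target hmem), ?_⟩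
    rw [← hψ.fst_eq _ (ψ.map_target hmem), ψ.right_inv hmem,
      (hU'.eq_iff _ h.2 _ (hU'.mem _ h.2)).2 rfl]
  · rw [slide_of_notMem h]
    refine ⟨hq.1, ?_⟩
    rw [hq.2, hσσ' fun hA => h ⟨hA.1, hψ.snd_mem_ball hA⟩]

include hψ hσσ' hU' in
lemma slide_eq_self (hσ' : ∀ q, σ' q ∈ Set.Icc 0 1) {q : X} (hq : q ∈ dampedFibre W F c σ)
    (hqA : q ∉ chartClosedBall ψ (0, z) (2 * r / 3)) :
    slide ψ c (Metric.ball z r) U' q = q := by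
  by_cases h : q ∈ ψ.source ∧ (ψ q).2 ∈ Metric.ball z r
  · rw [slide_of_mem h.1 h.2]
    exact hψ.symm_graph_eq hU' hσ' (by rw [hq.2, hσσ' hqA]) h.1 h.2
  · exact slide_of_notMem h

include hψ hc hσσ' hU' in
lemma continuousOn_slide [T2Space X] (hσ' : ∀ q, σ' q ∈ Set.Icc 0 1) :
    ContinuousOn (slide ψ c (Metric.ball z r) U') (dampedFibre W F c σ) := by
  intro q hq
  by_cases hqA : q ∈ chartClosedBall ψ (0, z) (2 * r / 3)
  · have hq2 : (ψ q).2 ∈ Metric.ball z r := hψ.snd_mem_ball hqA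
    have hsnd : ContinuousAt (fun q => (ψ q).2) q := (ψ.continuousAt hqA.1).snd
    have hU'q : ContinuousAt (fun q => U' (ψ q).2) q :=
      ContinuousAt.comp (f := fun q => (ψ q).2)
        (hU'.continuousOn.continuousAt (Metric.isOpen_ball.mem_nhds hq2)) hsnd
    have hgraph : ContinuousAt (fun q => ψ.symm (c * U' (ψ q).2, (ψ q).2)) q :=
      ContinuousAt.comp (f := fun q => (c * (U' (ψ q).2 : ℂ), (ψ q).2))
        (ψ.symm.continuousAt (hψ.mem_target hc (hU'.mem _ hq2) hq2))
        (ContinuousAt.prodMk (hU'q.ofReal.const_mul c) hsnd)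
    refine (hgraph.congr ?_).continuousWithinAt
    filter_upwards [ψ.open_source.mem_nhds hqA.1, hsnd (Metric.isOpen_ball.mem_nhds hq2)]
      with p hp hp2 using (slide_of_mem hp hp2).symm
  · have hopen : IsOpen (chartClosedBall ψ (0, z) (2 * r / 3))ᶜ :=
      isOpen_compl_bumpSupport hψ.pos (Metric.ball_subset_closedBall.trans hψ.closedBall_subset)
    have hid := fun p hp => slide_eq_self hψ hσσ' hU' hσ' (q := p) hp
    refine continuousWithinAt_id.congr_of_eventuallyEq ?_ (hid q hq hqA)
    filter_upwards [self_mem_nhdsWithin, mem_nhdsWithin_of_mem_nhds (hopen.mem_nhds hqA)]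
      with p hp hpA using hid p hp hpA

end SameOutside

lemma slide_slide (hψ : IsSmoothChart W F ψ z r) (hc : ‖c‖ ≤ r)
    (hU : IsGraphOver ψ c (Metric.ball z r) σ U) (hU' : IsGraphOver ψ c (Metric.ball z r) σ' U')
    (hσ : ∀ q, σ q ∈ Set.Icc 0 1) {q : X} (hq : q ∈ dampedFibre W F c σ) :
    slide ψ c (Metric.ball z r) U (slide ψ c (Metric.ball z r) U' q) = q := by
  by_cases h : q ∈ ψ.source ∧ (ψ q).2 ∈ Metric.ball z r
  · have hmem := hψ.mem_target hc (hU'.mem _ h.2) h.2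
    have hright := ψ.right_inv hmem
    rw [slide_of_mem h.1 h.2, slide_of_mem (ψ.map_target hmem) (hright.symm ▸ h.2), hright]
    exact hψ.symm_graph_eq hU hσ hq.2 h.1 h.2
  · rw [slide_of_notMem h, slide_of_notMem h]

theorem nonempty_homeomorph_dampedFibre [T2Space X] (hψ : IsSmoothChart W F ψ z r) (hc : ‖c‖ ≤ r)
    (hσ : ∀ q, σ q ∈ Set.Icc 0 1) (hσ' : ∀ q, σ' q ∈ Set.Icc 0 1) (hσc : Continuous σ)
    (hσc' : Continuous σ') (hσψ : ContractsAlong ψ c (Metric.ball z r) σ)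
    (hσψ' : ContractsAlong ψ c (Metric.ball z r) σ')
    (hσσ' : Set.EqOn σ σ' (chartClosedBall ψ (0, z) (2 * r / 3))ᶜ) :
    Nonempty (dampedFibre W F c σ ≃ₜ dampedFibre W F c σ') := by
  have hmem := fun u hu w hw => hψ.mem_target hc (u := u) hu (w := w) hw
  obtain ⟨U, hU⟩ := exists_isGraphOver hmem hσ hσc hσψ
  obtain ⟨U', hU'⟩ := exists_isGraphOver hmem hσ' hσc' hσψ'
  exact ⟨{
    toFun q := ⟨_, slide_mem_dampedFibre hψ hc hσσ' hU' q.2⟩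
    invFun q := ⟨_, slide_mem_dampedFibre hψ hc hσσ'.symm hU q.2⟩
    left_inv q := Subtype.ext (slide_slide hψ hc hU hU' hσ q.2)
    right_inv q := Subtype.ext (slide_slide hψ hc hU' hU hσ' q.2)
    continuous_toFun := Continuous.subtype_mk
      (continuousOn_slide hψ hc hσσ' hU' hσ').domRestrict _
    continuous_invFun := Continuous.subtype_mk
      (continuousOn_slide hψ hc hσσ'.symm hU hσ).domRestrict _ }⟩

end Slide

end SurfaceFibration

end

section

/-! ### Degeneration to a fibre with double points -/

open Filter Topology

namespace SurfaceFibration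

variable {X : Type u} [TopologicalSpace X] {W : Set X} {F : X → ℂ} {c : ℂ}
  {𝒞 : Set (OpenPartialHomeomorph X (ℂ × ℂ))}

/-- A chart in which `F` is the product of the coordinates, together with a bidisc of radius `ε`
around the double point which is covered by the chart. -/
structure IsNodeChart (W : Set X) (F : X → ℂ) (φ : OpenPartialHomeomorph X (ℂ × ℂ)) (ε : ℝ) :
    Prop where
  source_subset : φ.source ⊆ W
  eq_mul : ∀ q ∈ φ.source, F q = (φ q).1 * (φ q).2
  pos : 0 < ε
  ball_subset : Metric.ball 0 ε ⊆ φ.target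

lemma IsNodeChart.dampedFibre_inter {φ : OpenPartialHomeomorph X (ℂ × ℂ)} {ε : ℝ}
    (hφ : IsNodeChart W F φ ε) {σ : X → ℝ} {g : ℂ × ℂ → ℝ}
    (hσ : ∀ q ∈ chartBall φ 0 ε, σ q = g (φ q)) :
    dampedFibre W F c σ ∩ chartBall φ 0 ε =
      φ.source ∩ φ ⁻¹' {v | ‖v‖ < ε ∧ v.1 * v.2 = c * g v} := by
  ext q
  constructor
  · rintro ⟨⟨-, hF⟩, hq⟩
    exact ⟨hq.1, mem_ball_zero_iff.1 hq.2, by rw [← hφ.eq_mul q hq.1, hF, hσ q hq]⟩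
  · rintro ⟨hqφ, hqε, hF⟩
    have hq : q ∈ chartBall φ 0 ε := ⟨hqφ, mem_ball_zero_iff.2 hqε⟩
    exact ⟨⟨hφ.source_subset hqφ, by rw [hφ.eq_mul q hqφ, hF, hσ q hq]⟩, hq⟩

section NodeDamping

variable {ι : Type*} {φ : ι → OpenPartialHomeomorph X (ℂ × ℂ)} {ε : ι → ℝ} {T : Finset ι} {q : X}

/-- A damping which vanishes near the centres of the charts `φ p`, `p ∈ T`, and is `1` away from
them. -/
def nodeDamping (φ : ι → OpenPartialHomeomorph X (ℂ × ℂ)) (ε : ι → ℝ) (T : Finset ι) (q : X) : ℝ :=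
  max 0 (1 - ∑ p ∈ T, bump (φ p) 0 (ε p) q)

lemma nodeDamping_mem_Icc (q : X) : nodeDamping φ ε T q ∈ Set.Icc 0 1 :=
  ⟨le_max_left _ _, max_le zero_le_one
    (sub_le_self _ (Finset.sum_nonneg fun _ _ => bump_nonneg q))⟩

lemma nodeDamping_empty : nodeDamping φ ε ∅ = 1 := by
  funext q
  rw [nodeDamping, Finset.sum_empty, sub_zero, max_eq_right zero_le_one, Pi.one_apply]

lemma nodeDamping_eq_zero {p : ι} (hp : p ∈ T) (hε : 0 < ε p)
    (hq : q ∈ chartBall (φ p) 0 (ε p / 3)) : nodeDamping φ ε T q = 0 := by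
  have hsum : bump (φ p) 0 (ε p) q ≤ ∑ p ∈ T, bump (φ p) 0 (ε p) q :=
    Finset.single_le_sum (fun p _ => bump_nonneg q) hp
  rw [bump_eq_one hε hq] at hsum
  exact max_eq_left (sub_nonpos.2 hsum)

lemma nodeDamping_insert_of_notMem [DecidableEq ι] {p : ι} (hp : p ∉ T) (hε : 0 < ε p)
    (hq : q ∉ chartClosedBall (φ p) 0 (2 * ε p / 3)) :
    nodeDamping φ ε (insert p T) q = nodeDamping φ ε T q := by
  rw [nodeDamping, Finset.sum_insert hp, bump_eq_zero hε hq, zero_add, nodeDamping]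

lemma continuous_nodeDamping [T2Space X] (hφ : ∀ p, IsNodeChart W F (φ p) (ε p)) :
    Continuous (nodeDamping φ ε T) :=
  continuous_const.max (continuous_const.sub
    (continuous_finsetSum _ fun p _ => continuous_bump (hφ p).pos (hφ p).ball_subset))

lemma chartLipschitz_nodeDamping [T2Space X] (h𝒞 : LipschitzCompatible 𝒞) (hφ𝒞 : ∀ p, φ p ∈ 𝒞)
    (hφ : ∀ p, IsNodeChart W F (φ p) (ε p)) : ChartLipschitz 𝒞 (nodeDamping φ ε T) :=
  ChartLipschitz.comp (g := fun x => max 0 (1 - x))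
    (((LipschitzWith.const 1).sub LipschitzWith.id).const_max 0)
    (ChartLipschitz.sum T fun p _ =>
      chartLipschitz_bump h𝒞 (hφ𝒞 p) (hφ p).pos (hφ p).ball_subset)

variable (hφ : ∀ p, IsNodeChart W F (φ p) (ε p))
  (hdisj : Pairwise fun p p' => Disjoint (chartBall (φ p) 0 (ε p)) (chartBall (φ p') 0 (ε p')))
include hφ hdisj

lemma sum_bump_eq_zero {p : ι} (hp : p ∉ T) (hq : q ∈ chartBall (φ p) 0 (ε p)) :
    ∑ p' ∈ T, bump (φ p') 0 (ε p') q = 0 := by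
  refine Finset.sum_eq_zero fun p' hp' => bump_eq_zero (hφ p').pos fun hq' => ?_
  refine Set.disjoint_left.1 (hdisj (ne_of_mem_of_not_mem hp' hp)) ?_ hq
  exact chartClosedBall_subset_chartBall _ _ (by linarith [(hφ p').pos]) hq'

lemma eulerNumber_nodeDamping_insert [T2Space X] [DecidableEq ι] {p : ι} (hp : p ∉ T) (hc₀ : c ≠ 0)
    (hc : ‖c‖ < (ε p / 3) ^ 2) (hfin : HasFiniteHomology (dampedFibre W F c (nodeDamping φ ε T))) :
    HasFiniteHomology (dampedFibre W F c (nodeDamping φ ε (insert p T))) ∧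
      eulerNumber (dampedFibre W F c (nodeDamping φ ε (insert p T))) =
        eulerNumber (dampedFibre W F c (nodeDamping φ ε T)) + 1 := by
  refine eulerNumber_node (φ p) (hφ p).pos hc₀ hc (hφ p).ball_subset ?_ ?_ ?_ hfin
  · refine (hφ p).dampedFibre_inter (g := fun v => 1 - cutoff (‖v‖ / ε p)) fun q hq => ?_
    rw [nodeDamping, Finset.sum_insert hp, sum_bump_eq_zero hφ hdisj hp hq, add_zero,
      bump_of_mem hq.1, sub_zero, max_eq_right (sub_nonneg.2 (cutoff_le_one _))]
  · refine ((hφ p).dampedFibre_inter (g := 1) fun q hq => ?_).trans ?_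
    · rw [nodeDamping, sum_bump_eq_zero hφ hdisj hp hq, sub_zero, max_eq_right zero_le_one,
        Pi.one_apply]
    · simp only [Pi.one_apply, Complex.ofReal_one, mul_one]
  · ext q
    refine and_congr_left fun hq => and_congr_right fun _ => ?_
    rw [nodeDamping_insert_of_notMem hp (hφ p).pos hq]

theorem eulerNumber_nodeDamping [T2Space X] (hc₀ : c ≠ 0) (hc : ∀ p, ‖c‖ < (ε p / 3) ^ 2)
    (T : Finset ι) (hfin : HasFiniteHomology ↥(W ∩ F ⁻¹' {c})) :
    HasFiniteHomology (dampedFibre W F c (nodeDamping φ ε T)) ∧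
      eulerNumber (dampedFibre W F c (nodeDamping φ ε T)) =
        eulerNumber ↥(W ∩ F ⁻¹' {c}) + T.card := by
  classical
  induction T using Finset.induction_on with
  | empty =>
    rw [nodeDamping_empty, dampedFibre_one, Finset.card_empty, Nat.cast_zero, add_zero]
    exact ⟨hfin, rfl⟩
  | insert p T hp ih =>
    obtain ⟨hfin', heuler⟩ := eulerNumber_nodeDamping_insert hφ hdisj hp hc₀ (hc p) ih.1
    refine ⟨hfin', ?_⟩
    rw [heuler, ih.2, Finset.card_insert_of_notMem hp, Nat.cast_succ, add_assoc]

end NodeDamping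

section ChartDamping

variable {κ : Type*} {ψ : κ → OpenPartialHomeomorph X (ℂ × ℂ)} {z : κ → ℂ} {r : κ → ℝ}
  {t : Finset κ} {τ : X → ℝ} {q : X}

/-- The part of the damping `τ` which is supported in the charts `ψ i`, `i ∈ t`. -/
def chartDamping (τ : X → ℝ) (ψ : κ → OpenPartialHomeomorph X (ℂ × ℂ)) (z : κ → ℂ) (r : κ → ℝ)
    (t : Finset κ) (q : X) : ℝ :=
  min (τ q) (∑ i ∈ t, bump (ψ i) (0, z i) (r i) q)

lemma chartDamping_mem_Icc (hτ : ∀ q, τ q ∈ Set.Icc 0 1) (q : X) :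
    chartDamping τ ψ z r t q ∈ Set.Icc 0 1 :=
  ⟨le_min (hτ q).1 (Finset.sum_nonneg fun _ _ => bump_nonneg q),
    (min_le_left _ _).trans (hτ q).2⟩

lemma chartDamping_empty (hτ : ∀ q, τ q ∈ Set.Icc 0 1) : chartDamping τ ψ z r ∅ = 0 := by
  funext q
  rw [chartDamping, Finset.sum_empty, min_eq_right (hτ q).1, Pi.zero_apply]

lemma chartDamping_of_eq_zero (hq : τ q = 0) : chartDamping τ ψ z r t q = τ q :=
  min_eq_left (hq ▸ Finset.sum_nonneg fun _ _ => bump_nonneg q)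

lemma chartDamping_of_mem (hτ : ∀ q, τ q ∈ Set.Icc 0 1) {i : κ} (hi : i ∈ t) (hr : 0 < r i)
    (hq : q ∈ chartBall (ψ i) (0, z i) (r i / 3)) : chartDamping τ ψ z r t q = τ q := by
  have hsum : bump (ψ i) (0, z i) (r i) q ≤ ∑ i ∈ t, bump (ψ i) (0, z i) (r i) q :=
    Finset.single_le_sum (f := fun i => bump (ψ i) (0, z i) (r i) q)
      (fun i _ => bump_nonneg q) hi
  rw [bump_eq_one hr hq] at hsum
  exact min_eq_left ((hτ q).2.trans hsum)

variable [T2Space X]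

lemma continuous_chartDamping (hψ : ∀ i, IsSmoothChart W F (ψ i) (z i) (r i)) (hτ : Continuous τ) :
    Continuous (chartDamping τ ψ z r t) :=
  hτ.min (continuous_finsetSum _ fun i _ => continuous_bump (hψ i).pos
    (Metric.ball_subset_closedBall.trans (hψ i).closedBall_subset))

lemma chartLipschitz_chartDamping (h𝒞 : LipschitzCompatible 𝒞) (hψ𝒞 : ∀ i, ψ i ∈ 𝒞)
    (hψ : ∀ i, IsSmoothChart W F (ψ i) (z i) (r i)) (hτ : ChartLipschitz 𝒞 τ) :
    ChartLipschitz 𝒞 (chartDamping τ ψ z r t) :=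
  hτ.min (ChartLipschitz.sum t fun i _ => chartLipschitz_bump h𝒞 (hψ𝒞 i) (hψ i).pos
    (Metric.ball_subset_closedBall.trans (hψ i).closedBall_subset))

theorem eventually_homeomorph_chartDamping (h𝒞 : LipschitzCompatible 𝒞) (hψ𝒞 : ∀ i, ψ i ∈ 𝒞)
    (hψ : ∀ i, IsSmoothChart W F (ψ i) (z i) (r i)) (hτ : ∀ q, τ q ∈ Set.Icc 0 1)
    (hτc : Continuous τ) (hτ𝒞 : ChartLipschitz 𝒞 τ) (t : Finset κ) :
    ∀ᶠ c : ℂ in 𝓝 0,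
      Nonempty (↥(W ∩ F ⁻¹' {0}) ≃ₜ dampedFibre W F c (chartDamping τ ψ z r t)) := by
  classical
  induction t using Finset.induction_on with
  | empty =>
    refine Eventually.of_forall fun c => ?_
    rw [chartDamping_empty hτ, dampedFibre_zero]
    exact ⟨.refl _⟩
  | insert a t ha ih =>
    have hcontracts (t : Finset κ) := eventually_contractsAlong
      (chartLipschitz_chartDamping (t := t) h𝒞 hψ𝒞 hψ hτ𝒞) (hψ𝒞 a) (hψ a)
    filter_upwards [ih, hcontracts t, hcontracts (insert a t),
      Metric.closedBall_mem_nhds (0 : ℂ) (hψ a).pos] with c ⟨e⟩ ht hat hc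
    have hEqOn : Set.EqOn (chartDamping τ ψ z r t) (chartDamping τ ψ z r (insert a t))
        (chartClosedBall (ψ a) (0, z a) (2 * r a / 3))ᶜ := fun q hq => by
      rw [chartDamping, chartDamping, Finset.sum_insert ha, bump_eq_zero (hψ a).pos hq, zero_add]
    obtain ⟨e'⟩ := nonempty_homeomorph_dampedFibre (hψ a) (mem_closedBall_zero_iff.1 hc)
      (chartDamping_mem_Icc hτ) (chartDamping_mem_Icc hτ) (continuous_chartDamping hψ hτc)
      (continuous_chartDamping hψ hτc) ht hat hEqOn
    exact ⟨e.trans e'⟩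

end ChartDamping

lemma exists_isNodeChart {φ : OpenPartialHomeomorph X (ℂ × ℂ)} {p : X} (hp : p ∈ φ.source)
    (hφW : φ.source ⊆ W) (hφp : φ p = 0) (hF : ∀ q ∈ φ.source, F q = (φ q).1 * (φ q).2)
    {V : Set X} (hV : V ∈ 𝓝 p) :
    ∃ ε, IsNodeChart W F φ ε ∧ p ∈ chartBall φ 0 (ε / 3) ∧ chartBall φ 0 ε ⊆ V := by
  have hsymm : Tendsto φ.symm (𝓝 0) (𝓝 p) := hφp ▸ φ.tendsto_symm hp
  obtain ⟨ε, hε, hball⟩ := Metric.mem_nhds_iff.1 (inter_mem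
    (hφp ▸ φ.open_target.mem_nhds (φ.map_source hp)) (hsymm hV))
  refine ⟨ε, ⟨hφW, hF, hε, hball.trans Set.inter_subset_left⟩, ⟨hp, ?_⟩, fun q hq => ?_⟩
  · rw [Set.mem_preimage, hφp]
    exact Metric.mem_ball_self (by positivity)
  · have := (hball hq.2).2
    rwa [Set.mem_preimage, φ.left_inv hq.1] at this

lemma exists_isSmoothChart {ψ : OpenPartialHomeomorph X (ℂ × ℂ)} {p : X} (hp : p ∈ ψ.source)
    (hψW : ψ.source ⊆ W) (hF : ∀ q ∈ ψ.source, (ψ q).1 = F q) (hFp : F p = 0) :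
    ∃ z r, IsSmoothChart W F ψ z r ∧ p ∈ chartBall ψ (0, z) (r / 3) := by
  have hψp : ψ p = (0, (ψ p).2) := Prod.ext ((hF p hp).trans hFp) rfl
  obtain ⟨r, hr, hball⟩ := Metric.nhds_basis_closedBall.mem_iff.1
    (ψ.open_target.mem_nhds (ψ.map_source hp))
  refine ⟨(ψ p).2, r, ⟨hψW, hF, hr, hψp ▸ hball⟩, hp, ?_⟩
  rw [Set.mem_preimage, ← hψp]
  exact Metric.mem_ball_self (by positivity)

variable [T2Space X]

/-- The damped fibre with the damping `nodeDamping` is seen in two ways: as the fibre over `c` with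
the double points pinched, and, since the damping is supported in the charts `ψ i` near the fibre
over `0`, as a deformation of the latter. -/
theorem eulerNumber_degeneration_of_charts (h𝒞 : LipschitzCompatible 𝒞)
    {ι κ : Type*} [Fintype ι] {φ : ι → OpenPartialHomeomorph X (ℂ × ℂ)} {ε : ι → ℝ}
    (hφ𝒞 : ∀ p, φ p ∈ 𝒞) (hφ : ∀ p, IsNodeChart W F (φ p) (ε p))
    (hdisj : Pairwise fun p p' => Disjoint (chartBall (φ p) 0 (ε p)) (chartBall (φ p') 0 (ε p')))
    {ψ : κ → OpenPartialHomeomorph X (ℂ × ℂ)} {z : κ → ℂ} {r : κ → ℝ} (hψ𝒞 : ∀ i, ψ i ∈ 𝒞)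
    (hψ : ∀ i, IsSmoothChart W F (ψ i) (z i) (r i)) (t : Finset κ)
    (hcover : ∀ᶠ c : ℂ in 𝓝 0, W ∩ F ⁻¹' {c} ⊆ (⋃ p, chartBall (φ p) 0 (ε p / 3)) ∪
      ⋃ i ∈ t, chartBall (ψ i) (0, z i) (r i / 3)) :
    ∀ᶠ c : ℂ in 𝓝[≠] 0, HasFiniteHomology ↥(W ∩ F ⁻¹' {c}) →
      HasFiniteHomology ↥(W ∩ F ⁻¹' {0}) ∧
        eulerNumber ↥(W ∩ F ⁻¹' {0}) = eulerNumber ↥(W ∩ F ⁻¹' {c}) + Fintype.card ι := by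
  let τ : X → ℝ := nodeDamping φ ε Finset.univ
  have hτ (q : X) : τ q ∈ Set.Icc 0 1 := nodeDamping_mem_Icc q
  have hcores : Set.EqOn (chartDamping τ ψ z r t) τ ((⋃ p, chartBall (φ p) 0 (ε p / 3)) ∪
      ⋃ i ∈ t, chartBall (ψ i) (0, z i) (r i / 3)) := by
    rintro q (hq | hq)
    · obtain ⟨p, hq⟩ := Set.mem_iUnion.1 hq
      exact chartDamping_of_eq_zero (nodeDamping_eq_zero (Finset.mem_univ p) (hφ p).pos hq)
    · obtain ⟨i, hi, hq⟩ := Set.mem_iUnion₂.1 hq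
      exact chartDamping_of_mem hτ hi (hψ i).pos hq
  have hnorm : ∀ᶠ c : ℂ in 𝓝 0, ∀ p, ‖c‖ < (ε p / 3) ^ 2 := eventually_all.2 fun p => by
    have := (hφ p).pos
    exact (continuous_norm.tendsto' 0 0 norm_zero).eventually_lt_const (by positivity)
  obtain ⟨δ, hδ, hcover⟩ := Metric.eventually_nhds_iff_ball.1 hcover
  filter_upwards [self_mem_nhdsWithin, nhdsWithin_le_nhds hnorm,
    nhdsWithin_le_nhds (Metric.ball_mem_nhds (0 : ℂ) hδ), nhdsWithin_le_nhds
      (eventually_homeomorph_chartDamping h𝒞 hψ𝒞 hψ hτ (continuous_nodeDamping hφ)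
        (chartLipschitz_nodeDamping h𝒞 hφ𝒞 hφ) t)] with c hc₀ hcε hcδ ⟨e⟩ hfin
  have heq : dampedFibre W F c (chartDamping τ ψ z r t) = dampedFibre W F c τ := by
    refine dampedFibre_congr (fun q hqW hqc => ?_) (chartDamping_mem_Icc hτ) hτ hcores
    refine hcover (F q) (mem_ball_zero_iff.2 ?_) ⟨hqW, rfl⟩
    exact hqc.trans_lt (mem_ball_zero_iff.1 hcδ)
  rw [heq] at e
  obtain ⟨hfinτ, heuler⟩ := eulerNumber_nodeDamping hφ hdisj hc₀ hcε Finset.univ hfin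
  exact ⟨hfinτ.of_homeomorph e.symm, (eulerNumber_congr_homeomorph e).trans heuler⟩

theorem eulerNumber_degeneration (h𝒞 : LipschitzCompatible 𝒞) (hcpt : IsCompact (W ∩ F ⁻¹' {0}))
    (htube : ∀ O, IsOpen O → W ∩ F ⁻¹' {0} ⊆ O → ∀ᶠ c : ℂ in 𝓝 0, W ∩ F ⁻¹' {c} ⊆ O)
    (S : Finset X)
    (hnode : ∀ p ∈ S, ∃ φ ∈ 𝒞, p ∈ φ.source ∧ φ.source ⊆ W ∧ φ p = 0 ∧
      ∀ q ∈ φ.source, F q = (φ q).1 * (φ q).2)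
    (hsmooth : ∀ p ∈ W ∩ F ⁻¹' {0}, p ∉ S → ∃ ψ ∈ 𝒞, p ∈ ψ.source ∧ ψ.source ⊆ W ∧
      ∀ q ∈ ψ.source, (ψ q).1 = F q) :
    ∀ᶠ c : ℂ in 𝓝[≠] 0, HasFiniteHomology ↥(W ∩ F ⁻¹' {c}) →
      HasFiniteHomology ↥(W ∩ F ⁻¹' {0}) ∧
        eulerNumber ↥(W ∩ F ⁻¹' {0}) = eulerNumber ↥(W ∩ F ⁻¹' {c}) + S.card := by
  obtain ⟨V, hV, hVdisj⟩ := S.finite_toSet.t2_separation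
  have hnodes (p : S) : ∃ φ ∈ 𝒞, ∃ ε, IsNodeChart W F φ ε ∧ p.1 ∈ chartBall φ 0 (ε / 3) ∧
      chartBall φ 0 ε ⊆ V p := by
    obtain ⟨φ, hφ𝒞, hpφ, hφW, hφp, hF⟩ := hnode p p.2
    exact ⟨φ, hφ𝒞, exists_isNodeChart hpφ hφW hφp hF ((hV p).2.mem_nhds (hV p).1)⟩
  choose φ hφ𝒞 ε hφ hpφ hφV using hnodes
  let O₁ : Set X := ⋃ p, chartBall (φ p) 0 (ε p / 3)
  have hO₁ : IsOpen O₁ := isOpen_iUnion fun p => isOpen_chartBall _ _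
  have hsmooths (p : ↥((W ∩ F ⁻¹' {0}) \ O₁)) :
      ∃ ψ ∈ 𝒞, ∃ z r, IsSmoothChart W F ψ z r ∧ p.1 ∈ chartBall ψ (0, z) (r / 3) := by
    have hpS : p.1 ∉ S := fun hp => p.2.2 (Set.mem_iUnion.2 ⟨⟨p, hp⟩, hpφ ⟨p, hp⟩⟩)
    obtain ⟨ψ, hψ𝒞, hpψ, hψW, hF⟩ := hsmooth p p.2.1 hpS
    exact ⟨ψ, hψ𝒞, exists_isSmoothChart hpψ hψW hF p.2.1.2⟩
  choose ψ hψ𝒞 z r hψ hpψ using hsmooths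
  obtain ⟨t, ht⟩ := (hcpt.diff hO₁).elim_nhds_subcover'
    (fun p hp => chartBall (ψ ⟨p, hp⟩) (0, z ⟨p, hp⟩) (r ⟨p, hp⟩ / 3))
    (fun p hp => (isOpen_chartBall _ _).mem_nhds (hpψ ⟨p, hp⟩))
  have hcover := htube (O₁ ∪ ⋃ p ∈ t, chartBall (ψ p) (0, z p) (r p / 3))
    (hO₁.union (isOpen_biUnion fun p _ => isOpen_chartBall _ _)) (Set.sdiff_subset_iff.1 ht)
  have hdisj : Pairwise fun p p' : S =>
      Disjoint (chartBall (φ p) 0 (ε p)) (chartBall (φ p') 0 (ε p')) := fun p p' hpp' =>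
    (hVdisj p.2 p'.2 (Subtype.coe_injective.ne hpp')).mono (hφV p) (hφV p')
  simpa only [Fintype.card_coe] using
    eulerNumber_degeneration_of_charts h𝒞 hφ𝒞 hφ hdisj hψ𝒞 hψ t hcover

end SurfaceFibration

end

section

/-! ### Local structure of a holomorphic map from a surface to a curve -/

open Filter Topology

namespace SurfaceFibration

section Slice

variable {X : Type*} [TopologicalSpace X] {ψ : OpenPartialHomeomorph X (ℂ × ℂ)} {P : Set X} {c : ℂ}

lemma symm_mem_of_forall_mem_iff (hP : ∀ q ∈ ψ.source, q ∈ P ↔ (ψ q).1 = c) {z : ℂ}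
    (hz : (c, z) ∈ ψ.target) : ψ.symm (c, z) ∈ P :=
  (hP _ (ψ.map_target hz)).2 (by rw [ψ.right_inv hz])

lemma mk_snd_eq_of_forall_mem_iff (hP : ∀ q ∈ ψ.source, q ∈ P ↔ (ψ q).1 = c) {q : X} (hqP : q ∈ P)
    (hq : q ∈ ψ.source) : (c, (ψ q).2) = ψ q :=
  Prod.ext ((hP _ hq).1 hqP).symm rfl

open Classical in
/-- The chart of `P` given by the second coordinate of a chart of the ambient space in which `P` is
the locus where the first coordinate is `c`. The point `q₀` is the value of the inverse outside the
target. -/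
def sliceChart (hP : ∀ q ∈ ψ.source, q ∈ P ↔ (ψ q).1 = c) (q₀ : P) : OpenPartialHomeomorph P ℂ where
  toFun q := (ψ q).2
  invFun z := if hz : (c, z) ∈ ψ.target then ⟨_, symm_mem_of_forall_mem_iff hP hz⟩ else q₀
  source := {q | q.1 ∈ ψ.source}
  target := {z | (c, z) ∈ ψ.target}
  map_source' q hq := by
    rw [Set.mem_ofPred_eq, mk_snd_eq_of_forall_mem_iff hP q.2 hq]
    exact ψ.map_source hq
  map_target' z (hz : (c, z) ∈ ψ.target) := by
    rw [dif_pos hz]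
    exact ψ.map_target hz
  left_inv' q hq := by
    simp only [mk_snd_eq_of_forall_mem_iff hP q.2 hq, ψ.map_source hq, ψ.left_inv hq, dif_pos]
  right_inv' z (hz : (c, z) ∈ ψ.target) := by rw [dif_pos hz, ψ.right_inv hz]
  open_source := ψ.open_source.preimage continuous_subtype_val
  open_target := ψ.open_target.preimage (by fun_prop)
  continuousOn_toFun := continuous_snd.comp_continuousOn
    (ψ.continuousOn.comp continuous_subtype_val.continuousOn fun _ hq => hq)
  continuousOn_invFun := by
    rw [Topology.IsInducing.subtypeVal.continuousOn_iff]
    refine (ψ.continuousOn_symm.comp (f := fun z => (c, z)) (by fun_prop) fun _ hz => hz).congr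
      fun z (hz : (c, z) ∈ ψ.target) => ?_
    simp only [Function.comp_apply, dif_pos hz]

end Slice

section SmoothCharts

variable {X : Type*} [TopologicalSpace X] [ChartedSpace (ℂ × ℂ) X]

variable (X) in
/-- The charts of a complex surface which are continuously differentiable along with their
inverses. -/
def smoothCharts : Set (OpenPartialHomeomorph X (ℂ × ℂ)) :=
  {ψ | ∀ q ∈ ψ.source, ContMDiffAt 𝓘(ℂ, ℂ × ℂ) 𝓘(ℂ, ℂ × ℂ) 1 ψ q ∧
    ContMDiffAt 𝓘(ℂ, ℂ × ℂ) 𝓘(ℂ, ℂ × ℂ) 1 ψ.symm (ψ q)}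

lemma lipschitzCompatible_smoothCharts : LipschitzCompatible (smoothCharts X) := by
  intro ψ hψ ψ' hψ' q hq hq'
  have htransition : ContMDiffAt 𝓘(ℂ, ℂ × ℂ) 𝓘(ℂ, ℂ × ℂ) 1 (ψ' ∘ ψ.symm) (ψ q) :=
    ContMDiffAt.comp (ψ q) (by rw [ψ.left_inv hq]; exact (hψ' q hq').1) (hψ q hq).2
  exact htransition.contDiffAt.exists_lipschitzOnWith

lemma maximalAtlas_subset_smoothCharts [IsManifold 𝓘(ℂ, ℂ × ℂ) ω X] :
    IsManifold.maximalAtlas 𝓘(ℂ, ℂ × ℂ) ω X ⊆ smoothCharts X := fun φ hφ _ hq =>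
  ⟨((contMDiffOn_of_mem_maximalAtlas hφ).contMDiffAt (φ.open_source.mem_nhds hq)).of_le le_top,
    ((contMDiffOn_symm_of_mem_maximalAtlas hφ).contMDiffAt
      (φ.open_target.mem_nhds (φ.map_source hq))).of_le le_top⟩

lemma chartAt_mem_smoothCharts [IsManifold 𝓘(ℂ, ℂ × ℂ) ω X] (q : X) :
    chartAt (ℂ × ℂ) q ∈ smoothCharts X :=
  maximalAtlas_subset_smoothCharts (IsManifold.chart_mem_maximalAtlas q)

lemma mdifferentiable_of_mem_smoothCharts {φ : OpenPartialHomeomorph X (ℂ × ℂ)}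
    (hφ : φ ∈ smoothCharts X) : φ.MDifferentiable 𝓘(ℂ, ℂ × ℂ) 𝓘(ℂ, ℂ × ℂ) := by
  refine ⟨fun q hq => ((hφ q hq).1.mdifferentiableAt one_ne_zero).mdifferentiableWithinAt,
    fun v hv => ?_⟩
  have hsymm := (hφ _ (φ.map_target hv)).2
  rw [φ.right_inv hv] at hsymm
  exact (hsymm.mdifferentiableAt one_ne_zero).mdifferentiableWithinAt

lemma exists_mem_smoothCharts_comp {φ : OpenPartialHomeomorph X (ℂ × ℂ)} (hφ : φ ∈ smoothCharts X)
    {q : X} (hq : q ∈ φ.source) {U : Set X} (hU : U ∈ 𝓝 q) {H : ℂ × ℂ → ℂ × ℂ}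
    (hH : ContDiffAt ℂ 1 H (φ q)) {e : (ℂ × ℂ) ≃L[ℂ] ℂ × ℂ}
    (he : HasFDerivAt H (e : ℂ × ℂ →L[ℂ] ℂ × ℂ) (φ q)) :
    ∃ ψ ∈ smoothCharts X, q ∈ ψ.source ∧ ψ.source ⊆ U ∧ ψ.source ⊆ φ.source ∧
      ∀ p, ψ p = H (φ p) := by
  let h := hH.toOpenPartialHomeomorph H he one_ne_zero
  let V : Set X := {p | p ∈ U ∧ ContDiffAt ℂ 1 H (φ p) ∧ ContDiffAt ℂ 1 h.symm (H (φ p))}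
  have hV : V ∈ 𝓝 q := by
    filter_upwards [hU, (φ.continuousAt hq).eventually (hH.eventually (by simp)),
      (hH.continuousAt.comp (φ.continuousAt hq)).eventually
        ((hH.to_localInverse he one_ne_zero).eventually (by simp))] with p hpU hpH hph
    exact ⟨hpU, hpH, hph⟩
  refine ⟨(φ.trans h).restr V, ?_,
    ⟨⟨hq, hH.mem_toOpenPartialHomeomorph_source he one_ne_zero⟩, mem_interior_iff_mem_nhds.2 hV⟩,
    fun p hp => (interior_subset hp.2).1, fun p hp => hp.1.1, fun _ => rfl⟩
  rintro p ⟨⟨hpφ, hph⟩, hpV⟩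
  obtain ⟨-, hpH, hpsymm⟩ := interior_subset hpV
  have hleft : h.symm (H (φ p)) = φ p := h.left_inv hph
  exact ⟨ContMDiffAt.comp (g := H) (f := φ) p hpH.contMDiffAt (hφ p hpφ).1,
    ContMDiffAt.comp (g := φ.symm) (f := h.symm) (H (φ p)) (by rw [hleft]; exact (hφ p hpφ).2)
      hpsymm.contMDiffAt⟩

end SmoothCharts

section FibreEquation

variable {X B : Type u} [TopologicalSpace B] [ChartedSpace ℂ B]

/-- The function `t ∘ f - t s`, for the preferred local coordinate `t` of the curve at `s`; it is a
local equation of the fibre of `f` over `s`. -/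
def fibreEquation (f : X → B) (s : B) (q : X) : ℂ := chartAt ℂ s (f q) - chartAt ℂ s s

variable {f : X → B} {s : B} {q : X}

lemma fibreEquation_eq_sub_iff (hq : f q ∈ (chartAt ℂ s).source) {s' : B}
    (hs' : s' ∈ (chartAt ℂ s).source) :
    fibreEquation f s q = chartAt ℂ s s' - chartAt ℂ s s ↔ f q = s' :=
  sub_left_inj.trans ((chartAt ℂ s).injOn.eq_iff hq hs')

lemma fibreEquation_eq_zero_iff (hq : f q ∈ (chartAt ℂ s).source) :
    fibreEquation f s q = 0 ↔ f q = s := by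
  rw [← sub_self (chartAt ℂ s s), fibreEquation_eq_sub_iff hq (mem_chart_source ℂ s)]

variable [TopologicalSpace X] [ChartedSpace (ℂ × ℂ) X] [IsManifold 𝓘(ℂ, ℂ) ω B]

lemma contMDiffAt_fibreEquation (hf : ContMDiff 𝓘(ℂ, ℂ × ℂ) 𝓘(ℂ, ℂ) ω f)
    (hq : f q ∈ (chartAt ℂ s).source) :
    ContMDiffAt 𝓘(ℂ, ℂ × ℂ) 𝓘(ℂ, ℂ) ω (fibreEquation f s) q :=
  (((contMDiffOn_chart (I := 𝓘(ℂ, ℂ)) (n := ω)).contMDiffAt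
    ((chartAt ℂ s).open_source.mem_nhds hq)).comp q (hf q)).sub contMDiffAt_const

lemma contDiffAt_fibreEquation_comp_symm (hf : ContMDiff 𝓘(ℂ, ℂ × ℂ) 𝓘(ℂ, ℂ) ω f)
    {φ : OpenPartialHomeomorph X (ℂ × ℂ)} (hφ : φ ∈ smoothCharts X) (hqφ : q ∈ φ.source)
    (hq : f q ∈ (chartAt ℂ s).source) :
    ContDiffAt ℂ 1 (fibreEquation f s ∘ φ.symm) (φ q) := by
  have hF : ContMDiffAt 𝓘(ℂ, ℂ × ℂ) 𝓘(ℂ, ℂ) 1 (fibreEquation f s) (φ.symm (φ q)) := by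
    rw [φ.left_inv hqφ]
    exact (contMDiffAt_fibreEquation hf hq).of_le le_top
  exact (hF.comp (φ q) (hφ q hqφ).2).contDiffAt

lemma fderiv_fibreEquation_comp_symm (hf : ContMDiff 𝓘(ℂ, ℂ × ℂ) 𝓘(ℂ, ℂ) ω f)
    {φ : OpenPartialHomeomorph X (ℂ × ℂ)} (hφ : φ ∈ smoothCharts X) (hqφ : q ∈ φ.source)
    (hq : f q ∈ (chartAt ℂ s).source) (v : ℂ × ℂ) :
    fderiv ℂ (fibreEquation f s ∘ φ.symm) (φ q) v = mfderiv 𝓘(ℂ, ℂ) 𝓘(ℂ, ℂ) (chartAt ℂ s) (f q)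
      (mfderiv 𝓘(ℂ, ℂ × ℂ) 𝓘(ℂ, ℂ) f q (mfderiv 𝓘(ℂ, ℂ × ℂ) 𝓘(ℂ, ℂ × ℂ) φ.symm (φ q) v)) := by
  have hqq : φ.symm (φ q) = q := φ.left_inv hqφ
  have hφ' : HasMFDerivAt 𝓘(ℂ, ℂ × ℂ) 𝓘(ℂ, ℂ × ℂ) φ.symm (φ q) _ :=
    ((mdifferentiable_of_mem_smoothCharts hφ).mdifferentiableAt_symm
      (φ.map_source hqφ)).hasMFDerivAt
  have hf' : HasMFDerivAt 𝓘(ℂ, ℂ × ℂ) 𝓘(ℂ, ℂ) f (φ.symm (φ q))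
      (mfderiv 𝓘(ℂ, ℂ × ℂ) 𝓘(ℂ, ℂ) f q) := by
    rw [hqq]
    exact ((hf q).mdifferentiableAt (by simp)).hasMFDerivAt
  have hβ' : HasMFDerivAt 𝓘(ℂ, ℂ) 𝓘(ℂ, ℂ) (chartAt ℂ s) (f (φ.symm (φ q)))
      (mfderiv 𝓘(ℂ, ℂ) 𝓘(ℂ, ℂ) (chartAt ℂ s) (f q)) := by
    rw [hqq]
    exact ((mdifferentiable_chart s).mdifferentiableAt hq).hasMFDerivAt
  have hchain := (hβ'.comp (φ q) (hf'.comp (φ q) hφ')).hasFDerivAt.sub_const (chartAt ℂ s s)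
  exact congrArg (fun l : ℂ × ℂ →L[ℂ] ℂ => l v) hchain.fderiv

lemma isSmoothPoint_iff_fderiv_ne_zero (hf : ContMDiff 𝓘(ℂ, ℂ × ℂ) 𝓘(ℂ, ℂ) ω f)
    {φ : OpenPartialHomeomorph X (ℂ × ℂ)} (hφ : φ ∈ smoothCharts X) (hqφ : q ∈ φ.source)
    (hq : f q ∈ (chartAt ℂ s).source) :
    IsSmoothPoint f q ↔ fderiv ℂ (fibreEquation f s ∘ φ.symm) (φ q) ≠ 0 := by
  have hβ := (mdifferentiable_chart (I := 𝓘(ℂ, ℂ)) s).mfderiv_injective hq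
  have hφsurj := (mdifferentiable_of_mem_smoothCharts hφ).symm.mfderiv_surjective
    (φ.map_source hqφ)
  rw [IsSmoothPoint, not_iff_not]
  refine ⟨fun h => ContinuousLinearMap.ext fun v => ?_,
    fun h => ContinuousLinearMap.ext fun w => hβ ?_⟩
  · rw [fderiv_fibreEquation_comp_symm hf hφ hqφ hq, h]
    exact map_zero _
  · rw [φ.left_inv hqφ] at hφsurj
    obtain ⟨v, rfl⟩ := hφsurj w
    have hGv : fderiv ℂ (fibreEquation f s ∘ φ.symm) (φ q) v = 0 := by rw [h]; rfl
    exact (fderiv_fibreEquation_comp_symm hf hφ hqφ hq v).symm.trans (hGv.trans (map_zero _).symm)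

end FibreEquation

end SurfaceFibration

end

section

/-! ### Nodal fibres and their neighbours -/

open Filter Topology

namespace SurfaceFibration

lemma exists_injective_prod {l : ℂ × ℂ →L[ℂ] ℂ} (hl : l ≠ 0) :
    ∃ m : ℂ × ℂ →L[ℂ] ℂ, Function.Injective (l.prod m) := by
  have hcoord : ∀ v : ℂ × ℂ, l v = v.1 * l (1, 0) + v.2 * l (0, 1) := fun v => by
    simp only [← smul_eq_mul, ← map_smul, ← map_add]
    simp
  by_cases h10 : l (1, 0) = 0
  · have h01 : l (0, 1) ≠ 0 := fun h01 => hl (ContinuousLinearMap.ext fun v => by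
      rw [hcoord, h10, h01, mul_zero, mul_zero, add_zero, zero_apply])
    refine ⟨ContinuousLinearMap.fst ℂ ℂ ℂ, (injective_iff_map_eq_zero _).2 fun v hv => ?_⟩
    obtain ⟨hlv, hfst⟩ : l v = 0 ∧ v.1 = 0 := Prod.mk.inj hv
    rw [hcoord, hfst, zero_mul, zero_add] at hlv
    exact Prod.ext hfst ((mul_eq_zero.1 hlv).resolve_right h01)
  · refine ⟨ContinuousLinearMap.snd ℂ ℂ ℂ, (injective_iff_map_eq_zero _).2 fun v hv => ?_⟩
    obtain ⟨hlv, hsnd⟩ : l v = 0 ∧ v.2 = 0 := Prod.mk.inj hv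
    rw [hcoord, hsnd, zero_mul, add_zero] at hlv
    exact Prod.ext ((mul_eq_zero.1 hlv).resolve_right h10) hsnd

section Curve

variable {B : Type*} [TopologicalSpace B] [ChartedSpace ℂ B]

lemma neBot_nhdsNE_of_chartedSpace (s : B) : (𝓝[≠] s).NeBot := by
  let β := chartAt ℂ s
  have hs : s ∈ β.source := mem_chart_source ℂ s
  have hsymm : Tendsto β.symm (𝓝[≠] (β s)) (𝓝[≠] s) := by
    refine tendsto_nhdsWithin_iff.2 ⟨(β.tendsto_symm hs).mono_left nhdsWithin_le_nhds, ?_⟩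
    filter_upwards [self_mem_nhdsWithin,
      mem_nhdsWithin_of_mem_nhds (β.open_target.mem_nhds (β.map_source hs))] with z hz hzβ hzs
    exact hz (by rw [← β.right_inv hzβ, Set.mem_singleton_iff.1 hzs]; rfl)
  exact hsymm.neBot

lemma tendsto_chartAt_sub_nhdsNE (s : B) :
    Tendsto (fun s' => chartAt ℂ s s' - chartAt ℂ s s) (𝓝[≠] s) (𝓝[≠] 0) := by
  have hs : s ∈ (chartAt ℂ s).source := mem_chart_source ℂ s
  refine tendsto_nhdsWithin_iff.2 ⟨?_, ?_⟩
  · rw [← sub_self (chartAt ℂ s s)]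
    exact (((chartAt ℂ s).continuousAt hs).tendsto.sub_const _).mono_left nhdsWithin_le_nhds
  · filter_upwards [self_mem_nhdsWithin,
      mem_nhdsWithin_of_mem_nhds ((chartAt ℂ s).open_source.mem_nhds hs)] with s' hne hs'
    exact sub_ne_zero.2 ((chartAt ℂ s).injOn.ne hs' hs hne)

end Curve

section Fibre

variable {X B : Type u} [TopologicalSpace B] {f : X → B} {s : B}

lemma isCompact_fibre [TopologicalSpace X] [CompactSpace X] [T1Space B] (hf : Continuous f)
    (s : B) : IsCompact (fibre f s) :=
  (isClosed_singleton.preimage hf).isCompact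

variable [ChartedSpace ℂ B]

lemma inter_preimage_fibreEquation_sub {s' : B} (hs' : s' ∈ (chartAt ℂ s).source) :
    f ⁻¹' (chartAt ℂ s).source ∩ fibreEquation f s ⁻¹' {chartAt ℂ s s' - chartAt ℂ s s} =
      fibre f s' := by
  ext q
  refine ⟨fun hq => (fibreEquation_eq_sub_iff hq.1 hs').1 hq.2, fun hq => ?_⟩
  have hqs : f q ∈ (chartAt ℂ s).source := by rwa [show f q = s' from hq]
  exact ⟨hqs, (fibreEquation_eq_sub_iff hqs hs').2 hq⟩

variable (f s) in
lemma inter_preimage_fibreEquation_zero :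
    f ⁻¹' (chartAt ℂ s).source ∩ fibreEquation f s ⁻¹' {0} = fibre f s := by
  rw [← inter_preimage_fibreEquation_sub (mem_chart_source ℂ s), sub_self]

lemma eventually_inter_preimage_fibreEquation_subset [TopologicalSpace X] [CompactSpace X]
    [T2Space B] (hf : Continuous f) {O : Set X} (hO : IsOpen O) (hs : fibre f s ⊆ O) :
    ∀ᶠ c : ℂ in 𝓝 0, f ⁻¹' (chartAt ℂ s).source ∩ fibreEquation f s ⁻¹' {c} ⊆ O := by
  have hlim : Tendsto (fun c => (chartAt ℂ s).symm (c + chartAt ℂ s s)) (𝓝 0) (𝓝 s) :=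
    ((chartAt ℂ s).tendsto_symm (mem_chart_source ℂ s)).comp
      (Continuous.tendsto' (by fun_prop) _ _ (zero_add _))
  filter_upwards [hlim.eventually (hf.isClosedMap.eventually_nhds_fiber s
    fun _ hp => hO.mem_nhds (hs hp))] with c hc q hq
  refine hc q ?_
  rw [← show fibreEquation f s q = c from hq.2, fibreEquation, sub_add_cancel,
    (chartAt ℂ s).left_inv hq.1]
  rfl

end Fibre

variable {X B : Type u} [TopologicalSpace X] [ChartedSpace (ℂ × ℂ) X] [IsManifold 𝓘(ℂ, ℂ × ℂ) ω X]
  [TopologicalSpace B] [ChartedSpace ℂ B] [IsManifold 𝓘(ℂ, ℂ) ω B] {f : X → B} {s : B}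

lemma exists_smoothChart (hf : ContMDiff 𝓘(ℂ, ℂ × ℂ) 𝓘(ℂ, ℂ) ω f) {q : X}
    (hqs : f q ∈ (chartAt ℂ s).source) (hq : IsSmoothPoint f q) :
    ∃ ψ ∈ smoothCharts X, q ∈ ψ.source ∧ ψ.source ⊆ f ⁻¹' (chartAt ℂ s).source ∧
      ∀ p ∈ ψ.source, (ψ p).1 = fibreEquation f s p := by
  let φ := chartAt (ℂ × ℂ) q
  have hφ : φ ∈ smoothCharts X := chartAt_mem_smoothCharts q
  have hqφ : q ∈ φ.source := mem_chart_source _ q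
  let G : ℂ × ℂ → ℂ := fibreEquation f s ∘ φ.symm
  have hG : ContDiffAt ℂ 1 G (φ q) := contDiffAt_fibreEquation_comp_symm hf hφ hqφ hqs
  obtain ⟨m, hm⟩ :=
    exists_injective_prod ((isSmoothPoint_iff_fderiv_ne_zero hf hφ hqφ hqs).1 hq)
  let e := (LinearEquiv.ofInjectiveEndo ((fderiv ℂ G (φ q)).prod m).toLinearMap hm)
    |>.toContinuousLinearEquiv
  have he : HasFDerivAt (fun v => (G v, m v)) (e : ℂ × ℂ →L[ℂ] ℂ × ℂ) (φ q) :=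
    (hG.differentiableAt one_ne_zero).hasFDerivAt.prodMk m.hasFDerivAt
  obtain ⟨ψ, hψ, hqψ, hψs, hψφ, hψG⟩ := exists_mem_smoothCharts_comp hφ hqφ
    (((chartAt ℂ s).open_source.preimage hf.continuous).mem_nhds hqs)
    (hG.prodMk m.contDiff.contDiffAt) he
  refine ⟨ψ, hψ, hqψ, hψs, fun p hp => ?_⟩
  rw [hψG]
  exact congrArg (fibreEquation f s) (φ.left_inv (hψφ hp))

lemma IsSmoothPoint.eventually (hf : ContMDiff 𝓘(ℂ, ℂ × ℂ) 𝓘(ℂ, ℂ) ω f) {q : X}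
    (hq : IsSmoothPoint f q) : ∀ᶠ p in 𝓝 q, IsSmoothPoint f p := by
  have hφ := chartAt_mem_smoothCharts q
  have hqφ := mem_chart_source (ℂ × ℂ) q
  have hqβ := mem_chart_source ℂ (f q)
  have hderiv := (contDiffAt_fibreEquation_comp_symm hf hφ hqφ hqβ).continuousAt_fderiv one_ne_zero
  filter_upwards [((chartAt (ℂ × ℂ) q).continuousAt hqφ).eventually
      (hderiv.eventually_ne ((isSmoothPoint_iff_fderiv_ne_zero hf hφ hqφ hqβ).1 hq)),
    (chartAt (ℂ × ℂ) q).open_source.mem_nhds hqφ,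
    hf.continuous.continuousAt ((chartAt ℂ (f q)).open_source.mem_nhds hqβ)] with p hp hpφ hpβ
  exact (isSmoothPoint_iff_fderiv_ne_zero hf hφ hpφ hpβ).2 hp

lemma fderiv_fst_mul_snd_eq_zero_iff {v : ℂ × ℂ} :
    fderiv ℂ (fun w : ℂ × ℂ => w.1 * w.2) v = 0 ↔ v = 0 := by
  have hd : HasFDerivAt (fun w : ℂ × ℂ => w.1 * w.2)
      (v.1 • ContinuousLinearMap.snd ℂ ℂ ℂ + v.2 • ContinuousLinearMap.fst ℂ ℂ ℂ) v :=
    hasFDerivAt_fst.mul hasFDerivAt_snd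
  rw [hd.fderiv]
  refine ⟨fun h => Prod.ext ?_ ?_,
    fun h => ContinuousLinearMap.ext fun w => by simp [h]⟩
  · simpa using congrArg (fun l : ℂ × ℂ →L[ℂ] ℂ => l (0, 1)) h
  · simpa using congrArg (fun l : ℂ × ℂ →L[ℂ] ℂ => l (1, 0)) h

lemma isSmoothPoint_iff_ne_zero_of_node (hf : ContMDiff 𝓘(ℂ, ℂ × ℂ) 𝓘(ℂ, ℂ) ω f)
    {φ : OpenPartialHomeomorph X (ℂ × ℂ)} (hφ : φ ∈ IsManifold.maximalAtlas 𝓘(ℂ, ℂ × ℂ) ω X)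
    (hnode : ∀ q ∈ φ.source, f q ∈ (chartAt ℂ s).source ∧
      fibreEquation f s q = (φ q).1 * (φ q).2) {q : X} (hq : q ∈ φ.source) :
    IsSmoothPoint f q ↔ φ q ≠ 0 := by
  have hG : fibreEquation f s ∘ φ.symm =ᶠ[𝓝 (φ q)] fun v => v.1 * v.2 := by
    filter_upwards [φ.open_target.mem_nhds (φ.map_source hq)] with v hv
    rw [Function.comp_apply, (hnode _ (φ.map_target hv)).2, φ.right_inv hv]
  rw [isSmoothPoint_iff_fderiv_ne_zero hf (maximalAtlas_subset_smoothCharts hφ) hq (hnode q hq).1,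
    hG.fderiv_eq, Ne, fderiv_fst_mul_snd_eq_zero_iff]

lemma IsDoublePoint.not_isSmoothPoint (hf : ContMDiff 𝓘(ℂ, ℂ × ℂ) 𝓘(ℂ, ℂ) ω f) {p : X}
    (hp : IsDoublePoint f p) : ¬ IsSmoothPoint f p := by
  obtain ⟨φ, hφ, hpφ, hφp, hnode⟩ := hp
  rw [isSmoothPoint_iff_ne_zero_of_node hf hφ hnode hpφ, not_not]
  exact hφp

lemma IsDoublePoint.eventually_isSmoothPoint (hf : ContMDiff 𝓘(ℂ, ℂ × ℂ) 𝓘(ℂ, ℂ) ω f) {p : X}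
    (hp : IsDoublePoint f p) : ∀ᶠ q in 𝓝[≠] p, IsSmoothPoint f q := by
  obtain ⟨φ, hφ, hpφ, hφp, hnode⟩ := hp
  filter_upwards [self_mem_nhdsWithin,
    mem_nhdsWithin_of_mem_nhds (φ.open_source.mem_nhds hpφ)] with q hqp hq
  rw [isSmoothPoint_iff_ne_zero_of_node hf hφ hnode hq, ← hφp]
  exact φ.injOn.ne hq hpφ hqp

lemma IsSmoothFibre.doublePoints_eq_empty (hf : ContMDiff 𝓘(ℂ, ℂ × ℂ) 𝓘(ℂ, ℂ) ω f)
    (hs : IsSmoothFibre f s) : doublePoints f s = ∅ :=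
  Set.eq_empty_iff_forall_notMem.2 fun p hp => hp.2.not_isSmoothPoint hf (hs p hp.1)

lemma IsSmoothFibre.hasFiniteHomology [T2Space X] [CompactSpace X] [T1Space B]
    (hf : ContMDiff 𝓘(ℂ, ℂ × ℂ) 𝓘(ℂ, ℂ) ω f) (hs : IsSmoothFibre f s) :
    HasFiniteHomology (fibre f s) := by
  have := isCompact_iff_compactSpace.1 (isCompact_fibre hf.continuous s)
  refine hasFiniteHomology_of_charts (E := ℂ) fun q => ?_
  have hqs : f q ∈ (chartAt ℂ s).source := by
    rw [show f q = s from q.2]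
    exact mem_chart_source ℂ s
  obtain ⟨ψ, -, hqψ, hψs, hψ⟩ := exists_smoothChart hf hqs (hs q q.2)
  have hslice : ∀ p ∈ ψ.source, p ∈ fibre f s ↔ (ψ p).1 = 0 := fun p hp => by
    rw [hψ p hp, fibreEquation_eq_zero_iff (hψs hp)]
    rfl
  exact ⟨sliceChart hslice q, hqψ⟩

section Nodal

variable (hf : ContMDiff 𝓘(ℂ, ℂ × ℂ) 𝓘(ℂ, ℂ) ω f)
  (hnodal : ∀ p ∈ fibre f s, IsSmoothPoint f p ∨ IsDoublePoint f p)

include hf hnodal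

lemma eventually_isSmoothPoint_nhdsNE {p : X} (hp : p ∈ fibre f s) :
    ∀ᶠ q in 𝓝[≠] p, IsSmoothPoint f q :=
  (hnodal p hp).elim (fun h => eventually_nhdsWithin_of_eventually_nhds (h.eventually hf))
    fun h => h.eventually_isSmoothPoint hf

lemma finite_doublePoints [CompactSpace X] [T1Space B] : (doublePoints f s).Finite := by
  obtain ⟨t, -, ht⟩ := (isCompact_fibre hf.continuous s).elim_nhds_subcover
    (fun p => {q | q ≠ p → IsSmoothPoint f q}) fun p hp =>
      eventually_nhdsWithin_iff.1 (eventually_isSmoothPoint_nhdsNE hf hnodal hp)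
  refine t.finite_toSet.subset fun q hq => ?_
  obtain ⟨p, hp, hqp⟩ := Set.mem_iUnion₂.1 (ht hq.1)
  have hqp : q = p := not_not.1 fun h => hq.2.not_isSmoothPoint hf (hqp h)
  exact hqp ▸ hp

lemma eventually_isSmoothFibre [CompactSpace X] [T2Space B] :
    ∀ᶠ s' in 𝓝[≠] s, IsSmoothFibre f s' := by
  have hnear : ∀ p ∈ fibre f s, ∀ᶠ q in 𝓝 p, q ∈ fibre f s ∨ IsSmoothPoint f q := fun p hp => by
    filter_upwards [eventually_nhdsWithin_iff.1 (eventually_isSmoothPoint_nhdsNE hf hnodal hp)]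
      with q hq
    exact (eq_or_ne q p).imp (fun hqp : q = p => hqp ▸ hp) hq
  filter_upwards [self_mem_nhdsWithin, mem_nhdsWithin_of_mem_nhds
    (hf.continuous.isClosedMap.eventually_nhds_fiber s hnear)] with s' hne hs' q hq
  exact (hs' q hq).resolve_left fun hqs => hne ((show f q = s' from hq).symm.trans hqs)

theorem eventually_eulerNumber_fibre [T2Space X] [CompactSpace X] [T2Space B] :
    ∀ᶠ s' in 𝓝[≠] s, IsSmoothFibre f s' ∧ HasFiniteHomology (fibre f s) ∧
      eulerNumber (fibre f s) = eulerNumber (fibre f s') + (doublePoints f s).ncard := by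
  let W : Set X := f ⁻¹' (chartAt ℂ s).source
  have hfin : (doublePoints f s).Finite := finite_doublePoints hf hnodal
  have hdegen := eulerNumber_degeneration (W := W) (F := fibreEquation f s)
    lipschitzCompatible_smoothCharts ?_ ?_ hfin.toFinset ?_ ?_
  · filter_upwards [(tendsto_chartAt_sub_nhdsNE s).eventually hdegen,
      eventually_isSmoothFibre hf hnodal, mem_nhdsWithin_of_mem_nhds
        ((chartAt ℂ s).open_source.mem_nhds (mem_chart_source ℂ s))] with s' hs' hsmooth hs's
    rw [inter_preimage_fibreEquation_sub hs's, inter_preimage_fibreEquation_zero,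
      ← Set.ncard_eq_toFinset_card _ hfin] at hs'
    exact ⟨hsmooth, hs' (hsmooth.hasFiniteHomology hf)⟩
  · rw [inter_preimage_fibreEquation_zero]
    exact isCompact_fibre hf.continuous s
  · intro O hO hsub
    rw [inter_preimage_fibreEquation_zero] at hsub
    exact eventually_inter_preimage_fibreEquation_subset hf.continuous hO hsub
  · intro p hp
    obtain ⟨rfl, φ, hφ, hpφ, hφp, hnode⟩ := hfin.mem_toFinset.1 hp
    exact ⟨φ, maximalAtlas_subset_smoothCharts hφ, hpφ, fun q hq => (hnode q hq).1, hφp,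
      fun q hq => (hnode q hq).2⟩
  · intro p hp hpS
    have hps : p ∈ fibre f s := inter_preimage_fibreEquation_zero f s ▸ hp
    exact exists_smoothChart hf hp.1
      ((hnodal p hps).resolve_right fun h => hpS (hfin.mem_toFinset.2 ⟨hps, h⟩))

end Nodal

lemma isLocallyConstant_eulerNumber_sub_ncard [T2Space X] [CompactSpace X] [T2Space B]
    (hf : ContMDiff 𝓘(ℂ, ℂ × ℂ) 𝓘(ℂ, ℂ) ω f)
    (hnodal : ∀ s, ∀ p ∈ fibre f s, IsSmoothPoint f p ∨ IsDoublePoint f p) :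
    IsLocallyConstant fun s => eulerNumber (fibre f s) - ((doublePoints f s).ncard : ℤ) := by
  rw [IsLocallyConstant.iff_eventually_eq]
  intro s
  filter_upwards [eventually_nhdsWithin_iff.1 (eventually_eulerNumber_fibre hf (hnodal s))]
    with s' hs'
  obtain rfl | hne := eq_or_ne s' s
  · rfl
  · obtain ⟨hsmooth, -, heuler⟩ := hs' hne
    rw [hsmooth.doublePoints_eq_empty hf, Set.ncard_empty, heuler]
    simp

end SurfaceFibration

end

end

open SurfaceFibration in
theorem lemma1p3_general {X B : Type u}
    [TopologicalSpace X] [T2Space X] [CompactSpace X]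
    [ChartedSpace (ℂ × ℂ) X] [IsManifold 𝓘(ℂ, ℂ × ℂ) ω X]
    [TopologicalSpace B] [T2Space B] [PreconnectedSpace B]
    [ChartedSpace ℂ B] [IsManifold 𝓘(ℂ, ℂ) ω B]
    {f : X → B} (hf : ContMDiff 𝓘(ℂ, ℂ × ℂ) 𝓘(ℂ, ℂ) ω f)
    (hnodal : ∀ s, ∀ p ∈ fibre f s,
      IsSmoothPoint f p ∨ IsDoublePoint f p)
    (s : B) {t : B} (ht : IsSmoothFibre f t) :
    HasFiniteHomology (fibre f s) ∧
    HasFiniteHomology (fibre f t) ∧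
    (doublePoints f s).Finite ∧
    eulerNumber (fibre f s) -
        eulerNumber (fibre f t) =
      ((doublePoints f s).ncard : ℤ) := by
  have hfin : HasFiniteHomology (fibre f s) := by
    have := neBot_nhdsNE_of_chartedSpace s
    obtain ⟨_, -, hfin, -⟩ :=
      (eventually_eulerNumber_fibre hf (hnodal s)).exists
    exact hfin
  have hst := (isLocallyConstant_eulerNumber_sub_ncard
    hf hnodal).apply_eq_of_preconnectedSpace s t
  rw [ht.doublePoints_eq_empty hf, Set.ncard_empty, Nat.cast_zero, sub_zero] at hst
  exact ⟨hfin, ht.hasFiniteHomology hf, finite_doublePoints hf (hnodal s),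
    by linarith⟩

theorem lemma1p3 {X B : Type u}
    [TopologicalSpace X] [T2Space X] [CompactSpace X] [ConnectedSpace X]
    [ChartedSpace (ℂ × ℂ) X] [IsManifold 𝓘(ℂ, ℂ × ℂ) ω X]
    [TopologicalSpace B] [T2Space B] [CompactSpace B] [ConnectedSpace B]
    [ChartedSpace ℂ B] [IsManifold 𝓘(ℂ, ℂ) ω B]
    (g : ℕ) (f : X → B) (hf : SurfaceFibration.IsSemistableFibration g f)
    (s t : B) (ht : SurfaceFibration.IsSmoothFibre f t) :
    SurfaceFibration.HasFiniteHomology (SurfaceFibration.fibre f s) ∧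
    SurfaceFibration.HasFiniteHomology (SurfaceFibration.fibre f t) ∧
    (SurfaceFibration.doublePoints f s).Finite ∧
    SurfaceFibration.eulerNumber (SurfaceFibration.fibre f s) -
        SurfaceFibration.eulerNumber (SurfaceFibration.fibre f t) =
      ((SurfaceFibration.doublePoints f s).ncard : ℤ) := by
  exact lemma1p3_general hf.holomorphic (fun s => (hf.semistable s).nodal) s ht
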